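/- **Setting.** All trees are rooted and have no node with exactly one child; $\|t\|$ denotes the number of leaves of a tree or forest $t$. A $k$-variable and/or tree is a finite tree whose internal nodes are labelled by $\land$ or $\lor$ and whose leaves are labelled by literals in $\{x_1,\bar x_1,\dots,x_k,\bar x_k\}$; it represents a Boolean function of $k$ variables. The complexity $L(f)$ of a non-constant Boolean function $f$ is the smallest size of an and/or tree that represents $f$, and $L(\mathrm{True})=L(\mathrm{False})=0$. The random $k$-labelling $\hat t$ of a tree (or forest) $t$ gives each internal node a uniform connective and each leaf a uniform literal, all independently. A locally finite tree with a unique end consists of an infinite spine $u_0,u_1,\dots$ (with $u_0$ the root) and of non-empty finite forests $A_0,A_1,\dots$ of finite trees, where the roots of the trees of $A_i$ are children of $u_i$. A labelled tree with a unique end represents $g$ if all its finite parts obtained by cutting the spine between $u_h$ and $u_{h+1}$, with $h$ large enough, represent $g$. *Trimming.* In a labelled tree, the root has the empty set of constraints. If $v$ is a child of $u$, the constraint set of $v$ is that of $u$ together with, for each child $w$ of $u$ that is a leaf, the constraint "the label of $w$ is True" if $u$ is labelled $\land$, and "the label of $w$ is False" if $u$ is labelled $\lor$. The trimmed tree $\mathtt{trim}$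 keeps the nodes whose constraint set is satisfied by some assignment of the variables; its size $\|\mathtt{trim}(\cdot)\|$ is the number of leaves of the original tree that are kept. For a forest hanging from a node, that node is used as the root with a uniform connective. **Hypotheses.** For each $k\ge1$ let $(T_{k,n})_{n\ge0}$ be random finite trees that converge in distribution, for the local topology, to a random tree $T_\infty$ (which may depend on $k$) with a unique end. Suppose that the forests $(A_i)_{i\ge 0}$ hanging from the spine of $T_\infty$ are i.i.d., with a common law, that of a random forest $A$, which does not depend on $k$. Let $L_k=\|\mathtt{trim}(\hat A)\|$ be the size of the trimmed random $k$-labelling of $A$, and suppose that for every integer $m\ge 1$ the moments $\mathbb E[L_k^m]$ are bounded by a constant independent of $k$, for $k$ large. Let $N_m(t)$ be the number of nodes of $t$ at distance at most $m$ from the root, and suppose that for all integers $m\ge1$ (and every $k\geq 1$) 1. $\mathbb E[N_m(T_\infty)^{m+2}]<\infty$, and 2. $\mathbb E[\|\mathtt{trim}(\hat T_\infty)\|^m]<\infty$. For a Boolean function $f$, let $L_A(f)$ be the smallest size of a forest in the support of $A$ that can be labelled so that the disjunction of its trees computes $f$ (and $L_A(f)=\infty$ if there is none). **Conclusion.** For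 every $k\ge 1$ and every $k$-variable Boolean function $g$, the probability that $\hat T_{k,n}$ represents $g$ converges, as $n\to\infty$, to the probability $\mathbb P_k(g)$ that $\hat T_\infty$ represents $g$. Let $k_0$ be an integer and $f$ a $k_0$-variable Boolean function, seen as a $k$-variable function for $k\ge k_0$. There are constants $c,C\in(0,\infty)$ such that for all $k$ large enough $$c\,\frac{\mathbb P_k(\mathrm{True})}{k^{L_A(f)}}\ \le\ \mathbb P_k(f)\ \le\ C\,\frac{\mathbb P_k(\mathrm{True})+\frac1k}{k^{L(f)}}$$ (the lower bound being void if $L_A(f)=\infty$). If moreover $L_A(f)=L(f)$, then $\mathbb P_k(f)=\Theta\big(k^{-(L(f)+1)}\big)$ as $k\to\infty$. -/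

import Mathlib

open MeasureTheory ProbabilityTheory Filter Topology
open scoped ENNReal NNReal

namespace AndOr

/-! ### Rooted trees and forests -/

/-- Finite rooted trees. The list of children is only a presentation: trees are compared up to
isomorphism (`RTree.Iso`), and nothing below depends on the order of the children.
A leaf is `node []`. -/
inductive RTree : Type
  | node : List RTree → RTree

instance : MeasurableSpace RTree := ⊤

/-- Finite forests of finite rooted trees. -/
def Forest : Type := List RTree

instance : MeasurableSpace Forest := ⊤

/-- Isomorphism of rooted trees: the children can be reordered so as to be pairwise isomorphic. -/
inductive RTree.Iso : RTree → RTree → Prop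
  | node {l m l' : List RTree} : List.Perm l m → List.Forall₂ RTree.Iso m l' →
      RTree.Iso (RTree.node l) (RTree.node l')

/-- No node has exactly one child. -/
inductive RTree.NoUnary : RTree → Prop
  | node {l : List RTree} : l.length ≠ 1 → (∀ t ∈ l, RTree.NoUnary t) →
      RTree.NoUnary (RTree.node l)

mutual
/-- The size of a tree: its number of leaves. -/
def RTree.size : RTree → ℕ
  | .node l => if l.isEmpty then 1 else RTree.sizeList l
/-- The size of a forest: its number of leaves. -/
def RTree.sizeList : List RTree → ℕ
  | [] => 0
  | t :: ts => t.size + RTree.sizeList ts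
end

/-- The size of a forest: its number of leaves. -/
def Forest.size (F : Forest) : ℕ := RTree.sizeList F

/-- The forests that can hang from a spine node of a tree without unary nodes. -/
def Forest.Admissible (F : Forest) : Prop :=
  F ≠ ([] : List RTree) ∧ List.Forall RTree.NoUnary F

mutual
/-- The number of nodes of a tree, the root included. -/
def RTree.numNodes : RTree → ℕ
  | .node l => 1 + RTree.numNodesList l
/-- The number of nodes of a forest. -/
def RTree.numNodesList : List RTree → ℕ
  | [] => 0
  | t :: ts => t.numNodes + RTree.numNodesList ts
end

/-- The truncation of a tree at height `h`: only the nodes at distance at most `h` from the root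
are kept. -/
def RTree.trunc : ℕ → RTree → RTree
  | 0, _ => .node []
  | h + 1, .node l => .node (l.map (RTree.trunc h))

/-- A locally finite infinite tree with a unique end: an infinite spine `u₀, u₁, …` starting at the
root `u₀`; the children of `u i` are `u (i + 1)` and the roots of the trees of the finite
forest `a i`. -/
def SpineTree : Type := ℕ → Forest

/-- The subtree of a one-ended tree rooted at the second node of the spine. -/
def SpineTree.tail (a : SpineTree) : SpineTree := fun i => a (i + 1)

/-- The truncation at height `h` of a tree with a unique end. -/
def SpineTree.trunc : ℕ → SpineTree → RTree
  | 0, _ => .node []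
  | h + 1, a => .node (SpineTree.trunc h a.tail :: List.map (RTree.trunc h) (a 0))

/-- `N_m`: the number of nodes at distance at most `m` from the root. -/
def SpineTree.numNodesUpTo (m : ℕ) (a : SpineTree) : ℕ := (a.trunc m).numNodes

/-! ### And/or trees -/

/-- `k`-variable Boolean functions. -/
abbrev BoolFun (k : ℕ) : Type := (Fin k → Bool) → Bool

/-- Literals in `k` variables: `(i, true)` is the variable `x i`, `(i, false)` its negation. -/
abbrev Literal (k : ℕ) : Type := Fin k × Bool

/-- The truth value of a literal. -/
def Literal.eval {k : ℕ} (x : Fin k → Bool) (ℓ : Literal k) : Bool := x ℓ.1 == ℓ.2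

/-- The negation of a literal. -/
def Literal.neg {k : ℕ} (ℓ : Literal k) : Literal k := (ℓ.1, !ℓ.2)

/-- Connectives: `false` is the conjunction, `true` is the disjunction. -/
abbrev Conn : Type := Bool

/-- The conjunction or the disjunction of a list of truth values. -/
def Conn.apply (c : Conn) (l : List Bool) : Bool :=
  if c = true then l.any id else l.all id

/-- Finite trees with leaves labelled by literals and internal nodes labelled by connectives. -/
inductive LTree (k : ℕ) : Type
  | leaf : Literal k → LTree k
  | node : Conn → List (LTree k) → LTree k

/-- And/or trees: every internal node has at least two children. -/
inductive LTree.IsAndOr {k : ℕ} : LTree k → Prop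
  | leaf (ℓ : Literal k) : LTree.IsAndOr (LTree.leaf ℓ)
  | node {c : Conn} {l : List (LTree k)} : 2 ≤ l.length → (∀ t ∈ l, LTree.IsAndOr t) →
      LTree.IsAndOr (LTree.node c l)

mutual
/-- The number of leaves. -/
def LTree.size {k : ℕ} : LTree k → ℕ
  | .leaf _ => 1
  | .node _ l => LTree.sizeList l
/-- The number of leaves of a labelled forest. -/
def LTree.sizeList {k : ℕ} : List (LTree k) → ℕ
  | [] => 0
  | t :: ts => t.size + LTree.sizeList ts
end

mutual
/-- The truth value computed at the root of a labelled tree. -/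
def LTree.eval {k : ℕ} (x : Fin k → Bool) : LTree k → Bool
  | .leaf ℓ => Literal.eval x ℓ
  | .node c l => Conn.apply c (LTree.evalList x l)
/-- The truth values computed at the roots of a labelled forest. -/
def LTree.evalList {k : ℕ} (x : Fin k → Bool) : List (LTree k) → List Bool
  | [] => []
  | t :: ts => t.eval x :: LTree.evalList x ts
end

/-- The Boolean function represented by a labelled tree. -/
def LTree.fn {k : ℕ} (τ : LTree k) : BoolFun k := fun x => τ.eval x

/-- The constant function True. -/
def trueFn (k : ℕ) : BoolFun k := fun _ => true

open Classical in
/-- The complexity `L(f)`: zero if `f` is constant, and otherwise the smallest size of an and/or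
tree that represents `f`. -/
noncomputable def complexity {k : ℕ} (f : BoolFun k) : ℕ :=
  if ∃ b : Bool, ∀ x, f x = b then 0
  else sInf {n | ∃ τ : LTree k, τ.IsAndOr ∧ τ.fn = f ∧ τ.size = n}

/-- A `k₀`-variable Boolean function seen as a function of `k ≥ k₀` variables. -/
def BoolFun.lift {k₀ k : ℕ} (f : BoolFun k₀) (h : k₀ ≤ k) : BoolFun k :=
  fun x => f (fun i => x (Fin.castLE h i))

/-! ### Random labellings -/

mutual
/-- The law of the randomly `k`-labelled version of a tree: every internal node gets a uniform
connective, every leaf a uniform literal, all independent. -/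
noncomputable def RTree.label (k : ℕ) [NeZero k] : RTree → PMF (LTree k)
  | .node l =>
      if l.isEmpty then (PMF.uniformOfFintype (Literal k)).map LTree.leaf
      else (PMF.uniformOfFintype Conn).bind fun c => (RTree.labelList k l).map (LTree.node c)
/-- The law of the random labelling of a forest: the trees are labelled independently. -/
noncomputable def RTree.labelList (k : ℕ) [NeZero k] : List RTree → PMF (List (LTree k))
  | [] => PMF.pure []
  | t :: ts => (RTree.label k t).bind fun τ => (RTree.labelList k ts).map fun τs => τ :: τs
end

/-- `P_k[t](g)`: the probability that the randomly `k`-labelled version of the finite tree `t`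
represents `g`. -/
noncomputable def treeProb (k : ℕ) [NeZero k] (t : RTree) (g : BoolFun k) : ℝ≥0∞ :=
  (RTree.label k t).toOuterMeasure {τ | τ.fn = g}

/-- A labelled node of the spine: its connective and the labelled forest that hangs from it. -/
structure LLevel (k : ℕ) : Type where
  conn : Conn
  forest : List (LTree k)

instance (k : ℕ) : MeasurableSpace (LLevel k) := ⊤

/-- The random labelling of a spine node and of the forest that hangs from it. -/
noncomputable def Forest.label (k : ℕ) [NeZero k] (F : Forest) : PMF (LLevel k) :=
  (PMF.uniformOfFintype Conn).bind fun c => (RTree.labelList k F).map fun l => ⟨c, l⟩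

/-- Labelled trees with a unique end. -/
abbrev LSpineTree (k : ℕ) : Type := ℕ → LLevel k

/-- The law of the randomly `k`-labelled version of a tree with a unique end. -/
noncomputable def SpineTree.label (k : ℕ) [NeZero k] (a : SpineTree) : Measure (LSpineTree k) :=
  Measure.infinitePi fun i => (Forest.label k (a i)).toMeasure

/-- The Boolean function of the finite labelled tree obtained by cutting the spine between its
nodes `u h` and `u (h + 1)`. -/
def LSpineTree.cutEval {k : ℕ} (x : Fin k → Bool) : ℕ → LSpineTree k → Bool
  | 0, σ => Conn.apply (σ 0).conn (LTree.evalList x (σ 0).forest)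
  | h + 1, σ => Conn.apply (σ 0).conn
      (LSpineTree.cutEval x h (fun i => σ (i + 1)) :: LTree.evalList x (σ 0).forest)

/-- The infinite labelled tree `σ` represents `g`: all the trees obtained by cutting the spine far
enough from the root represent `g`. -/
def LSpineTree.Represents {k : ℕ} (σ : LSpineTree k) (g : BoolFun k) : Prop :=
  ∀ᶠ h in atTop, ∀ x, LSpineTree.cutEval x h σ = g x

/-- `P_k[a](g)`: the probability that the randomly `k`-labelled version of the one-ended tree `a`
represents `g`. -/
noncomputable def spineProb (k : ℕ) [NeZero k] (a : SpineTree) (g : BoolFun k) : ℝ≥0∞ :=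
  SpineTree.label k a {σ | σ.Represents g}

/-! ### Trimming -/

/-- The constraint (a literal that has to be true) which a leaf labelled `ℓ` imposes on itself and
on its siblings if the parent is labelled `c`: the leaf is true below a conjunction and false below
a disjunction. -/
def constraintOf {k : ℕ} (c : Conn) (ℓ : Literal k) : Literal k :=
  if c = true then ℓ.neg else ℓ

/-- The constraints that a node labelled `c` with list of children `l` adds to its children. -/
def leafConstraints {k : ℕ} (c : Conn) (l : List (LTree k)) : Set (Literal k) :=
  {ℓ' | ∃ ℓ, LTree.leaf ℓ ∈ l ∧ ℓ' = constraintOf c ℓ}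

/-- Some assignment of the variables satisfies all the constraints. -/
def Consistent {k : ℕ} (S : Set (Literal k)) : Prop :=
  ∃ x : Fin k → Bool, ∀ ℓ ∈ S, Literal.eval x ℓ = true

open Classical in
/-- `1` if the constraint set `S` is consistent, and `0` otherwise. -/
noncomputable def keep {k : ℕ} (S : Set (Literal k)) : ℕ := if Consistent S then 1 else 0

mutual
/-- The number of leaves of a tree, whose root has the constraint set `S`, that are kept by the
trimming procedure, that is, whose constraint set is consistent. As constraint sets increase along
the paths from the root, the ancestors of such a leaf are kept as well. Internal
nodes that become leaves by trimming are not counted. -/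
noncomputable def LTree.trimSize {k : ℕ} : LTree k → Set (Literal k) → ℕ
  | .leaf _, S => keep S
  | .node c l, S => LTree.trimSizeList l (S ∪ leafConstraints c l)
/-- The same for a forest, all of whose roots have the constraint set `S`. -/
noncomputable def LTree.trimSizeList {k : ℕ} : List (LTree k) → Set (Literal k) → ℕ
  | [], _ => 0
  | t :: ts, S => t.trimSize S + LTree.trimSizeList ts S
end

/-- The number of leaves kept by trimming in the forest that hangs from a spine node whose own
constraint set is `S`. -/
noncomputable def LLevel.trimSize {k : ℕ} (v : LLevel k) (S : Set (Literal k)) : ℕ :=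
  LTree.trimSizeList v.forest (S ∪ leafConstraints v.conn v.forest)

/-- The constraint set of the spine node `u i`. -/
def LSpineTree.constraints {k : ℕ} (σ : LSpineTree k) : ℕ → Set (Literal k)
  | 0 => ∅
  | i + 1 => LSpineTree.constraints σ i ∪ leafConstraints (σ i).conn (σ i).forest

/-- The size of the trimmed version of a labelled one-ended tree. -/
noncomputable def LSpineTree.trimSize {k : ℕ} (σ : LSpineTree k) : ℝ≥0∞ :=
  ∑' i, ((σ i).trimSize (LSpineTree.constraints σ i) : ℝ≥0∞)

/-- The `m`-th moment of `L`, the number of leaves of the trimmed version of the randomly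
`k`-labelled version of a random forest with law `α`. -/
noncomputable def momentL (k : ℕ) [NeZero k] (α : Measure Forest) (m : ℕ) : ℝ≥0∞ :=
  ∫⁻ F, ∫⁻ v, (v.trimSize ∅ : ℝ≥0∞) ^ m ∂(Forest.label k F).toMeasure ∂α

/-! ### Random trees -/

section

variable {Ω : Type*} [MeasurableSpace Ω]

/-- Convergence in distribution, in the local topology, of the random finite trees `T n` to the
random one-ended tree with forests `A i`: for every height `h`, the laws of the truncations, up
to isomorphism, converge. -/
def LocallyConverges (μ : Measure Ω) (T : ℕ → Ω → RTree) (A : ℕ → Ω → Forest) : Prop :=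
  ∀ (h : ℕ) (s : RTree),
    Tendsto (fun n => μ {ω | RTree.Iso ((T n ω).trunc h) s}) atTop
      (𝓝 (μ {ω | RTree.Iso (SpineTree.trunc h fun i => A i ω) s}))

/-- The probability that the randomly `k`-labelled version of the random finite tree `T`
represents `g`. -/
noncomputable def randomTreeProb (k : ℕ) [NeZero k] (μ : Measure Ω) (T : Ω → RTree)
    (g : BoolFun k) : ℝ :=
  (∫⁻ ω, treeProb k (T ω) g ∂μ).toReal

/-- `ℙ_k(g)`: the probability that the randomly `k`-labelled version of the random one-ended tree
with forests `A i` represents `g`. -/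
noncomputable def limitProb (k : ℕ) [NeZero k] (μ : Measure Ω) (A : ℕ → Ω → Forest)
    (g : BoolFun k) : ℝ :=
  (∫⁻ ω, spineProb k (fun i => A i ω) g ∂μ).toReal

end

/-- The effective complexity of `f` with respect to a law `α` on forests: the smallest size of a
forest in the support of `α` that has a labelling for which the disjunction of its trees
computes `f` (and `⊤` if there is none). -/
noncomputable def effComplexity {k : ℕ} (α : Measure Forest) (f : BoolFun k) : ℕ∞ :=
  sInf {n | ∃ F : Forest, α {F} ≠ 0 ∧ (F.size : ℕ∞) = n ∧ ∃ _ : NeZero k,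
    ∃ l ∈ (RTree.labelList k F).support, ∀ x, Conn.apply true (LTree.evalList x l) = f x}

end AndOr

/-!
# Random and/or trees with a one-ended local limit

*The hypotheses that matter.* If the leaves of a forest carry distinct variables, all the
constraints can be satisfied at once and trimming removes nothing. For a fixed forest this happens
with probability tending to one as `k → ∞`, so by Fatou's lemma the uniform bounds on the moments of
the trimmed forest bound all the moments of the size of the untrimmed forest
(`lintegral_size_pow_ne_top`). After that, trimming is used only once more: if no tree of the
forests were a single leaf, then no constraint would reach the spine and the trimmed tree would have
infinite expected size. So single leaves hang from the spine with positive probability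
(`measure_hasLeaf_ne_zero`).

*Convergence.* Monotone approximations, in which all nodes at depth `h` are set to `False` or all to
`True`, bound the value of a tree from below and from above. When they agree, the first `h` levels
force the represented function. For each assignment, the connective of a spine node absorbs one of
the values in the forest that hangs from it with probability at least one half, and then the node
ignores what follows on the spine; so the function of the limit tree is almost surely forced
(`label_exists_forced`). The probability that `h` levels force `g` depends on the truncation at
height `h` up to isomorphism only, hence passes to the limit as a lower bound; as the limits add up
to one over `g`, the lower bounds are sharp (`tendsto_of_sum_eq_one`, `tendsto_randomTreeProb`).

*Upper bound* `ℙ_k(f) ≤ C / k ^ (L(f) + 1)` (`exists_lintegral_spineProb_le`). Cut the spine into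
pairs of consecutive nodes and explore it until `2 L(f) + 1` pairs have distinct connectives; the
number of levels needed has an exponential tail and is independent of the labels of the leaves.
Count as restrictions the leaves whose variable is one of those of `f`, or has appeared before. If
there were at most `L(f)` restrictions, one of the pairs with distinct connectives would be made of
leaves whose variables are free and appear once, so that its value could be set at will without
touching any other leaf (`settable_pair`). This freedom propagates towards the root until it meets a
leaf whose variable is one of those of `f` or appears twice. There, forcing the absorbing value
removes everything beyond, so `f` is computed by what lies closer to the root, which has at least
`L(f)` leaves labelled by variables of `f`: together with the leaf just met, or another leaf with
the same variable, these are `L(f) + 1` restrictions (`restr_of_represents`). Among `S` uniform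
labels, `L(f) + 1` restrictions occur with probability at most a power of `S` times
`k ^ (-(L(f) + 1))` (`unifs_restr_le`), and the powers of `S` are integrable. In particular
`ℙ_k(True) ≤ C / k`.

*Lower bound* `ℙ_k(f) ≥ c / k ^ (L_A(f) + 1)` (`exists_le_lintegral_spineProb`). Let the root be a
disjunction, with a fixed forest of size `L_A(f)` labelled so as to compute `f`, and let the next
two spine nodes be conjunctions with leaves labelled by opposite literals. These two nodes
contradict each other, so the rest of the spine contributes `False` at the root; the labels of the
forest cost `k ^ (-L_A(f))` and the coincidence of the two variables costs `1 / k`.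

The claimed comparisons with `ℙ_k(True)` follow from these two bounds.
-/

namespace AndOr

/-! ### Independent sequences of laws -/

section SeqList

variable {X Y : Type*}

/-- The law of a list of independent random variables whose laws are the members of the given
list. -/
noncomputable def seqList : List (PMF X) → PMF (List X)
  | [] => PMF.pure []
  | p :: ps => p.bind fun x => (seqList ps).map fun l => x :: l

theorem seqList_map (f : X → Y) (ps : List (PMF X)) :
    (seqList ps).map (List.map f) = seqList (ps.map (PMF.map f)) := by
  induction ps with
  | nil => simp [seqList, PMF.pure_map]
  | cons p ps ih =>
    simp only [seqList, List.map_cons, PMF.map_bind, PMF.bind_map, ← ih, PMF.map_comp]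
    rfl

theorem mem_support_seqList {ps : List (PMF X)} {l : List X} :
    l ∈ (seqList ps).support ↔ List.Forall₂ (fun x p => x ∈ p.support) l ps := by
  induction ps generalizing l with
  | nil => simp [seqList]
  | cons p ps ih =>
    simp only [seqList, PMF.mem_support_bind_iff, PMF.mem_support_map_iff,
      List.forall₂_cons_right_iff, ih]
    constructor
    · rintro ⟨x, hx, l', hl', rfl⟩
      exact ⟨x, l', hx, hl', rfl⟩
    · rintro ⟨x, l', hx, hl', rfl⟩
      exact ⟨x, hx, l', hl', rfl⟩

/-- A function of a list that does not depend on the order of its entries has the same law when the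
independent entries are permuted. -/
theorem map_seqList_perm {ps qs : List (PMF X)} (h : ps.Perm qs) :
    ∀ φ : List X → Y, (∀ l l' : List X, l.Perm l' → φ l = φ l') →
      (seqList ps).map φ = (seqList qs).map φ := by
  induction h with
  | nil => intros; rfl
  | cons p _ ih =>
    intro φ hφ
    simp only [seqList, PMF.map_bind, PMF.map_comp]
    congr 1
    funext x
    exact ih _ fun l l' hl => hφ _ _ (hl.cons x)
  | swap p q ps =>
    intro φ hφ
    simp only [seqList, PMF.map_bind, PMF.map_comp]
    rw [PMF.bind_comm]
    congr 1
    funext x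
    congr 1
    funext y
    congr 1
    funext l
    exact hφ _ _ (List.Perm.swap _ _ _)
  | trans _ _ ih₁ ih₂ => intro φ hφ; rw [ih₁ φ hφ, ih₂ φ hφ]

theorem seqList_cons_apply (p : PMF X) (ps : List (PMF X)) (x : X) (l : List X) :
    seqList (p :: ps) (x :: l) = p x * seqList ps l := by
  classical
  rw [seqList, PMF.bind_apply, tsum_eq_single x]
  · congr 1
    rw [PMF.map_apply, tsum_eq_single l]
    · simp
    · intro l' hl'
      simp [hl'.symm]
  · intro y hy
    rw [mul_eq_zero]
    right
    rw [PMF.apply_eq_zero_iff, PMF.mem_support_map_iff]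
    rintro ⟨l', -, h⟩
    exact hy (List.cons.inj h).1

theorem seqList_ofFn_apply {n : ℕ} (p : Fin n → PMF X) (x : Fin n → X) :
    seqList (List.ofFn p) (List.ofFn x) = ∏ i, p i (x i) := by
  induction n with
  | zero => simp [seqList]
  | succ n ih => rw [List.ofFn_succ, List.ofFn_succ, seqList_cons_apply, ih, Fin.prod_univ_succ]

theorem length_of_mem_support_seqList {ps : List (PMF X)} {l : List X}
    (h : l ∈ (seqList ps).support) : l.length = ps.length :=
  (mem_support_seqList.1 h).length_eq

/-- The list of the first `n` terms of a sequence. -/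
def pre (n : ℕ) (σ : ℕ → X) : List X := List.ofFn fun i : Fin n => σ i

theorem pre_zero (σ : ℕ → X) : pre 0 σ = [] := by simp [pre]

theorem pre_succ (n : ℕ) (σ : ℕ → X) : pre (n + 1) σ = σ 0 :: pre n (fun i => σ (i + 1)) := by
  simp [pre, List.ofFn_succ]

theorem length_pre (n : ℕ) (σ : ℕ → X) : (pre n σ).length = n := by simp [pre]

theorem mem_pre {n : ℕ} {σ : ℕ → X} {x : X} : x ∈ pre n σ ↔ ∃ i < n, σ i = x := by
  simp only [pre, List.mem_ofFn', Set.mem_range]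
  exact ⟨fun ⟨i, hi⟩ => ⟨i, i.2, hi⟩, fun ⟨i, hi, h⟩ => ⟨⟨i, hi⟩, h⟩⟩

theorem map_pre (f : X → Y) (n : ℕ) (σ : ℕ → X) : (pre n σ).map f = pre n (fun i => f (σ i)) := by
  simp [pre, List.map_ofFn, Function.comp_def]

theorem pre_add (m n : ℕ) (σ : ℕ → X) :
    pre (m + n) σ = pre m σ ++ pre n (fun i => σ (m + i)) := by
  induction m generalizing σ with
  | zero => simp [pre_zero]
  | succ m ih =>
    rw [Nat.succ_add, pre_succ, pre_succ, ih]
    simp [Nat.succ_add]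

theorem measurable_pre_top [Countable X] [MeasurableSpace X] [DiscreteMeasurableSpace X] (n : ℕ) :
    Measurable[_, ⊤] (fun σ : ℕ → X => pre n σ) := by
  let _ : MeasurableSpace (List X) := ⊤
  have h1 : Measurable (fun σ : ℕ → X => fun i : Fin n => σ i) := by fun_prop
  have h2 : Measurable (fun x : Fin n → X => List.ofFn x) := measurable_of_countable _
  exact h2.comp h1

theorem measurableSet_pre [Countable X] [MeasurableSpace X] [DiscreteMeasurableSpace X] (n : ℕ)
    (E : Set (List X)) : MeasurableSet {σ : ℕ → X | pre n σ ∈ E} :=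
  measurable_pre_top n (show MeasurableSet[⊤] E from trivial)

/-- The law of the first coordinates under an infinite product of discrete laws. -/
theorem infinitePi_pre [Countable X] [MeasurableSpace X] [DiscreteMeasurableSpace X]
    (p : ℕ → PMF X) (n : ℕ) (E : Set (List X)) :
    Measure.infinitePi (fun i => (p i).toMeasure) {σ | pre n σ ∈ E} =
      (seqList (pre n p)).toOuterMeasure E := by
  let _ : MeasurableSpace (List X) := ⊤
  have : DiscreteMeasurableSpace (List X) := ⟨fun _ => trivial⟩
  have hmeas : Measurable (fun σ : ℕ → X => pre n σ) := measurable_pre_top n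
  have key : (Measure.infinitePi (fun i => (p i).toMeasure)).map (fun σ : ℕ → X => pre n σ) =
      (seqList (pre n p)).toMeasure := by
    apply Measure.ext_of_singleton
    intro l
    rw [Measure.map_apply hmeas (MeasurableSet.singleton l),
      PMF.toMeasure_apply_singleton _ _ (MeasurableSet.singleton l)]
    by_cases hl : l.length = n
    · obtain ⟨x, rfl⟩ : ∃ x : Fin n → X, l = List.ofFn x := by
        subst hl
        exact ⟨l.get, (List.ofFn_get l).symm⟩
      set t : ℕ → Set X := fun i => if h : i < n then {x ⟨i, h⟩} else Set.univ with ht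
      have hset : (fun σ : ℕ → X => pre n σ) ⁻¹' {List.ofFn x} =
          ((Finset.range n : Finset ℕ) : Set ℕ).pi t := by
        ext σ
        simp only [Set.mem_preimage, Set.mem_singleton_iff, Set.mem_pi,
          Finset.coe_range, Set.mem_Iio]
        rw [pre, List.ofFn_inj, funext_iff]
        constructor
        · intro h i hi
          simp [ht, hi, ← h ⟨i, hi⟩]
        · intro h i
          have := h i i.2
          simpa [ht] using this
      rw [hset, Measure.infinitePi_pi _ (fun i _ => MeasurableSet.of_discrete),
        Finset.prod_range, pre, seqList_ofFn_apply]
      refine Finset.prod_congr rfl fun i _ => ?_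
      simp [ht, PMF.toMeasure_apply_singleton]
    · have h1 : (fun σ : ℕ → X => pre n σ) ⁻¹' {l} = ∅ := by
        ext σ
        simp only [Set.mem_preimage, Set.mem_singleton_iff, Set.mem_empty_iff_false, iff_false]
        rintro rfl
        exact hl (length_pre n σ)
      rw [h1, measure_empty, eq_comm, PMF.apply_eq_zero_iff]
      intro h
      exact hl (by rw [length_of_mem_support_seqList h, length_pre])
  have := congrArg (fun ν => ν E) key
  rw [Measure.map_apply hmeas (MeasurableSet.of_discrete),
    PMF.toMeasure_apply_eq_toOuterMeasure] at this
  exact this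

end SeqList

/-! ### Countability of the spaces of trees -/

theorem countable_lists {X : Type*} {s : Set X} (hs : s.Countable) :
    {l : List X | ∀ x ∈ l, x ∈ s}.Countable := by
  have := hs.to_subtype
  refine (Set.countable_range (fun l : List s => l.map Subtype.val)).mono ?_
  intro l hl
  exact ⟨l.attach.map fun x => ⟨x.1, hl x.1 x.2⟩, by simp [Function.comp_def]⟩

instance : Countable RTree := by
  have key : ∀ n : ℕ, {t : RTree | sizeOf t ≤ n}.Countable := by
    intro n
    induction n with
    | zero =>
      refine Set.Countable.mono (s₂ := ∅) ?_ Set.countable_empty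
      rintro ⟨l⟩ h
      simp at h
    | succ n ih =>
      refine ((countable_lists ih).image RTree.node).mono ?_
      rintro ⟨l⟩ h
      refine ⟨l, fun t ht => ?_, rfl⟩
      have := List.sizeOf_lt_of_mem ht
      simp at h ⊢
      omega
  rw [← Set.countable_univ_iff]
  refine (Set.countable_iUnion key).mono fun t _ => Set.mem_iUnion.2 ⟨sizeOf t, le_refl (sizeOf t)⟩

instance : Countable Forest := inferInstanceAs (Countable (List RTree))

instance (k : ℕ) : Countable (LTree k) := by
  have key : ∀ n : ℕ, {t : LTree k | sizeOf t ≤ n}.Countable := by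
    intro n
    induction n with
    | zero =>
      refine Set.Countable.mono (s₂ := ∅) ?_ Set.countable_empty
      rintro (ℓ | ⟨c, l⟩) h <;> simp at h
    | succ n ih =>
      refine ((Set.countable_range (LTree.leaf (k := k))).union
        (Set.countable_iUnion fun c => (countable_lists ih).image (LTree.node c))).mono ?_
      rintro (ℓ | ⟨c, l⟩) h
      · exact Or.inl ⟨ℓ, rfl⟩
      · refine Or.inr (Set.mem_iUnion.2 ⟨c, l, fun t ht => ?_, rfl⟩)
        have := List.sizeOf_lt_of_mem ht
        simp at h ⊢
        omega
  rw [← Set.countable_univ_iff]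
  refine (Set.countable_iUnion key).mono fun t _ => Set.mem_iUnion.2 ⟨sizeOf t, le_refl (sizeOf t)⟩

instance (k : ℕ) : Countable (LLevel k) := by
  refine Function.Injective.countable (f := fun v : LLevel k => (v.conn, v.forest)) ?_
  rintro ⟨c, l⟩ ⟨c', l'⟩ h
  simpa using h

instance (k : ℕ) : DiscreteMeasurableSpace (LLevel k) := ⟨fun _ => trivial⟩
instance : DiscreteMeasurableSpace Forest := ⟨fun _ => trivial⟩
instance : DiscreteMeasurableSpace RTree := ⟨fun _ => trivial⟩

/-! ### The law of a random labelling -/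

section Label

variable (k : ℕ) [NeZero k]

theorem labelList_eq_seqList (l : List RTree) :
    RTree.labelList k l = seqList (l.map (RTree.label k)) := by
  induction l with
  | nil => simp [RTree.labelList, seqList]
  | cons t ts ih => simp only [RTree.labelList, seqList, List.map_cons, ih]

theorem label_node_nil :
    RTree.label k (.node []) = (PMF.uniformOfFintype (Literal k)).map LTree.leaf := by
  simp [RTree.label]

theorem label_node {l : List RTree} (hl : l ≠ []) :
    RTree.label k (.node l) =
      (PMF.uniformOfFintype Conn).bind fun c => (RTree.labelList k l).map (LTree.node c) := by
  simp [RTree.label, hl]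

theorem uniform_conn (c : Conn) : PMF.uniformOfFintype Conn c = 2⁻¹ := by
  rw [PMF.uniformOfFintype_apply]
  simp

theorem label_pre (a : ℕ → Forest) (n : ℕ) (E : Set (List (LLevel k))) :
    SpineTree.label k a {σ | pre n σ ∈ E} =
      (seqList (pre n fun i => Forest.label k (a i))).toOuterMeasure E :=
  infinitePi_pre _ n E

instance (a : ℕ → Forest) : IsProbabilityMeasure (SpineTree.label k a) := by
  unfold SpineTree.label
  infer_instance

end Label

theorem evalList_eq_map {k : ℕ} (x : Fin k → Bool) (l : List (LTree k)) :
    LTree.evalList x l = l.map (LTree.eval x) := by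
  induction l with
  | nil => rfl
  | cons t ts ih => simp [LTree.evalList, ih]

theorem Conn.apply_nil (c : Conn) : c.apply [] = !c := by cases c <;> rfl

theorem Conn.apply_cons (c : Conn) (b : Bool) (l : List Bool) :
    c.apply (b :: l) = if c then b || c.apply l else b && c.apply l := by
  cases c <;> rfl

theorem Conn.apply_of_mem {c : Conn} {l : List Bool} (h : c ∈ l) : c.apply l = c := by
  cases c
  · simp [Conn.apply, h]
  · simp [Conn.apply, h]

theorem Conn.apply_of_forall_eq {c : Conn} {l : List Bool} {b : Bool} (hl : l ≠ [])
    (h : ∀ y ∈ l, y = b) : c.apply l = b := by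
  by_cases hcb : c = b
  · subst hcb
    obtain ⟨y, hy⟩ := List.exists_mem_of_ne_nil l hl
    exact Conn.apply_of_mem (h y hy ▸ hy)
  · have : b = !c := by cases b <;> cases c <;> simp_all
    subst this
    clear hcb hl
    induction l with
    | nil => exact Conn.apply_nil c
    | cons y l ih =>
      rw [Conn.apply_cons, ih fun z hz => h z (List.mem_cons_of_mem _ hz),
        h y List.mem_cons_self]
      cases c <;> rfl

theorem Conn.apply_mono (c : Conn) {l l' : List Bool} (h : List.Forall₂ (· ≤ ·) l l') :
    c.apply l ≤ c.apply l' := by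
  induction h with
  | nil => exact le_rfl
  | cons hb _ ih =>
    rw [Conn.apply_cons, Conn.apply_cons]
    cases c
    · exact inf_le_inf hb ih
    · exact sup_le_sup hb ih

theorem Conn.apply_perm (c : Conn) {l l' : List Bool} (h : l.Perm l') :
    c.apply l = c.apply l' := by
  unfold Conn.apply
  rw [h.any_eq, h.all_eq]

/-! ### Isomorphism of trees -/

theorem RTree.Iso.refl (t : RTree) : RTree.Iso t t := by
  induction h : sizeOf t using Nat.strong_induction_on generalizing t with
  | _ n ih =>
    subst h
    obtain ⟨l⟩ := t
    refine .node (.refl l) (List.forall₂_same.2 fun t ht => ih _ ?_ t rfl)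
    have := List.sizeOf_lt_of_mem ht
    simp
    omega

theorem RTree.Iso.symm {t t' : RTree} (h : RTree.Iso t t') : RTree.Iso t' t := by
  refine RTree.Iso.rec (motive_1 := fun t t' _ => RTree.Iso t' t)
    (motive_2 := fun l l' _ => List.Forall₂ RTree.Iso l' l) ?_ ?_ ?_ h
  · intro l m l' hlm _ ih
    obtain ⟨w, hw, hw'⟩ := List.perm_comp_forall₂ hlm ih.flip
    exact .node hw'.symm hw.flip
  · exact .nil
  · intro a b l l' _ _ h1 h2
    exact .cons h1 h2

theorem RTree.Iso.trans {t t' t'' : RTree} (h : RTree.Iso t t') (h' : RTree.Iso t' t'') :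
    RTree.Iso t t'' := by
  refine RTree.Iso.rec (motive_1 := fun t t' _ => ∀ t'', RTree.Iso t' t'' → RTree.Iso t t'')
    (motive_2 := fun l l' _ => ∀ l'', List.Forall₂ RTree.Iso l' l'' → List.Forall₂ RTree.Iso l l'')
    ?_ ?_ ?_ h t'' h'
  · rintro l m l' hlm _ ih _ ⟨hlm', hf⟩
    obtain ⟨w, hw, hw'⟩ := List.perm_comp_forall₂ hlm' hf
    have h1 : Relation.Comp (List.Forall₂ RTree.Iso) List.Perm m _ := ⟨w, ih w hw, hw'⟩
    rw [List.forall₂_comp_perm_eq_perm_comp_forall₂] at h1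
    obtain ⟨z, hz, hz'⟩ := h1
    exact .node (hlm.trans hz) hz'
  · intro l'' h
    exact h
  · rintro a b l l' _ _ h1 h2 _ (_ | ⟨h3, h4⟩)
    exact .cons (h1 _ h3) (h2 _ h4)

/-- Rooted trees up to isomorphism. -/
def isoSetoid : Setoid RTree := ⟨RTree.Iso, RTree.Iso.refl, RTree.Iso.symm, RTree.Iso.trans⟩

/-! ### Evaluation of a tree from its first levels -/

variable {k : ℕ}

/-- The value computed at the root of a labelled tree when all the nodes at distance `h` from the
root are given the value `b`. -/
def LTree.approx (b : Bool) (x : Fin k → Bool) : ℕ → LTree k → Bool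
  | 0, _ => b
  | _ + 1, .leaf ℓ => Literal.eval x ℓ
  | h + 1, .node c l => Conn.apply c (l.map (LTree.approx b x h))

/-- The value computed at the root of the spine when all the nodes at distance `h` from the
root are given the value `b`. The list is that of the first `h` labelled spine nodes. -/
def levelsApprox (b : Bool) (x : Fin k → Bool) : ℕ → List (LLevel k) → Bool
  | h + 1, v :: l => Conn.apply v.conn (levelsApprox b x h l :: v.forest.map (LTree.approx b x h))
  | _, _ => b

/-- `LTree.approx` as a pair (indexed by `b`) of Boolean functions. If the two functions are the
same function `g`, then the nodes at distance less than `h` from the root force the tree to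
represent `g`. -/
def LTree.approxFn (h : ℕ) (τ : LTree k) : Bool → BoolFun k := fun b x => τ.approx b x h

/-- `levelsApprox` as a pair of Boolean functions. -/
def levelsApproxFn (h : ℕ) (l : List (LLevel k)) : Bool → BoolFun k :=
  fun b x => levelsApprox b x h l

theorem LTree.eval_node (x : Fin k → Bool) (c : Conn) (l : List (LTree k)) :
    (LTree.node c l).eval x = c.apply (l.map (LTree.eval x)) := by
  rw [LTree.eval, evalList_eq_map]

theorem forall₂_map_map {X Y : Type*} {R : Y → Y → Prop} {f g : X → Y} {l : List X}
    (h : ∀ a ∈ l, R (f a) (g a)) : List.Forall₂ R (l.map f) (l.map g) := by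
  rw [List.forall₂_map_left_iff, List.forall₂_map_right_iff]
  exact List.forall₂_same.2 h

theorem LTree.approx_false_le_eval (x : Fin k → Bool) (h : ℕ) (τ : LTree k) :
    τ.approx false x h ≤ τ.eval x := by
  induction h generalizing τ with
  | zero => exact bot_le
  | succ h ih =>
    rcases τ with ℓ | ⟨c, l⟩
    · exact le_of_eq (by rw [LTree.eval, LTree.approx])
    · rw [LTree.approx, LTree.eval_node]
      exact c.apply_mono (forall₂_map_map fun a _ => ih a)

theorem LTree.eval_le_approx_true (x : Fin k → Bool) (h : ℕ) (τ : LTree k) :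
    τ.eval x ≤ τ.approx true x h := by
  induction h generalizing τ with
  | zero => exact le_top
  | succ h ih =>
    rcases τ with ℓ | ⟨c, l⟩
    · exact le_of_eq (by rw [LTree.eval, LTree.approx])
    · rw [LTree.approx, LTree.eval_node]
      exact c.apply_mono (forall₂_map_map fun a _ => ih a)

theorem LTree.fn_eq_of_approxFn {h : ℕ} {τ : LTree k} {g : BoolFun k}
    (hg : τ.approxFn h = fun _ => g) : τ.fn = g := by
  funext x
  have h1 : τ.approx false x h = g x := congrFun (congrFun hg false) x
  have h2 : τ.approx true x h = g x := congrFun (congrFun hg true) x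
  exact le_antisymm (h2 ▸ τ.eval_le_approx_true x h) (h1 ▸ τ.approx_false_le_eval x h)

theorem LTree.approx_false_mono (x : Fin k → Bool) (h : ℕ) (τ : LTree k) :
    τ.approx false x h ≤ τ.approx false x (h + 1) := by
  induction h generalizing τ with
  | zero => exact bot_le
  | succ h ih =>
    rcases τ with ℓ | ⟨c, l⟩
    · exact le_of_eq (by rw [LTree.approx, LTree.approx])
    · rw [LTree.approx, LTree.approx]
      exact c.apply_mono (forall₂_map_map fun a _ => ih a)

theorem LTree.approx_true_anti (x : Fin k → Bool) (h : ℕ) (τ : LTree k) :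
    τ.approx true x (h + 1) ≤ τ.approx true x h := by
  induction h generalizing τ with
  | zero => exact le_top
  | succ h ih =>
    rcases τ with ℓ | ⟨c, l⟩
    · exact le_of_eq (by rw [LTree.approx, LTree.approx])
    · rw [LTree.approx, LTree.approx]
      exact c.apply_mono (forall₂_map_map fun a _ => ih a)

theorem LTree.approx_eventually_eq (τ : LTree k) :
    ∀ᶠ h in atTop, ∀ b x, τ.approx b x h = τ.eval x := by
  induction hn : sizeOf τ using Nat.strong_induction_on generalizing τ with
  | _ n ih =>
    subst hn
    rw [← map_add_atTop_eq_nat 1, eventually_map]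
    rcases τ with ℓ | ⟨c, l⟩
    · exact Eventually.of_forall fun h b x => by rw [LTree.approx, LTree.eval]
    · have : ∀ᶠ h in atTop, ∀ τ ∈ l, ∀ b x, τ.approx b x h = τ.eval x := by
        have := (l.finite_toSet.eventually_all (l := (atTop : Filter ℕ))
          (p := fun τ h => ∀ b x, τ.approx b x h = τ.eval x)).2
        refine this fun τ hτ => ih _ ?_ τ rfl
        have := List.sizeOf_lt_of_mem hτ
        simp
        omega
      filter_upwards [this] with h hh b x
      rw [LTree.approx, LTree.eval_node]
      congr 1
      exact List.map_congr_left fun τ hτ => hh τ hτ b x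

theorem forest_approx_eventually_eq (l : List (LTree k)) :
    ∀ᶠ h in atTop, ∀ b x, l.map (LTree.approx b x h) = LTree.evalList x l := by
  have := (l.finite_toSet.eventually_all (l := (atTop : Filter ℕ))
    (p := fun τ h => ∀ b x, τ.approx b x h = τ.eval x)).2 fun τ _ => τ.approx_eventually_eq
  filter_upwards [this] with h hh b x
  rw [evalList_eq_map]
  exact List.map_congr_left fun τ hτ => hh τ hτ b x

theorem levelsApprox_false_le_cutEval (x : Fin k → Bool) {h n : ℕ} (hn : h ≤ n)
    (σ : LSpineTree k) : levelsApprox false x h (pre h σ) ≤ LSpineTree.cutEval x n σ := by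
  induction h generalizing n σ with
  | zero => exact bot_le
  | succ h ih =>
    obtain ⟨n, rfl⟩ : ∃ m, n = m + 1 := ⟨n - 1, by omega⟩
    rw [pre_succ, levelsApprox, LSpineTree.cutEval, evalList_eq_map]
    exact Conn.apply_mono _ (.cons (ih (by omega) _)
      (forall₂_map_map fun τ _ => τ.approx_false_le_eval x h))

theorem cutEval_le_levelsApprox_true (x : Fin k → Bool) {h n : ℕ} (hn : h ≤ n)
    (σ : LSpineTree k) : LSpineTree.cutEval x n σ ≤ levelsApprox true x h (pre h σ) := by
  induction h generalizing n σ with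
  | zero => exact le_top
  | succ h ih =>
    obtain ⟨n, rfl⟩ : ∃ m, n = m + 1 := ⟨n - 1, by omega⟩
    rw [pre_succ, levelsApprox, LSpineTree.cutEval, evalList_eq_map]
    exact Conn.apply_mono _ (.cons (ih (by omega) _)
      (forall₂_map_map fun τ _ => τ.eval_le_approx_true x h))

/-- The labelled one-ended trees whose first `h` levels force them to represent `g`. -/
def Forced (h : ℕ) (g : BoolFun k) : Set (LSpineTree k) :=
  {σ | pre h σ ∈ {l | levelsApproxFn h l = fun _ => g}}

theorem represents_of_forced {h : ℕ} {g : BoolFun k} {σ : LSpineTree k} (hσ : σ ∈ Forced h g) :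
    σ.Represents g := by
  filter_upwards [eventually_ge_atTop h] with n hn x
  have h1 : levelsApprox false x h (pre h σ) = g x := congrFun (congrFun hσ false) x
  have h2 : levelsApprox true x h (pre h σ) = g x := congrFun (congrFun hσ true) x
  exact le_antisymm (h2 ▸ cutEval_le_levelsApprox_true x hn σ)
    (h1 ▸ levelsApprox_false_le_cutEval x hn σ)

theorem levelsApprox_false_mono (x : Fin k → Bool) (h : ℕ) (σ : LSpineTree k) :
    levelsApprox false x h (pre h σ) ≤ levelsApprox false x (h + 1) (pre (h + 1) σ) := by
  induction h generalizing σ with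
  | zero => exact bot_le
  | succ h ih =>
    rw [pre_succ (h + 1), levelsApprox, pre_succ h σ, levelsApprox]
    exact Conn.apply_mono _ (.cons (ih _)
      (forall₂_map_map fun τ _ => τ.approx_false_mono x h))

theorem levelsApprox_true_anti (x : Fin k → Bool) (h : ℕ) (σ : LSpineTree k) :
    levelsApprox true x (h + 1) (pre (h + 1) σ) ≤ levelsApprox true x h (pre h σ) := by
  induction h generalizing σ with
  | zero => exact le_top
  | succ h ih =>
    rw [pre_succ (h + 1), levelsApprox, pre_succ h σ, levelsApprox]
    exact Conn.apply_mono _ (.cons (ih _)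
      (forall₂_map_map fun τ _ => τ.approx_true_anti x h))

theorem forced_of_eq {h : ℕ} {g : BoolFun k} {σ : LSpineTree k}
    (h1 : ∀ x, g x ≤ levelsApprox false x h (pre h σ))
    (h2 : ∀ x, levelsApprox true x h (pre h σ) ≤ g x) : σ ∈ Forced h g := by
  have h3 : ∀ x, levelsApprox false x h (pre h σ) ≤ levelsApprox true x h (pre h σ) := fun x =>
    (levelsApprox_false_le_cutEval x le_rfl σ).trans (cutEval_le_levelsApprox_true x le_rfl σ)
  change levelsApproxFn h (pre h σ) = _
  funext b x
  cases b
  · exact le_antisymm ((h3 x).trans (h2 x)) (h1 x)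
  · exact le_antisymm (h2 x) ((h1 x).trans (h3 x))

theorem forced_mono (g : BoolFun k) : Monotone fun h => (Forced h g : Set (LSpineTree k)) := by
  refine monotone_nat_of_le_succ fun h σ hσ => forced_of_eq (fun x => ?_) fun x => ?_
  · rw [← show levelsApprox false x h (pre h σ) = g x from congrFun (congrFun hσ false) x]
    exact levelsApprox_false_mono x h σ
  · rw [← show levelsApprox true x h (pre h σ) = g x from congrFun (congrFun hσ true) x]
    exact levelsApprox_true_anti x h σ

theorem measurableSet_forced (h : ℕ) (g : BoolFun k) :
    MeasurableSet (Forced h g : Set (LSpineTree k)) :=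
  measurableSet_pre _ _

/-- A spine node labelled `c`, one of whose finite subtrees has the value `c` (the absorbing
value), does not depend on the spine nodes that follow it. -/
theorem levelsApprox_eventually_eq (x : Fin k → Bool) (i : ℕ) (σ : LSpineTree k)
    (hi : (σ i).conn ∈ LTree.evalList x (σ i).forest) :
    ∃ w, ∀ᶠ h in atTop, ∀ b, levelsApprox b x h (pre h σ) = w := by
  induction i generalizing σ with
  | zero =>
    refine ⟨(σ 0).conn, ?_⟩
    rw [← map_add_atTop_eq_nat 1, eventually_map]
    filter_upwards [forest_approx_eventually_eq (σ 0).forest] with h hh b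
    rw [pre_succ, levelsApprox, hh]
    exact Conn.apply_of_mem (List.mem_cons_of_mem _ hi)
  | succ i ih =>
    obtain ⟨w, hw⟩ := ih (fun j => σ (j + 1)) hi
    refine ⟨(σ 0).conn.apply (w :: LTree.evalList x (σ 0).forest), ?_⟩
    rw [← map_add_atTop_eq_nat 1, eventually_map]
    filter_upwards [forest_approx_eventually_eq (σ 0).forest, hw] with h hh hh' b
    rw [pre_succ, levelsApprox, hh, hh']

theorem exists_forced {σ : LSpineTree k}
    (hσ : ∀ x, ∃ i, (σ i).conn ∈ LTree.evalList x (σ i).forest) : ∃ g h, σ ∈ Forced h g := by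
  choose i hi using hσ
  choose g hg using fun x => levelsApprox_eventually_eq x (i x) σ (hi x)
  obtain ⟨h, hh⟩ := (eventually_all.2 hg).exists
  refine ⟨g, h, ?_⟩
  change levelsApproxFn h (pre h σ) = _
  funext b x
  exact hh x b

theorem represents_unique {σ : LSpineTree k} {g g' : BoolFun k} (h : σ.Represents g)
    (h' : σ.Represents g') : g = g' := by
  obtain ⟨n, hn, hn'⟩ := (h.and h').exists
  funext x
  rw [← hn, ← hn']

/-! ### Laws of the approximations -/

section Law

section

variable {k : ℕ}

/-- The `h`-th approximations of the children of a node determine that of the node. -/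
def combine (c : Conn) (es : List (Bool → BoolFun k)) : Bool → BoolFun k :=
  fun b x => c.apply (es.map fun e => e b x)

theorem combine_perm (c : Conn) {l l' : List (Bool → BoolFun k)} (h : l.Perm l') :
    combine c l = combine c l' := by
  funext b x
  exact c.apply_perm (h.map _)

theorem approxFn_node (h : ℕ) (c : Conn) (l : List (LTree k)) :
    (LTree.node c l).approxFn (h + 1) = combine c (l.map (LTree.approxFn h)) := by
  funext b x
  simp [LTree.approxFn, combine, LTree.approx, Function.comp_def]

theorem levelsApproxFn_cons (h : ℕ) (v : LLevel k) (l : List (LLevel k)) :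
    levelsApproxFn (h + 1) (v :: l) =
      combine v.conn (levelsApproxFn h l :: v.forest.map (LTree.approxFn h)) := by
  funext b x
  simp [levelsApproxFn, combine, levelsApprox, LTree.approxFn, Function.comp_def]

end

variable (k : ℕ) [NeZero k]

/-- The law of the `h`-th approximation of the random labelling of a finite tree. -/
noncomputable def treeLaw (h : ℕ) (t : RTree) : PMF (Bool → BoolFun k) :=
  (RTree.label k t).map (LTree.approxFn h)

/-- The law of the `h`-th approximation of the random labelling of a one-ended tree, as a function
of the forests that hang from its spine. -/
noncomputable def levelsLaw (h : ℕ) (Fs : List Forest) : PMF (Bool → BoolFun k) :=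
  (seqList (Fs.map (Forest.label k))).map (levelsApproxFn h)

variable {k}

theorem treeLaw_zero (t : RTree) : treeLaw k 0 t = PMF.pure fun b _ => b := by
  have : (LTree.approxFn 0 : LTree k → _) = Function.const _ fun b _ => b := by
    funext τ b x
    rfl
  rw [treeLaw, this, PMF.map_const]

theorem treeLaw_succ (h : ℕ) {l : List RTree} (hl : l ≠ []) :
    treeLaw k (h + 1) (.node l) = (PMF.uniformOfFintype Conn).bind fun c =>
      (seqList (l.map (treeLaw k h))).map (combine c) := by
  rw [treeLaw, label_node k hl, PMF.map_bind]
  congr 1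
  funext c
  rw [PMF.map_comp, labelList_eq_seqList]
  have : (LTree.approxFn (h + 1) ∘ LTree.node c : List (LTree k) → _) =
      combine c ∘ List.map (LTree.approxFn h) := by
    funext l
    exact approxFn_node h c l
  rw [this, ← PMF.map_comp, seqList_map, List.map_map]
  rfl

theorem treeLaw_trunc (h : ℕ) (t : RTree) : treeLaw k h (t.trunc h) = treeLaw k h t := by
  induction h generalizing t with
  | zero => rw [treeLaw_zero, treeLaw_zero]
  | succ h ih =>
    obtain ⟨l⟩ := t
    by_cases hl : l = []
    · subst hl
      simp [RTree.trunc]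
    · rw [RTree.trunc, treeLaw_succ h hl, treeLaw_succ h (by simpa using hl), List.map_map]
      congr 1
      funext c
      congr 2
      exact List.map_congr_left fun t _ => ih t

theorem treeLaw_iso (h : ℕ) {t t' : RTree} (ht : t.Iso t') : treeLaw k h t = treeLaw k h t' := by
  induction h generalizing t t' with
  | zero => rw [treeLaw_zero, treeLaw_zero]
  | succ h ih =>
    obtain @⟨l, m, l', hlm, hm⟩ := ht
    by_cases hl : l = []
    · subst hl
      obtain rfl := hlm.nil_eq
      cases hm
      rfl
    · have hm' : m ≠ [] := fun h => hl (by subst h; exact hlm.eq_nil)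
      have hl' : l' ≠ [] := fun h => by subst h; cases hm; exact hm' rfl
      rw [treeLaw_succ h hl, treeLaw_succ h hl']
      congr 1
      funext c
      rw [map_seqList_perm (hlm.map _) _ fun _ _ => combine_perm c]
      congr 2
      clear hlm hm' hl' hl
      induction hm with
      | nil => rfl
      | cons h1 _ ih' => rw [List.map_cons, List.map_cons, ih h1, ih']

theorem spineTrunc_succ (h : ℕ) (a : ℕ → Forest) :
    SpineTree.trunc (h + 1) a = .node
      (SpineTree.trunc h (fun i => a (i + 1)) :: List.map (RTree.trunc h) (a 0)) := rfl

theorem bind_levelsApproxFn (h : ℕ) (c : Conn) (F : List RTree) (p : PMF (List (LLevel k))) :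
    ((RTree.labelList k F).bind fun fl =>
      (p.map fun l => (⟨c, fl⟩ : LLevel k) :: l).map (levelsApproxFn (h + 1))) =
    (seqList (p.map (levelsApproxFn h) ::
      (F.map (RTree.trunc h)).map (treeLaw k h))).map (combine c) := by
  have e1 : (F.map (RTree.trunc h)).map (treeLaw k h) =
      (F.map (RTree.label k)).map (PMF.map (LTree.approxFn h)) := by
    rw [List.map_map, List.map_map]
    exact List.map_congr_left fun t _ => treeLaw_trunc h t
  rw [e1, seqList, ← seqList_map, labelList_eq_seqList, PMF.bind_map, PMF.map_bind]
  simp only [PMF.map_comp]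
  simp only [PMF.map, Function.comp_def, PMF.bind_bind, PMF.pure_bind]
  rw [PMF.bind_comm]
  congr 1
  funext l
  congr 1
  funext fl
  rw [levelsApproxFn_cons]

theorem levelsLaw_pre (h : ℕ) (a : ℕ → Forest) :
    levelsLaw k h (pre h a) = treeLaw k h (SpineTree.trunc h a) := by
  induction h generalizing a with
  | zero =>
    rw [treeLaw_zero, pre_zero, levelsLaw]
    simp only [List.map_nil, seqList, PMF.pure_map]
    rfl
  | succ h ih =>
    rw [spineTrunc_succ, treeLaw_succ h (List.cons_ne_nil _ _), levelsLaw, pre_succ, List.map_cons,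
      seqList, Forest.label, PMF.bind_bind, PMF.map_bind]
    congr 1
    funext c
    rw [PMF.bind_map, PMF.map_bind, List.map_cons, ← ih]
    exact bind_levelsApproxFn h c (a 0) _

theorem treeLaw_le_treeProb (h : ℕ) (t : RTree) (g : BoolFun k) :
    treeLaw k h t (fun _ => g) ≤ treeProb k t g := by
  rw [← PMF.toOuterMeasure_apply_singleton, treeLaw, PMF.toOuterMeasure_map_apply]
  exact measure_mono fun τ hτ => LTree.fn_eq_of_approxFn hτ

theorem label_forced (a : ℕ → Forest) (h : ℕ) (g : BoolFun k) :
    SpineTree.label k a (Forced h g) = levelsLaw k h (pre h a) fun _ => g := by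
  rw [← PMF.toOuterMeasure_apply_singleton, levelsLaw, PMF.toOuterMeasure_map_apply, Forced,
    label_pre, map_pre]
  rfl

theorem toOuterMeasure_univ {X : Type*} (p : PMF X) : p.toOuterMeasure Set.univ = 1 := by
  rw [PMF.toOuterMeasure_apply_eq_one_iff]
  exact Set.subset_univ _

theorem PMF_toOuterMeasure_le_one {X : Type*} (p : PMF X) (s : Set X) : p.toOuterMeasure s ≤ 1 :=
  toOuterMeasure_univ p ▸ measure_mono (Set.subset_univ s)

theorem sum_treeProb (t : RTree) : ∑ g, treeProb k t g = 1 := by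
  have : ∀ g, treeProb k t g = (RTree.label k t).map LTree.fn g := by
    intro g
    rw [← PMF.toOuterMeasure_apply_singleton, PMF.toOuterMeasure_map_apply]
    rfl
  simp_rw [this]
  rw [← tsum_fintype (L := .unconditional _)]
  exact PMF.tsum_coe _

/-- A bound for the probability of an event after a random choice. -/
theorem toOuterMeasure_bind_le {X Y : Type*} (p : PMF X) (f : X → PMF Y) (s : Set Y) (c : ℝ≥0∞)
    (h : ∀ x ∈ p.support, (f x).toOuterMeasure s ≤ c) : (p.bind f).toOuterMeasure s ≤ c := by
  rw [PMF.toOuterMeasure_bind_apply]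
  calc ∑' x, p x * (f x).toOuterMeasure s ≤ ∑' x, p x * c := by
        refine ENNReal.tsum_le_tsum fun x => ?_
        by_cases hx : x ∈ p.support
        · exact mul_le_mul_right (h x hx) _
        · rw [(PMF.apply_eq_zero_iff _ _).2 hx, zero_mul, zero_mul]
    _ = c := by rw [ENNReal.tsum_mul_right, PMF.tsum_coe, one_mul]

theorem Forest.label_eq (F : Forest) :
    Forest.label k F = (RTree.labelList k F).bind fun l =>
      (PMF.uniformOfFintype Conn).map fun c => ⟨c, l⟩ := by
  simp only [Forest.label, PMF.map]
  rw [PMF.bind_comm]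
  rfl

theorem length_of_mem_support_labelList {F : List RTree} {l : List (LTree k)}
    (hl : l ∈ (RTree.labelList k F).support) : l.length = F.length := by
  rw [labelList_eq_seqList] at hl
  rw [length_of_mem_support_seqList hl, List.length_map]

theorem ne_nil_of_mem_support_labelList {F : List RTree} {l : List (LTree k)}
    (hl : l ∈ (RTree.labelList k F).support) (hF : F ≠ []) : l ≠ [] := by
  intro h
  have := length_of_mem_support_labelList hl
  rw [h, List.length_nil, eq_comm, List.length_eq_zero_iff] at this
  exact hF this

/-- The connective of a spine node is independent of the forest that hangs from it, so that
it agrees with a given truth value with probability one half. -/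
theorem label_undetermined_le {F : Forest} (hF : F ≠ ([] : List RTree)) (x : Fin k → Bool) :
    (Forest.label k F).toOuterMeasure {v | v.conn ∉ LTree.evalList x v.forest} ≤ 2⁻¹ := by
  rw [Forest.label_eq]
  refine toOuterMeasure_bind_le _ _ _ _ fun l hl => ?_
  have hne : LTree.evalList x l ≠ [] := by
    rw [evalList_eq_map]
    simpa using ne_nil_of_mem_support_labelList hl hF
  obtain ⟨c₀, hc₀⟩ := List.exists_mem_of_ne_nil _ hne
  rw [PMF.toOuterMeasure_map_apply]
  calc _ ≤ (PMF.uniformOfFintype Conn).toOuterMeasure {!c₀} := by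
        refine measure_mono fun c hc => ?_
        have : c ≠ c₀ := by
          rintro rfl
          exact hc hc₀
        show c = !c₀
        cases c <;> cases c₀ <;> simp_all
    _ = 2⁻¹ := by
        rw [PMF.toOuterMeasure_apply_singleton, uniform_conn]

theorem label_exists_forced {a : ℕ → Forest} (ha : ∀ i, a i ≠ ([] : List RTree)) :
    ∀ᵐ σ ∂(SpineTree.label k a), ∃ g h, σ ∈ Forced h g := by
  have key : ∀ x : Fin k → Bool, ∀ᵐ σ ∂(SpineTree.label k a),
      ∃ i, (σ i).conn ∈ LTree.evalList x (σ i).forest := by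
    intro x
    rw [ae_iff]
    have hle : ∀ n : ℕ, SpineTree.label k a
        {σ | ¬ ∃ i, (σ i).conn ∈ LTree.evalList x (σ i).forest} ≤ 2⁻¹ ^ n := by
      intro n
      calc _ ≤ SpineTree.label k a (((Finset.range n : Finset ℕ) : Set ℕ).pi
              fun _ => {v | v.conn ∉ LTree.evalList x v.forest}) := by
            refine measure_mono fun σ hσ i _ hi => hσ ⟨i, hi⟩
        _ = ∏ i ∈ Finset.range n, (Forest.label k (a i)).toMeasure
              {v | v.conn ∉ LTree.evalList x v.forest} :=
            Measure.infinitePi_pi _ fun i _ => MeasurableSet.of_discrete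
        _ ≤ ∏ i ∈ Finset.range n, 2⁻¹ := by
            refine Finset.prod_le_prod' fun i _ => ?_
            rw [PMF.toMeasure_apply_eq_toOuterMeasure]
            exact label_undetermined_le (ha i) x
        _ = 2⁻¹ ^ n := by simp
    have hlim := ENNReal.tendsto_pow_atTop_nhds_zero_of_lt_one (r := 2⁻¹) (by norm_num)
    exact le_antisymm (ge_of_tendsto' hlim hle) zero_le
  filter_upwards [ae_all_iff.2 key] with σ hσ
  exact exists_forced hσ

theorem spineProb_eq {a : ℕ → Forest} (ha : ∀ i, a i ≠ ([] : List RTree)) (g : BoolFun k) :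
    spineProb k a g = ⨆ h, levelsLaw k h (pre h a) fun _ => g := by
  simp_rw [← label_forced]
  rw [← (forced_mono g).measure_iUnion]
  refine measure_congr ?_
  filter_upwards [label_exists_forced ha] with σ ⟨g', h, hσ⟩
  refine propext ⟨fun h1 => ?_, fun h1 => ?_⟩
  · obtain rfl := represents_unique h1 (represents_of_forced hσ)
    exact Set.mem_iUnion.2 ⟨h, hσ⟩
  · obtain ⟨h, hh⟩ := Set.mem_iUnion.1 h1
    exact represents_of_forced hh

theorem sum_spineProb {a : ℕ → Forest} (ha : ∀ i, a i ≠ ([] : List RTree)) :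
    ∑ g, spineProb k a g = 1 := by
  have h1 : ∀ g, spineProb k a g = SpineTree.label k a (⋃ h, Forced h g) := by
    intro g
    rw [spineProb_eq ha, (forced_mono g).measure_iUnion]
    simp_rw [label_forced]
  simp_rw [h1]
  rw [← tsum_fintype (L := .unconditional _), ← measure_iUnion]
  · rw [← measure_univ (μ := SpineTree.label k a)]
    refine measure_congr ?_
    filter_upwards [label_exists_forced ha] with σ ⟨g', h, hσ⟩
    refine propext ⟨fun _ => trivial, fun _ => ?_⟩
    exact Set.mem_iUnion.2 ⟨g', Set.mem_iUnion.2 ⟨h, hσ⟩⟩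
  · intro g g' hg
    refine Set.disjoint_left.2 fun σ hσ hσ' => hg ?_
    obtain ⟨h, hh⟩ := Set.mem_iUnion.1 hσ
    obtain ⟨h', hh'⟩ := Set.mem_iUnion.1 hσ'
    exact represents_unique (represents_of_forced hh) (represents_of_forced hh')
  · exact fun g => MeasurableSet.iUnion fun h => measurableSet_forced h g

end Law

/-! ### Convergence of the laws of the represented functions -/

section Convergence

/-- If lower bounds for the limits of finitely many probabilities add up to one, then they are the
limits. -/
theorem tendsto_of_sum_eq_one {G : Type*} [Fintype G] {u : ℕ → G → ℝ≥0∞} {L : G → ℝ≥0∞}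
    (hu : ∀ n, ∑ g, u n g = 1) (hL : ∑ g, L g = 1)
    (h : ∀ g, L g ≤ liminf (fun n => u n g) atTop) (g : G) :
    Tendsto (fun n => (u n g).toReal) atTop (𝓝 (L g).toReal) := by
  classical
  have hu1 : ∀ n g, u n g ≤ 1 := fun n g =>
    hu n ▸ Finset.single_le_sum (f := u n) (fun _ _ => zero_le) (Finset.mem_univ g)
  have hL1 : ∀ g, L g ≤ 1 := fun g =>
    hL ▸ Finset.single_le_sum (f := L) (fun _ _ => zero_le) (Finset.mem_univ g)
  have hut : ∀ n g, u n g ≠ ∞ := fun n g => ((hu1 n g).trans_lt ENNReal.one_lt_top).ne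
  have hLt : ∀ g, L g ≠ ∞ := fun g => ((hL1 g).trans_lt ENNReal.one_lt_top).ne
  have huR : ∀ n, ∑ g, (u n g).toReal = 1 := fun n => by
    rw [← ENNReal.toReal_sum fun g _ => hut n g, hu n, ENNReal.toReal_one]
  have hLR : ∑ g, (L g).toReal = 1 := by
    rw [← ENNReal.toReal_sum fun g _ => hLt g, hL, ENNReal.toReal_one]
  have hlow : ∀ g, ∀ ε > 0, ∀ᶠ n in atTop, (L g).toReal - ε < (u n g).toReal := by
    intro g ε hε
    by_cases hg : (L g).toReal - ε < 0
    · exact Eventually.of_forall fun n => hg.trans_le ENNReal.toReal_nonneg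
    · have h1 : ENNReal.ofReal ((L g).toReal - ε) < L g := by
        rw [ENNReal.ofReal_lt_iff_lt_toReal (not_lt.1 hg) (hLt g)]
        linarith
      filter_upwards [eventually_lt_of_lt_liminf (h1.trans_le (h g))] with n hn
      exact (ENNReal.ofReal_lt_iff_lt_toReal (not_lt.1 hg) (hut n g)).1 hn
  rw [Metric.tendsto_atTop']
  intro ε hε
  have hcard : (0 : ℝ) < Fintype.card G := by
    have : Nonempty G := ⟨g⟩
    exact_mod_cast Fintype.card_pos
  obtain ⟨N, hN⟩ := eventually_atTop.1
    (eventually_all.2 fun g => hlow g (ε / (Fintype.card G + 1)) (by positivity))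
  refine ⟨N, fun n hn => ?_⟩
  have hlt := hN n hn.le
  have hle : ε / (Fintype.card G + 1 : ℝ) ≤ ε := by
    rw [div_le_iff₀ (by positivity)]
    nlinarith
  rw [Real.dist_eq, abs_lt]
  constructor
  · linarith [hlt g]
  · have h1 := Finset.add_sum_erase Finset.univ (fun g => (u n g).toReal) (Finset.mem_univ g)
    have h2 := Finset.add_sum_erase Finset.univ (fun g => (L g).toReal) (Finset.mem_univ g)
    rw [huR] at h1
    rw [hLR] at h2
    have h3 : ∑ g ∈ Finset.univ.erase g, ((L g).toReal - ε / (Fintype.card G + 1)) ≤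
        ∑ g ∈ Finset.univ.erase g, (u n g).toReal :=
      Finset.sum_le_sum fun g _ => (hlt g).le
    rw [Finset.sum_sub_distrib, Finset.sum_const, Finset.card_erase_of_mem (Finset.mem_univ g),
      Finset.card_univ, nsmul_eq_mul] at h3
    have h4 : ((Fintype.card G - 1 : ℕ) : ℝ) * (ε / (Fintype.card G + 1)) < ε := by
      have : ((Fintype.card G - 1 : ℕ) : ℝ) ≤ Fintype.card G := by exact_mod_cast Nat.sub_le _ _
      rw [mul_div_assoc', div_lt_iff₀ (by positivity)]
      nlinarith
    linarith

variable {Ω : Type*} [MeasurableSpace Ω]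

/-- The expectation of a function of the isomorphism class of a random tree. -/
theorem lintegral_iso (μ : Measure Ω) {X : Ω → RTree} (hX : Measurable X) {φ : RTree → ℝ≥0∞}
    (hφ : ∀ t t', RTree.Iso t t' → φ t = φ t') :
    ∫⁻ ω, φ (X ω) ∂μ =
      ∑' q : Quotient isoSetoid, φ q.out * μ {ω | RTree.Iso (X ω) q.out} := by
  let _ : MeasurableSpace (Quotient isoSetoid) := ⊤
  have : DiscreteMeasurableSpace (Quotient isoSetoid) := ⟨fun _ => trivial⟩
  have hq : Measurable (fun t : RTree => (⟦t⟧ : Quotient isoSetoid)) := Measurable.of_discrete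
  have h1 : ∀ ω, φ (X ω) = (fun q : Quotient isoSetoid => φ q.out) ⟦X ω⟧ := fun ω =>
    hφ _ _ (RTree.Iso.symm (Quotient.mk_out (s := isoSetoid) (X ω)))
  simp_rw [h1]
  have h2 : ∫⁻ ω, (fun q : Quotient isoSetoid => φ q.out) ⟦X ω⟧ ∂μ =
      ∫⁻ q, φ q.out ∂(μ.map fun ω => (⟦X ω⟧ : Quotient isoSetoid)) :=
    (lintegral_map (Measurable.of_discrete (f := fun q : Quotient isoSetoid => φ q.out))
      (hq.comp hX)).symm
  rw [h2, lintegral_countable']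
  refine tsum_congr fun q => ?_
  rw [Measure.map_apply (f := fun ω => (⟦X ω⟧ : Quotient isoSetoid)) (hq.comp hX)
    (MeasurableSet.singleton q)]
  congr 2
  ext ω
  simp only [Set.mem_preimage, Set.mem_singleton_iff, Set.mem_ofPred_eq]
  constructor
  · rintro rfl
    exact RTree.Iso.symm (Quotient.mk_out (s := isoSetoid) (X ω))
  · intro h
    rw [← Quotient.out_eq q]
    exact Quotient.sound (s := isoSetoid) h

/-- Expectations of nonnegative functions of the local structure are lower semicontinuous for the
local convergence. -/
theorem LocallyConverges.lintegral_le {μ : Measure Ω} {T : ℕ → Ω → RTree} {A : ℕ → Ω → Forest}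
    (hT : LocallyConverges μ T A) (hTm : ∀ n, Measurable (T n)) (h : ℕ)
    (hA : Measurable fun ω => SpineTree.trunc h fun i => A i ω) {φ : RTree → ℝ≥0∞}
    (hφ : ∀ t t', RTree.Iso t t' → φ t = φ t') :
    ∫⁻ ω, φ (SpineTree.trunc h fun i => A i ω) ∂μ ≤
      liminf (fun n => ∫⁻ ω, φ ((T n ω).trunc h) ∂μ) atTop := by
  have hTm' : ∀ n, Measurable fun ω => (T n ω).trunc h := fun n =>
    (Measurable.of_discrete (f := RTree.trunc h)).comp (hTm n)
  rw [lintegral_iso μ hA hφ]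
  simp_rw [fun n => lintegral_iso μ (hTm' n) hφ]
  let _ : MeasurableSpace (Quotient isoSetoid) := ⊤
  have : DiscreteMeasurableSpace (Quotient isoSetoid) := ⟨fun _ => trivial⟩
  by_cases htop : ∃ q : Quotient isoSetoid, φ q.out = ∞ ∧
      μ {ω | RTree.Iso (SpineTree.trunc h fun i => A i ω) q.out} ≠ 0
  · obtain ⟨q, hq, hq0⟩ := htop
    have hev : ∀ᶠ n in atTop, μ {ω | RTree.Iso ((T n ω).trunc h) q.out} ≠ 0 :=
      (hT h q.out).eventually_ne hq0
    have : liminf (fun n => ∑' q : Quotient isoSetoid,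
        φ q.out * μ {ω | RTree.Iso ((T n ω).trunc h) q.out}) atTop = ∞ := by
      refine (liminf_congr ?_).trans (liminf_const (f := (atTop : Filter ℕ)) (∞ : ℝ≥0∞))
      filter_upwards [hev] with n hn
      refine ENNReal.tsum_eq_top_of_eq_top ⟨q, ?_⟩
      rw [hq, ENNReal.top_mul hn]
    rw [this]
    exact le_top
  · push Not at htop
    have hlim : ∀ q : Quotient isoSetoid,
        φ q.out * μ {ω | RTree.Iso (SpineTree.trunc h fun i => A i ω) q.out} ≤
        liminf (fun n => φ q.out * μ {ω | RTree.Iso ((T n ω).trunc h) q.out}) atTop := by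
      intro q
      by_cases hq : φ q.out = ∞
      · rw [htop q hq, mul_zero]
        exact zero_le
      · exact (ENNReal.Tendsto.const_mul (hT h q.out) (Or.inr hq)).liminf_eq.ge
    calc _ ≤ ∑' q : Quotient isoSetoid,
          liminf (fun n => φ q.out * μ {ω | RTree.Iso ((T n ω).trunc h) q.out}) atTop :=
          ENNReal.tsum_le_tsum hlim
      _ ≤ _ := by
          simp_rw [← lintegral_count]
          exact lintegral_liminf_le fun n => Measurable.of_discrete

theorem measurable_pre_forest {A : ℕ → Ω → Forest} (hA : ∀ i, Measurable (A i)) (n : ℕ) :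
    Measurable[_, ⊤] fun ω => pre n fun i => A i ω :=
  (measurable_pre_top n).comp (measurable_pi_lambda _ hA)

theorem measurable_comp_pre {Y : Type*} [MeasurableSpace Y] {A : ℕ → Ω → Forest}
    (hA : ∀ i, Measurable (A i)) (n : ℕ) (φ : List Forest → Y) :
    Measurable fun ω => φ (pre n fun i => A i ω) := by
  let _ : MeasurableSpace (List Forest) := ⊤
  have hφ : Measurable φ := fun _ _ => trivial
  exact hφ.comp (measurable_pre_forest hA n)

theorem measurable_trunc {A : ℕ → Ω → Forest} (hA : ∀ i, Measurable (A i)) (h : ℕ) :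
    Measurable fun ω => SpineTree.trunc h fun i => A i ω := by
  have key : ∀ h : ℕ, ∃ φ : List Forest → RTree, ∀ a : ℕ → Forest,
      SpineTree.trunc h a = φ (pre h a) := by
    intro h
    induction h with
    | zero => exact ⟨fun _ => .node [], fun a => rfl⟩
    | succ h ih =>
      obtain ⟨φ, hφ⟩ := ih
      refine ⟨fun l => match l with
        | [] => .node []
        | F :: Fs => .node (φ Fs :: List.map (RTree.trunc h) F), fun a => ?_⟩
      rw [pre_succ, spineTrunc_succ, hφ]
  obtain ⟨φ, hφ⟩ := key h
  simp_rw [hφ]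
  exact measurable_comp_pre hA h φ

variable {k : ℕ} [NeZero k] {μ : Measure Ω} {A : ℕ → Ω → Forest}

theorem lintegral_spineProb (hA : ∀ i, Measurable (A i))
    (hne : ∀ᵐ ω ∂μ, ∀ i, A i ω ≠ ([] : List RTree)) (g : BoolFun k) :
    ∫⁻ ω, spineProb k (fun i => A i ω) g ∂μ =
      ⨆ h, ∫⁻ ω, levelsLaw k h (pre h fun i => A i ω) (fun _ => g) ∂μ := by
  rw [← lintegral_iSup]
  · refine lintegral_congr_ae ?_
    filter_upwards [hne] with ω hω
    rw [spineProb_eq hω]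
  · exact fun h => measurable_comp_pre hA h fun l => levelsLaw k h l fun _ => g
  · intro h h' hh ω
    simp only [← label_forced]
    exact measure_mono (forced_mono g hh)

theorem sum_lintegral_spineProb [IsProbabilityMeasure μ] (hA : ∀ i, Measurable (A i))
    (hne : ∀ᵐ ω ∂μ, ∀ i, A i ω ≠ ([] : List RTree)) :
    ∑ g : BoolFun k, ∫⁻ ω, spineProb k (fun i => A i ω) g ∂μ = 1 := by
  rw [← lintegral_finsetSum']
  · calc _ = ∫⁻ _, 1 ∂μ := by
          refine lintegral_congr_ae ?_
          filter_upwards [hne] with ω hω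
          exact sum_spineProb hω
      _ = 1 := by simp
  · intro g _
    refine AEMeasurable.congr (f := fun ω => ⨆ h, levelsLaw k h (pre h fun i => A i ω) fun _ => g)
      ?_ ?_
    · exact (Measurable.iSup fun h =>
        measurable_comp_pre hA h fun l => levelsLaw k h l fun _ => g).aemeasurable
    · filter_upwards [hne] with ω hω
      rw [spineProb_eq hω]

theorem tendsto_randomTreeProb [IsProbabilityMeasure μ] {T : ℕ → Ω → RTree}
    (hT : LocallyConverges μ T A) (hTm : ∀ n, Measurable (T n)) (hA : ∀ i, Measurable (A i))
    (hne : ∀ᵐ ω ∂μ, ∀ i, A i ω ≠ ([] : List RTree)) (g : BoolFun k) :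
    Tendsto (fun n => randomTreeProb k μ (T n) g) atTop (𝓝 (limitProb k μ A g)) := by
  refine tendsto_of_sum_eq_one (u := fun n g => ∫⁻ ω, treeProb k (T n ω) g ∂μ)
    (L := fun g => ∫⁻ ω, spineProb k (fun i => A i ω) g ∂μ) (fun n => ?_)
    (sum_lintegral_spineProb hA hne) (fun g => ?_) g
  · rw [← lintegral_finsetSum]
    · simp [sum_treeProb]
    · exact fun g _ => (Measurable.of_discrete (f := fun t => treeProb k t g)).comp (hTm n)
  · rw [lintegral_spineProb hA hne]
    refine iSup_le fun h => ?_
    simp_rw [levelsLaw_pre]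
    refine (hT.lintegral_le hTm h (measurable_trunc hA h)
      (φ := fun t => treeLaw k h t fun _ => g) fun t t' ht => ?_).trans ?_
    · rw [treeLaw_iso h ht]
    · refine liminf_le_liminf (Eventually.of_forall fun n => lintegral_mono fun ω => ?_)
      simp only
      rw [treeLaw_trunc]
      exact treeLaw_le_treeProb h _ g

end Convergence

/-! ### Repetitions among the labels of the leaves -/

section Restr

variable {k : ℕ}

mutual
/-- The labels of the leaves. -/
def LTree.lits : LTree k → List (Literal k)
  | .leaf ℓ => [ℓ]
  | .node _ l => LTree.litsList l
/-- The labels of the leaves of a labelled forest. -/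
def LTree.litsList : List (LTree k) → List (Literal k)
  | [] => []
  | t :: ts => t.lits ++ LTree.litsList ts
end

/-- The variables at the leaves of a labelled forest. -/
def varsList (l : List (LTree k)) : List (Fin k) := (LTree.litsList l).map Prod.fst

theorem varsList_cons (t : LTree k) (ts : List (LTree k)) :
    varsList (t :: ts) = t.lits.map Prod.fst ++ varsList ts := by
  simp [varsList, LTree.litsList]

/-- The variables at the leaves of the forests that hang from consecutive spine nodes. -/
def levelsVars (l : List (LLevel k)) : List (Fin k) := l.flatMap fun v => varsList v.forest

theorem levelsVars_cons (v : LLevel k) (l : List (LLevel k)) :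
    levelsVars (v :: l) = varsList v.forest ++ levelsVars l := by
  simp [levelsVars]

theorem levelsVars_append (l l' : List (LLevel k)) :
    levelsVars (l ++ l') = levelsVars l ++ levelsVars l' := by
  simp [levelsVars]

/-- The number of restrictions of a list of variables: the number of entries that belong to `s`,
plus the number of entries outside `s` that are repetitions of a previous entry. -/
def restr (s : Finset (Fin k)) (xs : List (Fin k)) : ℕ :=
  ∑ i, (xs.count i - if i ∈ s then 0 else 1)

theorem restr_nil (s : Finset (Fin k)) : restr s [] = 0 := by simp [restr]

theorem restr_cons (s : Finset (Fin k)) (i : Fin k) (xs : List (Fin k)) :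
    restr s (i :: xs) = (if i ∈ s then 1 else 0) + restr (insert i s) xs := by
  rw [restr, restr, ← Finset.add_sum_erase _ _ (Finset.mem_univ i),
    ← Finset.add_sum_erase _ _ (Finset.mem_univ i), ← add_assoc]
  congr 1
  · by_cases h : i ∈ s
    · simp [h, add_comm]
    · simp [h]
  · refine Finset.sum_congr rfl fun j hj => ?_
    have hj' := Finset.ne_of_mem_erase hj
    simp [hj', List.count_cons_of_ne hj'.symm]

variable (k) in
/-- The law of `n` independent uniform variables. -/
noncomputable def unifs [NeZero k] (n : ℕ) : PMF (List (Fin k)) :=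
  seqList (List.replicate n (PMF.uniformOfFintype (Fin k)))

variable [NeZero k]

theorem unifs_succ (n : ℕ) : unifs k (n + 1) =
    (PMF.uniformOfFintype (Fin k)).bind fun i => (unifs k n).map fun l => i :: l := by
  rw [unifs, List.replicate_succ, seqList]
  rfl

/-- At least `R` restrictions appear among `n` uniform variables with probability
`O(k ^ (-R))`: given the previous ones, each of the variables is a restriction with probability at
most `N / k`. -/
theorem unifs_restr_le (n R N : ℕ) (s : Finset (Fin k)) (hN : s.card + n ≤ N) :
    (unifs k n).toOuterMeasure {xs | R ≤ restr s xs} ≤ n.choose R * ((N : ℝ≥0∞) / k) ^ R := by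
  induction n generalizing s R with
  | zero =>
    cases R with
    | zero => simpa using PMF_toOuterMeasure_le_one _ _
    | succ R => simp [unifs, seqList, restr_nil]
  | succ n ih =>
    cases R with
    | zero => simpa using PMF_toOuterMeasure_le_one _ _
    | succ R =>
      have hk : (k : ℝ≥0∞) ≠ 0 := by exact_mod_cast NeZero.ne k
      have hk' : (k : ℝ≥0∞) ≠ ∞ := ENNReal.natCast_ne_top k
      set θ : ℝ≥0∞ := (N : ℝ≥0∞) / k with hθ
      have h1 : ∀ i : Fin k, ((unifs k n).map fun l => i :: l).toOuterMeasure
          {xs | R + 1 ≤ restr s xs} ≤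
          (if i ∈ s then n.choose R * θ ^ R else 0) + n.choose (R + 1) * θ ^ (R + 1) := by
        intro i
        rw [PMF.toOuterMeasure_map_apply]
        by_cases hi : i ∈ s
        · refine le_trans ?_ (le_add_of_nonneg_right zero_le)
          rw [if_pos hi]
          refine le_trans (measure_mono ?_) (ih R s (by omega))
          intro xs hxs
          have : R + 1 ≤ restr s (i :: xs) := hxs
          rw [restr_cons, if_pos hi, Finset.insert_eq_of_mem hi] at this
          exact (by omega : R ≤ restr s xs)
        · rw [if_neg hi, zero_add]
          refine le_trans (measure_mono ?_) (ih (R + 1) (insert i s) ?_)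
          · intro xs hxs
            have : R + 1 ≤ restr s (i :: xs) := hxs
            rw [restr_cons, if_neg hi, zero_add] at this
            exact this
          · have := Finset.card_insert_le i s
            omega
      rw [unifs_succ, PMF.toOuterMeasure_bind_apply, tsum_fintype]
      calc _ ≤ ∑ i : Fin k, (k : ℝ≥0∞)⁻¹ *
            ((if i ∈ s then n.choose R * θ ^ R else 0) + n.choose (R + 1) * θ ^ (R + 1)) := by
            refine Finset.sum_le_sum fun i _ => ?_
            rw [PMF.uniformOfFintype_apply, Fintype.card_fin]
            exact mul_le_mul_right (h1 i) _
        _ = (s.card : ℝ≥0∞) / k * (n.choose R * θ ^ R) + n.choose (R + 1) * θ ^ (R + 1) := by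
            rw [← Finset.mul_sum, Finset.sum_add_distrib, Finset.sum_ite_mem, Finset.univ_inter,
              Finset.sum_const, Finset.sum_const, Finset.card_univ, Fintype.card_fin, mul_add,
              nsmul_eq_mul, nsmul_eq_mul, ← mul_assoc (k : ℝ≥0∞)⁻¹ (k : ℝ≥0∞),
              ENNReal.inv_mul_cancel hk hk', one_mul, ENNReal.div_eq_inv_mul, mul_assoc]
        _ ≤ θ * (n.choose R * θ ^ R) + n.choose (R + 1) * θ ^ (R + 1) := by
            gcongr
            exact ENNReal.div_le_div_right (by exact_mod_cast (by omega : s.card ≤ N)) _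
        _ = ((n + 1).choose (R + 1) : ℕ) * θ ^ (R + 1) := by
            rw [Nat.choose_succ_succ]
            push_cast
            ring

end Restr

/-! ### The joint law of the connectives and of the variables of the first levels -/

section Joint

theorem seqList_append {X : Type*} (ps qs : List (PMF X)) :
    seqList (ps ++ qs) = (seqList ps).bind fun l => (seqList qs).map fun l' => l ++ l' := by
  induction ps with
  | nil =>
    simp only [List.nil_append, seqList, PMF.pure_bind]
    exact (PMF.map_id _).symm
  | cons p ps ih =>
    simp only [List.cons_append, seqList, ih, PMF.bind_bind, PMF.map_bind, PMF.bind_map,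
      PMF.map_comp]
    rfl

variable {k : ℕ} [NeZero k]

theorem unifs_add (m n : ℕ) :
    unifs k (m + n) = (unifs k m).bind fun l => (unifs k n).map fun l' => l ++ l' := by
  rw [unifs, List.replicate_add, seqList_append]
  rfl

theorem map_fst_uniform :
    (PMF.uniformOfFintype (Literal k)).map Prod.fst = PMF.uniformOfFintype (Fin k) := by
  ext i
  rw [PMF.map_apply, tsum_fintype, Fintype.sum_prod_type,
    Finset.sum_eq_single i (by intro j _ hj; simp [hj.symm]) (by simp)]
  simp only [if_true, PMF.uniformOfFintype_apply, Fintype.card_prod, Fintype.card_fin,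
    Fintype.card_bool, Finset.sum_const, Finset.card_univ, nsmul_eq_mul]
  push_cast
  rw [ENNReal.mul_inv (Or.inr (by simp)) (Or.inr (by simp)), mul_left_comm,
    ENNReal.mul_inv_cancel (by simp) (by simp), mul_one]

theorem map_varsList_labelList_of {F : List RTree}
    (h : ∀ t ∈ F, (RTree.label k t).map (fun τ => τ.lits.map Prod.fst) = unifs k t.size) :
    (RTree.labelList k F).map varsList = unifs k (RTree.sizeList F) := by
  induction F with
  | nil => simp [RTree.labelList, RTree.sizeList, unifs, seqList, PMF.pure_map, varsList,
      LTree.litsList]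
  | cons t ts ih =>
    rw [RTree.labelList, RTree.sizeList, unifs_add, ← h t List.mem_cons_self,
      ← ih fun t ht => h t (List.mem_cons_of_mem _ ht), PMF.map_bind, PMF.bind_map]
    congr 1
    funext τ
    simp only [PMF.map_comp, Function.comp_apply]
    congr 1
    funext τs
    exact varsList_cons τ τs

/-- The variables at the leaves of a random labelling are independent and uniform. -/
theorem map_vars_label (t : RTree) :
    (RTree.label k t).map (fun τ => τ.lits.map Prod.fst) = unifs k t.size := by
  induction hn : sizeOf t using Nat.strong_induction_on generalizing t with
  | _ n ih =>
    subst hn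
    obtain ⟨l⟩ := t
    by_cases hl : l = []
    · subst hl
      rw [label_node_nil, PMF.map_comp]
      have h1 : ((fun τ : LTree k => τ.lits.map Prod.fst) ∘ LTree.leaf) =
          (fun i : Fin k => [i]) ∘ Prod.fst := by
        funext ℓ
        simp [LTree.lits]
      rw [h1, ← PMF.map_comp, map_fst_uniform]
      simp [RTree.size, unifs, seqList, PMF.map, Function.comp_def]
    · rw [label_node k hl, PMF.map_bind]
      have h1 : ∀ c, ((RTree.labelList k l).map (LTree.node c)).map
          (fun τ => τ.lits.map Prod.fst) = (RTree.labelList k l).map varsList := by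
        intro c
        rw [PMF.map_comp]
        congr 1
      simp_rw [h1]
      rw [PMF.bind_const]
      have h2 : ∀ t ∈ l, (RTree.label k t).map (fun τ => τ.lits.map Prod.fst) =
          unifs k t.size := by
        intro t ht
        refine ih _ ?_ t rfl
        have := List.sizeOf_lt_of_mem ht
        simp
        omega
      have h3 : (RTree.node l).size = RTree.sizeList l := by simp [RTree.size, hl]
      rw [h3]
      exact map_varsList_labelList_of h2

theorem map_varsList_labelList (F : List RTree) :
    (RTree.labelList k F).map varsList = unifs k (RTree.sizeList F) :=
  map_varsList_labelList_of fun t _ => map_vars_label t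

/-- The law of `n` independent uniform connectives. -/
noncomputable def conns (n : ℕ) : PMF (List Conn) :=
  seqList (List.replicate n (PMF.uniformOfFintype Conn))

theorem conns_succ (n : ℕ) : conns (n + 1) =
    (PMF.uniformOfFintype Conn).bind fun c => (conns n).map fun l => c :: l := by
  rw [conns, List.replicate_succ, seqList]
  rfl

theorem map_conn_vars (F : Forest) :
    (Forest.label k F).map (fun v => (v.conn, varsList v.forest)) =
      (PMF.uniformOfFintype Conn).bind fun c => (unifs k F.size).map fun xs => (c, xs) := by
  rw [Forest.label, PMF.map_bind]
  congr 1
  funext c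
  refine Eq.trans ?_ (congrArg (PMF.map fun xs => (c, xs)) (map_varsList_labelList F))
  rw [PMF.map_comp, PMF.map_comp]
  rfl

/-- The connectives of the spine nodes are independent of the variables at the leaves. -/
theorem map_joint (Fs : List Forest) :
    (seqList (Fs.map (Forest.label k))).map
      (fun l => (l.map LLevel.conn, levelsVars l)) =
    (conns Fs.length).bind fun cs =>
      (unifs k (Fs.map Forest.size).sum).map fun xs => (cs, xs) := by
  induction Fs with
  | nil => simp [seqList, conns, unifs, PMF.pure_map, levelsVars]
  | cons F Fs ih =>
    have h1 : ∀ v : LLevel k, ((seqList (Fs.map (Forest.label k))).map fun l => v :: l).map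
        (fun l => (l.map LLevel.conn, levelsVars l)) =
        ((conns Fs.length).bind fun cs =>
          (unifs k (Fs.map Forest.size).sum).map fun xs => (cs, xs)).map
          fun p => (v.conn :: p.1, varsList v.forest ++ p.2) := by
      intro v
      rw [← ih, PMF.map_comp, PMF.map_comp]
      congr 1
    rw [List.map_cons, seqList, PMF.map_bind]
    simp_rw [h1]
    have h2 : ∀ (p : PMF (LLevel k)) (q : PMF (List Conn × List (Fin k))),
        (p.bind fun v => q.map fun r => (v.conn :: r.1, varsList v.forest ++ r.2)) =
        (p.map fun v => (v.conn, varsList v.forest)).bind fun u =>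
          q.map fun r => (u.1 :: r.1, u.2 ++ r.2) := by
      intro p q
      rw [PMF.bind_map]
      rfl
    rw [h2, map_conn_vars, PMF.bind_bind, List.length_cons, conns_succ, PMF.bind_bind,
      List.map_cons, List.sum_cons, unifs_add]
    congr 1
    funext c
    simp only [PMF.map, PMF.bind_bind, PMF.pure_bind, Function.comp_def]
    rw [PMF.bind_comm]

theorem toOuterMeasure_bind_prod {X Y : Type*} (p : PMF X) (q : PMF Y) (s : Set X) (t : Set Y) :
    (p.bind fun x => q.map fun y => (x, y)).toOuterMeasure (s ×ˢ t) =
      p.toOuterMeasure s * q.toOuterMeasure t := by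
  classical
  rw [PMF.toOuterMeasure_bind_apply, PMF.toOuterMeasure_apply, ← ENNReal.tsum_mul_right]
  refine tsum_congr fun x => ?_
  rw [PMF.toOuterMeasure_map_apply]
  by_cases hx : x ∈ s
  · simp [hx, Set.preimage]
  · simp [hx, Set.preimage]

/-- The number of pairs of distinct connectives, when the list is cut into consecutive pairs. -/
def altPairs : List Conn → ℕ
  | a :: b :: l => (if a = b then 0 else 1) + altPairs l
  | _ => 0

/-- This is Markov's inequality for `2 ^ (-altPairs cs)`, written as an induction: a pair has
distinct connectives with probability one half, so contributes the
factor `(1 + 1 / 2) / 2 = 3 / 4`. -/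
theorem conns_altPairs_le (i M : ℕ) :
    (conns (2 * i)).toOuterMeasure {cs | altPairs cs < M} ≤ 2 ^ M * (3 / 4) ^ i := by
  induction i generalizing M with
  | zero =>
    refine (PMF_toOuterMeasure_le_one _ _).trans ?_
    rw [pow_zero, mul_one]
    exact one_le_pow₀ (by norm_num)
  | succ i ih =>
    cases M with
    | zero => simp
    | succ M =>
      have h1 : ∀ a b : Conn, (((conns (2 * i)).map fun l => b :: l).map
          fun l => a :: l).toOuterMeasure {cs | altPairs cs < M + 1} ≤
          if a = b then 2 ^ (M + 1) * (3 / 4) ^ i else 2 ^ M * (3 / 4) ^ i := by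
        intro a b
        rw [PMF.toOuterMeasure_map_apply, PMF.toOuterMeasure_map_apply]
        split_ifs with hab
        · refine le_trans (measure_mono fun cs hcs => ?_) (ih (M + 1))
          simpa [altPairs, hab] using hcs
        · refine le_trans (measure_mono fun cs hcs => ?_) (ih M)
          have : altPairs (a :: b :: cs) < M + 1 := hcs
          rw [altPairs, if_neg hab] at this
          exact (by omega : altPairs cs < M)
      have e : (conns (2 * (i + 1))).toOuterMeasure {cs | altPairs cs < M + 1} =
          ∑ a : Conn, 2⁻¹ * ∑ b : Conn, 2⁻¹ * (((conns (2 * i)).map fun l => b :: l).map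
          fun l => a :: l).toOuterMeasure {cs | altPairs cs < M + 1} := by
        rw [show 2 * (i + 1) = 2 * i + 1 + 1 by ring, conns_succ, PMF.toOuterMeasure_bind_apply,
          tsum_fintype]
        refine Finset.sum_congr rfl fun a _ => ?_
        rw [conns_succ, PMF.map_bind, PMF.toOuterMeasure_bind_apply, tsum_fintype, uniform_conn]
        simp_rw [uniform_conn]
      rw [e]
      calc _ ≤ ∑ a : Conn, 2⁻¹ * ∑ b : Conn, 2⁻¹ *
            (if a = b then 2 ^ (M + 1) * (3 / 4 : ℝ≥0∞) ^ i else 2 ^ M * (3 / 4) ^ i) := by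
            gcongr with a _ b _
            exact h1 a b
        _ = (2⁻¹ * 2 ^ (M + 1) + 2⁻¹ * 2 ^ M) * (3 / 4) ^ i := by
            simp only [Fintype.sum_bool]
            simp only [if_true, Bool.true_eq_false, Bool.false_eq_true, if_false]
            have h2 : (2⁻¹ : ℝ≥0∞) + 2⁻¹ = 1 := ENNReal.inv_two_add_inv_two
            calc _ = (2⁻¹ + 2⁻¹) * ((2⁻¹ * 2 ^ (M + 1) + 2⁻¹ * 2 ^ M) * (3 / 4 : ℝ≥0∞) ^ i) := by
                  ring
              _ = _ := by rw [h2, one_mul]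
        _ = 2 ^ (M + 1) * (3 / 4) ^ (i + 1) := by
            have h2 : (2⁻¹ : ℝ≥0∞) * 2 = 1 := ENNReal.inv_mul_cancel (by simp) (by simp)
            have h3 : (2 : ℝ≥0∞) * (3 / 4) = 1 + 2⁻¹ := by
              rw [← ENNReal.toReal_eq_toReal_iff' (by finiteness) (by finiteness)]
              rw [ENNReal.toReal_mul, ENNReal.toReal_add (by simp) (by simp)]
              simp [ENNReal.toReal_div, ENNReal.toReal_inv]
              norm_num
            calc _ = (2⁻¹ * 2 + 2⁻¹) * 2 ^ M * (3 / 4 : ℝ≥0∞) ^ i := by ring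
              _ = (1 + 2⁻¹) * 2 ^ M * (3 / 4 : ℝ≥0∞) ^ i := by rw [h2]
              _ = 2 ^ (M + 1) * (3 / 4) ^ (i + 1) := by rw [← h3]; ring

theorem conns_take_altPairs_le (i M : ℕ) :
    (conns (2 * (i + 1))).toOuterMeasure {cs | altPairs (cs.take (2 * i)) < M} ≤
      2 ^ M * (3 / 4) ^ i := by
  rw [show 2 * (i + 1) = 2 * i + 2 by ring, conns, List.replicate_add, seqList_append]
  refine le_trans ?_ (conns_altPairs_le i M)
  rw [PMF.toOuterMeasure_bind_apply, PMF.toOuterMeasure_apply]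
  refine ENNReal.tsum_le_tsum fun l => ?_
  change conns (2 * i) l * _ ≤ _
  by_cases hl : l ∈ (conns (2 * i)).support
  · have hlen := length_of_mem_support_seqList hl
    rw [List.length_replicate] at hlen
    by_cases hM : altPairs l < M
    · rw [Set.indicator_of_mem (show l ∈ {cs | altPairs cs < M} from hM)]
      exact mul_le_of_le_one_right' (PMF_toOuterMeasure_le_one _ _)
    · rw [PMF.toOuterMeasure_map_apply]
      have : (fun l' => l ++ l') ⁻¹' {cs | altPairs (cs.take (2 * i)) < M} = ∅ := by
        ext l'
        simp only [Set.mem_preimage, Set.mem_ofPred_eq, Set.mem_empty_iff_false, iff_false]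
        rwa [← hlen, List.take_left]
      rw [this, measure_empty, mul_zero]
      exact zero_le
  · rw [(PMF.apply_eq_zero_iff _ _).2 hl, zero_mul]
    exact zero_le

/-- The joint probability of `R` restrictions in `2 * (i + 1)` levels and of fewer than `M` pairs
of distinct connectives among the first `i` pairs. -/
theorem levels_restr_le (Fs : List Forest) (i M R : ℕ) (hFs : Fs.length = 2 * (i + 1))
    (s : Finset (Fin k)) :
    (seqList (Fs.map (Forest.label k))).toOuterMeasure
      {l | altPairs ((l.map LLevel.conn).take (2 * i)) < M ∧ R ≤ restr s (levelsVars l)} ≤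
    2 ^ M * (3 / 4) ^ i * (((Fs.map Forest.size).sum : ℝ≥0∞) ^ R *
      (((s.card + (Fs.map Forest.size).sum : ℕ) : ℝ≥0∞) / k) ^ R) := by
  have h1 : {l : List (LLevel k) |
      altPairs ((l.map LLevel.conn).take (2 * i)) < M ∧ R ≤ restr s (levelsVars l)} =
      (fun l => (l.map LLevel.conn, levelsVars l)) ⁻¹'
        ({cs | altPairs (cs.take (2 * i)) < M} ×ˢ {xs | R ≤ restr s xs}) := by
    ext l
    simp
  rw [h1, ← PMF.toOuterMeasure_map_apply, map_joint, toOuterMeasure_bind_prod, hFs]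
  refine mul_le_mul' (conns_take_altPairs_le i M)
    ((unifs_restr_le _ R _ s le_rfl).trans ?_)
  gcongr
  exact_mod_cast Nat.choose_le_pow _ _

theorem levels_altPairs_le (Fs : List Forest) (i M : ℕ) (hFs : Fs.length = 2 * i) :
    (seqList (Fs.map (Forest.label k))).toOuterMeasure
      {l | altPairs (l.map LLevel.conn) < M} ≤ 2 ^ M * (3 / 4) ^ i := by
  have h1 : {l : List (LLevel k) | altPairs (l.map LLevel.conn) < M} =
      (fun l => (l.map LLevel.conn, levelsVars l)) ⁻¹' ({cs | altPairs cs < M} ×ˢ Set.univ) := by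
    ext l
    simp
  rw [h1, ← PMF.toOuterMeasure_map_apply, map_joint, toOuterMeasure_bind_prod, hFs,
    toOuterMeasure_univ, mul_one]
  exact conns_altPairs_le i M

end Joint

/-! ### Assignments that force the value of a subtree -/

section Settable

variable {k : ℕ}

/-- Labelled trees all of whose internal nodes have a child. -/
inductive LTree.Pos : LTree k → Prop
  | leaf (ℓ : Literal k) : LTree.Pos (LTree.leaf ℓ)
  | node {c : Conn} {l : List (LTree k)} : l ≠ [] → (∀ t ∈ l, LTree.Pos t) →
      LTree.Pos (LTree.node c l)

theorem mem_litsList {ℓ : Literal k} {l : List (LTree k)} :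
    ℓ ∈ LTree.litsList l ↔ ∃ t ∈ l, ℓ ∈ t.lits := by
  induction l with
  | nil => simp [LTree.litsList]
  | cons t ts ih => simp [LTree.litsList, ih]

theorem LTree.Pos.eval_eq {τ : LTree k} (hτ : τ.Pos) {x : Fin k → Bool} {b : Bool}
    (h : ∀ ℓ ∈ τ.lits, Literal.eval x ℓ = b) : τ.eval x = b := by
  induction hn : sizeOf τ using Nat.strong_induction_on generalizing τ with
  | _ n ih =>
    subst hn
    rcases hτ with ℓ | ⟨hl, hpos⟩
    · rw [LTree.eval]
      exact h ℓ (by simp [LTree.lits])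
    · rename_i c l
      rw [LTree.eval_node]
      refine Conn.apply_of_forall_eq (by simpa using hl) ?_
      intro y hy
      obtain ⟨t, ht, rfl⟩ := List.mem_map.1 hy
      refine ih _ ?_ (hpos t ht) (fun ℓ hℓ => h ℓ ?_) rfl
      · have := List.sizeOf_lt_of_mem ht
        simp
        omega
      · rw [LTree.lits]
        exact mem_litsList.2 ⟨t, ht, hℓ⟩

theorem LTree.eval_congr {τ : LTree k} {x y : Fin k → Bool}
    (h : ∀ ℓ ∈ τ.lits, x ℓ.1 = y ℓ.1) : τ.eval x = τ.eval y := by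
  induction hn : sizeOf τ using Nat.strong_induction_on generalizing τ with
  | _ n ih =>
    subst hn
    rcases τ with ℓ | ⟨c, l⟩
    · rw [LTree.eval, LTree.eval, Literal.eval, Literal.eval, h ℓ (by simp [LTree.lits])]
    · rw [LTree.eval_node, LTree.eval_node]
      congr 1
      refine List.map_congr_left fun t ht => ih _ ?_ (fun ℓ hℓ => h ℓ ?_) rfl
      · have := List.sizeOf_lt_of_mem ht
        simp
        omega
      · rw [LTree.lits]
        exact mem_litsList.2 ⟨t, ht, hℓ⟩

theorem exists_assignment (b : Bool) (x : Fin k → Bool) {ls : List (Literal k)}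
    (h : (ls.map Prod.fst).Nodup) :
    ∃ x' : Fin k → Bool, (∀ i ∉ ls.map Prod.fst, x' i = x i) ∧
      ∀ ℓ ∈ ls, Literal.eval x' ℓ = b := by
  induction ls with
  | nil => exact ⟨x, fun _ _ => rfl, by simp⟩
  | cons ℓ ls ih =>
    rw [List.map_cons, List.nodup_cons] at h
    obtain ⟨x', h1, h2⟩ := ih h.2
    refine ⟨Function.update x' ℓ.1 (ℓ.2 == b), fun i hi => ?_, fun ℓ' hℓ' => ?_⟩
    · rw [List.map_cons, List.mem_cons, not_or] at hi
      rw [Function.update_of_ne hi.1, h1 i hi.2]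
    · rcases List.mem_cons.1 hℓ' with rfl | hℓ'
      · rw [Literal.eval, Function.update_self]
        cases b <;> cases ℓ'.2 <;> rfl
      · have hne : ℓ'.1 ≠ ℓ.1 := fun he => h.1 (he ▸ List.mem_map_of_mem hℓ')
        rw [← h2 ℓ' hℓ', Literal.eval, Literal.eval, Function.update_of_ne hne]

/-- The value of the first of the given consecutive spine nodes, when the spine node that follows
the last of them has the value `G`. -/
def spineEval (x : Fin k → Bool) (G : Bool) : List (LLevel k) → Bool
  | [] => G
  | v :: l => v.conn.apply (spineEval x G l :: LTree.evalList x v.forest)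

theorem spineEval_append (x : Fin k → Bool) (G : Bool) (l l' : List (LLevel k)) :
    spineEval x G (l ++ l') = spineEval x (spineEval x G l') l := by
  induction l with
  | nil => rfl
  | cons v l ih => rw [List.cons_append, spineEval, spineEval, ih]

theorem evalList_congr {l : List (LTree k)} {x y : Fin k → Bool}
    (h : ∀ i ∈ varsList l, x i = y i) : LTree.evalList x l = LTree.evalList y l := by
  rw [evalList_eq_map, evalList_eq_map]
  exact List.map_congr_left fun t ht => LTree.eval_congr fun ℓ hℓ =>
    h _ (List.mem_map_of_mem (mem_litsList.2 ⟨t, ht, hℓ⟩))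

theorem spineEval_congr {l : List (LLevel k)} {x y : Fin k → Bool} (G : Bool)
    (h : ∀ i ∈ levelsVars l, x i = y i) : spineEval x G l = spineEval y G l := by
  induction l with
  | nil => rfl
  | cons v l ih =>
    simp only [levelsVars_cons, List.mem_append] at h
    rw [spineEval, spineEval, ih fun i hi => h i (Or.inr hi),
      evalList_congr fun i hi => h i (Or.inl hi)]

/-- The forest of a spine node is not empty and no internal node of its trees is childless. -/
def LLevel.Pos (v : LLevel k) : Prop := v.forest ≠ [] ∧ ∀ t ∈ v.forest, t.Pos

theorem LLevel.Pos.evalList_eq {v : LLevel k} (hv : v.Pos) {x : Fin k → Bool} {b : Bool}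
    (h : ∀ ℓ ∈ LTree.litsList v.forest, Literal.eval x ℓ = b) :
    ∀ y ∈ LTree.evalList x v.forest, y = b := by
  rw [evalList_eq_map]
  intro y hy
  obtain ⟨t, ht, rfl⟩ := List.mem_map.1 hy
  exact (hv.2 t ht).eval_eq fun ℓ hℓ => h ℓ (mem_litsList.2 ⟨t, ht, hℓ⟩)

theorem LLevel.Pos.evalList_ne_nil {v : LLevel k} (hv : v.Pos) (x : Fin k → Bool) :
    LTree.evalList x v.forest ≠ [] := by
  rw [evalList_eq_map]
  simpa using hv.1

theorem literal_eval_congr {x y : Fin k → Bool} {ℓ : Literal k} (h : x ℓ.1 = y ℓ.1) :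
    Literal.eval x ℓ = Literal.eval y ℓ := by
  rw [Literal.eval, Literal.eval, h]

/-- Both truth values can be given to the first of the consecutive spine nodes `l` by changing only
the variables of the leaves attached to `l` that satisfy `P`. The value of the spine node that
follows the last of them is the function `G` of all variables, without any restriction. -/
def Settable (P : Fin k → Prop) (G : BoolFun k) (l : List (LLevel k)) : Prop :=
  ∀ (b : Bool) (x : Fin k → Bool), ∃ x' : Fin k → Bool,
    (∀ i, ¬ (P i ∧ i ∈ levelsVars l) → x' i = x i) ∧ spineEval x' (G x') l = b

theorem Settable.cons {P : Fin k → Prop} {G : BoolFun k} {v : LLevel k} {l : List (LLevel k)}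
    (hl : Settable P G l) (hv : v.Pos) (hvP : ∀ i ∈ varsList v.forest, P i)
    (hP : ∀ i, P i → (levelsVars (v :: l)).count i ≤ 1) : Settable P G (v :: l) := by
  intro b x
  have hcount : ∀ i ∈ varsList v.forest,
      (varsList v.forest).count i + (levelsVars l).count i ≤ 1 := by
    intro i hi
    rw [← List.count_append, ← levelsVars_cons]
    exact hP i (hvP i hi)
  have hnodup : (varsList v.forest).Nodup := by
    rw [List.nodup_iff_count_le_one]
    intro i
    by_cases hi : i ∈ varsList v.forest
    · have := hcount i hi
      omega
    · rw [List.count_eq_zero.2 hi]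
      exact zero_le_one
  obtain ⟨x₁, h1, h2⟩ := exists_assignment b x hnodup
  obtain ⟨x₂, h3, h4⟩ := hl b x₁
  refine ⟨x₂, fun i hi => ?_, ?_⟩
  · rw [levelsVars_cons, List.mem_append] at hi
    rw [h3 i fun h => hi ⟨h.1, Or.inr h.2⟩, h1 i fun h => hi ⟨hvP i h, Or.inl h⟩]
  · rw [spineEval]
    refine Conn.apply_of_forall_eq (by simp) fun y hy => ?_
    rcases List.mem_cons.1 hy with rfl | hy
    · exact h4
    · refine hv.evalList_eq (fun ℓ hℓ => ?_) y hy
      have hmem : ℓ.1 ∈ varsList v.forest := List.mem_map_of_mem hℓ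
      rw [← h2 ℓ hℓ]
      refine literal_eval_congr (h3 _ fun h => ?_)
      have h5 := hcount _ hmem
      have h6 := List.count_pos_iff.2 hmem
      have h7 := List.count_pos_iff.2 h.2
      omega

/-- Two consecutive spine nodes with distinct connectives, all of whose leaves have variables that
satisfy `P` and appear once, are enough whatever follows: set all their leaves to the value `b` to
be forced; one of the two connectives has `b` as its absorbing value. -/
theorem settable_pair {P : Fin k → Prop} {G : BoolFun k} {v w : LLevel k} {l : List (LLevel k)}
    (hv : v.Pos) (hw : w.Pos) (hvw : v.conn ≠ w.conn) (hvP : ∀ i ∈ varsList v.forest, P i)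
    (hwP : ∀ i ∈ varsList w.forest, P i)
    (hP : ∀ i, P i → (levelsVars (v :: w :: l)).count i ≤ 1) : Settable P G (v :: w :: l) := by
  intro b x
  have hmem : ∀ i ∈ varsList v.forest ++ varsList w.forest, P i := fun i hi =>
    (List.mem_append.1 hi).elim (hvP i) (hwP i)
  have hnodup : ((LTree.litsList v.forest ++ LTree.litsList w.forest).map Prod.fst).Nodup := by
    rw [List.map_append]
    change (varsList v.forest ++ varsList w.forest).Nodup
    rw [List.nodup_iff_count_le_one]
    intro i
    by_cases hi : i ∈ varsList v.forest ++ varsList w.forest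
    · refine le_trans ?_ (hP i (hmem i hi))
      rw [levelsVars_cons, levelsVars_cons, ← List.append_assoc,
        List.count_append (l₁ := varsList v.forest ++ varsList w.forest)]
      exact Nat.le_add_right _ _
    · rw [List.count_eq_zero.2 hi]
      exact zero_le_one
  obtain ⟨x', h1, h2⟩ := exists_assignment b x hnodup
  rw [List.map_append] at h1
  have hev := hv.evalList_eq (x := x') (b := b) fun ℓ hℓ => h2 ℓ (List.mem_append_left _ hℓ)
  have hew := hw.evalList_eq (x := x') (b := b) fun ℓ hℓ => h2 ℓ (List.mem_append_right _ hℓ)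
  have hbv : b ∈ LTree.evalList x' v.forest := by
    obtain ⟨y, hy⟩ := List.exists_mem_of_ne_nil _ (hv.evalList_ne_nil x')
    exact hev y hy ▸ hy
  have hbw : b ∈ LTree.evalList x' w.forest := by
    obtain ⟨y, hy⟩ := List.exists_mem_of_ne_nil _ (hw.evalList_ne_nil x')
    exact hew y hy ▸ hy
  refine ⟨x', fun i hi => h1 i fun h => hi ⟨hmem i h, ?_⟩, ?_⟩
  · rw [levelsVars_cons, levelsVars_cons, ← List.append_assoc]
    exact List.mem_append_left _ h
  · rw [spineEval]
    by_cases hb : v.conn = b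
    · rw [hb]
      exact Conn.apply_of_mem (List.mem_cons_of_mem _ hbv)
    · have hb' : w.conn = b := by
        cases b <;> cases hc : v.conn <;> cases hc' : w.conn <;> simp_all
      refine Conn.apply_of_forall_eq (by simp) fun y hy => ?_
      rcases List.mem_cons.1 hy with rfl | hy
      · rw [spineEval, hb']
        exact Conn.apply_of_mem (List.mem_cons_of_mem _ hbw)
      · exact hev y hy

/-- Either some pair of consecutive spine nodes has distinct connectives and only variables that
satisfy `P`, or each pair with distinct connectives has a leaf whose variable fails `P`. -/
theorem exists_pair_or_le (P : Fin k → Prop) [DecidablePred P] : ∀ l : List (LLevel k),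
    (∃ pre v w l', l = pre ++ v :: w :: l' ∧ v.conn ≠ w.conn ∧
      (∀ i ∈ varsList v.forest, P i) ∧ ∀ i ∈ varsList w.forest, P i) ∨
    altPairs (l.map LLevel.conn) ≤ (levelsVars l).countP fun i => ¬ P i
  | [] => Or.inr (by simp [altPairs])
  | [v] => Or.inr (by simp [altPairs])
  | v :: w :: l => by
    rcases exists_pair_or_le P l with ⟨pre, v', w', l', rfl, h1, h2, h3⟩ | h
    · exact Or.inl ⟨v :: w :: pre, v', w', l', rfl, h1, h2, h3⟩
    · by_cases hvw : v.conn = w.conn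
      · right
        simp only [List.map_cons, altPairs, hvw, if_true, zero_add, levelsVars_cons,
          List.countP_append]
        omega
      · by_cases hP : (∀ i ∈ varsList v.forest, P i) ∧ ∀ i ∈ varsList w.forest, P i
        · exact Or.inl ⟨[], v, w, l, rfl, hvw, hP.1, hP.2⟩
        · right
          have h4 : 0 < (varsList v.forest ++ varsList w.forest).countP fun i => ¬ P i := by
            rw [List.countP_pos_iff]
            by_contra hcon
            push Not at hcon
            refine hP ⟨fun i hi => ?_, fun i hi => ?_⟩
            · simpa using hcon i (List.mem_append_left _ hi)
            · simpa using hcon i (List.mem_append_right _ hi)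
          rw [List.countP_append] at h4
          simp only [List.map_cons, altPairs, hvw, if_false, levelsVars_cons,
            List.countP_append]
          omega

end Settable

/-! ### Complexity of a partially evaluated tree -/

section Complexity

variable {k₀ k : ℕ}

/-- The function `h` is constant or is represented by an and/or tree of size at most `n`. -/
def Expressible (h : BoolFun k₀) (n : ℕ) : Prop :=
  (∃ b, ∀ y, h y = b) ∨ ∃ τ : LTree k₀, τ.IsAndOr ∧ τ.fn = h ∧ τ.size ≤ n

theorem Expressible.complexity_le {h : BoolFun k₀} {n : ℕ} (hh : Expressible h n) :
    complexity h ≤ n := by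
  rw [complexity]
  split_ifs with hc
  · exact Nat.zero_le n
  · obtain ⟨τ, h1, h2, h3⟩ := hh.resolve_left hc
    exact le_trans (Nat.sInf_le ⟨τ, h1, h2, rfl⟩) h3

theorem Expressible.mono {h : BoolFun k₀} {m n : ℕ} (hh : Expressible h m) (hmn : m ≤ n) :
    Expressible h n :=
  hh.imp_right fun ⟨τ, h1, h2, h3⟩ => ⟨τ, h1, h2, h3.trans hmn⟩

theorem expressible_const (b : Bool) (n : ℕ) : Expressible (fun _ : Fin k₀ → Bool => b) n :=
  Or.inl ⟨b, fun _ => rfl⟩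

/-- Binary connectives applied to constants simplify, so no leaf is needed for the constants. -/
theorem Expressible.cons {c : Conn} {h : BoolFun k₀} {hs : (Fin k₀ → Bool) → List Bool} {m n : ℕ}
    (hh : Expressible h m) (hhs : Expressible (fun y => c.apply (hs y)) n) :
    Expressible (fun y => c.apply (h y :: hs y)) (m + n) := by
  have e : ∀ y, c.apply (h y :: hs y) = c.apply [h y, c.apply (hs y)] := by
    intro y
    simp only [Conn.apply_cons, Conn.apply_nil]
    cases c <;> simp
  simp_rw [e]
  rcases hh with ⟨b, hb⟩ | ⟨τ, h1, h2, h3⟩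
  · by_cases hbc : b = c
    · refine Or.inl ⟨c, fun y => Conn.apply_of_mem ?_⟩
      rw [hb, hbc]
      exact List.mem_cons_self
    · have : (fun y => c.apply [h y, c.apply (hs y)]) = fun y => c.apply (hs y) := by
        funext y
        simp only [Conn.apply_cons, Conn.apply_nil, hb]
        cases b <;> cases c <;> simp_all
      rw [this]
      exact hhs.mono (Nat.le_add_left _ _)
  · rcases hhs with ⟨b, hb⟩ | ⟨τ', h1', h2', h3'⟩
    · replace hb : ∀ y, c.apply (hs y) = b := hb
      by_cases hbc : b = c
      · refine Or.inl ⟨c, fun y => Conn.apply_of_mem ?_⟩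
        rw [hb, hbc]
        simp
      · refine Or.inr ⟨τ, h1, ?_, h3.trans (Nat.le_add_right _ _)⟩
        funext y
        simp only [Conn.apply_cons, Conn.apply_nil, hb, h2]
        cases b <;> cases c <;> simp_all
    · refine Or.inr ⟨.node c [τ, τ'], .node (by simp) ?_, ?_, ?_⟩
      · intro t ht
        rcases List.mem_cons.1 ht with rfl | ht
        · exact h1
        · rw [List.mem_singleton.1 ht]
          exact h1'
      · funext y
        change (LTree.node c [τ, τ']).eval y = _
        rw [LTree.eval_node]
        simp only [List.map_cons, List.map_nil]
        rw [← congrFun h2 y, ← congrFun h2' y]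
        rfl
      · simp only [LTree.size, LTree.sizeList]
        omega

/-- An assignment of the first `k₀` variables is completed by giving the value `False` to
the other variables. -/
def extend (k : ℕ) (y : Fin k₀ → Bool) : Fin k → Bool :=
  fun i => if h : (i : ℕ) < k₀ then y ⟨i, h⟩ else false

theorem lift_extend (f : BoolFun k₀) (hk : k₀ ≤ k) (y : Fin k₀ → Bool) :
    f.lift hk (extend k y) = f y := by
  rw [BoolFun.lift]
  congr 1
  funext i
  simp [extend]

/-- The variables among the first `k₀`. -/
def firstVars (k₀ k : ℕ) : Finset (Fin k) := Finset.univ.filter fun i => (i : ℕ) < k₀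

theorem mem_firstVars {i : Fin k} : i ∈ firstVars k₀ k ↔ (i : ℕ) < k₀ := by simp [firstVars]

theorem card_firstVars_le : (firstVars k₀ k).card ≤ k₀ := by
  rw [firstVars]
  calc _ ≤ (Finset.range k₀).card := by
        refine Finset.card_le_card_of_injOn (fun i : Fin k => (i : ℕ)) ?_ ?_
        · intro i hi
          simpa using hi
        · exact fun i _ j _ h => Fin.ext h
    _ = k₀ := Finset.card_range _

/-- Once the variables other than the first `k₀` are fixed, their leaves become constants and can be
eliminated. -/
theorem LTree.expressible (τ : LTree k) :
    Expressible (fun y : Fin k₀ → Bool => τ.eval (extend k y))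
      ((τ.lits.map Prod.fst).countP (· ∈ firstVars k₀ k)) := by
  induction hn : sizeOf τ using Nat.strong_induction_on generalizing τ with
  | _ n ih =>
    subst hn
    rcases τ with ℓ | ⟨c, l⟩
    · simp only [LTree.eval, Literal.eval, LTree.lits]
      by_cases h : (ℓ.1 : ℕ) < k₀
      · refine Or.inr ⟨.leaf (⟨ℓ.1, h⟩, ℓ.2), .leaf _, ?_, ?_⟩
        · funext y
          simp [LTree.fn, LTree.eval, Literal.eval, extend, h]
        · simp [LTree.size, mem_firstVars, h]
      · simp only [extend, h, dif_neg, not_false_eq_true]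
        exact expressible_const _ _
    · simp only [LTree.eval_node, LTree.lits]
      have h1 : ∀ t ∈ l, Expressible (fun y : Fin k₀ → Bool => t.eval (extend k y))
          ((t.lits.map Prod.fst).countP (· ∈ firstVars k₀ k)) := by
        intro t ht
        refine ih _ ?_ t rfl
        have := List.sizeOf_lt_of_mem ht
        simp
        omega
      clear ih
      induction l with
      | nil =>
        simp only [List.map_nil, Conn.apply_nil]
        exact expressible_const _ _
      | cons t ts ih' =>
        simp only [LTree.litsList, List.map_cons, List.map_append, List.countP_append]
        exact (h1 t List.mem_cons_self).cons (ih' fun t ht => h1 t (List.mem_cons_of_mem _ ht))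

theorem spineEval_expressible (b : Bool) (l : List (LLevel k)) :
    Expressible (fun y : Fin k₀ → Bool => spineEval (extend k y) b l)
      ((levelsVars l).countP (· ∈ firstVars k₀ k)) := by
  induction l with
  | nil => exact expressible_const _ _
  | cons v l ih =>
    simp only [spineEval, levelsVars_cons, List.countP_append]
    rw [add_comm]
    refine ih.cons ?_
    have := LTree.expressible (k₀ := k₀) (.node v.conn v.forest)
    simp only [LTree.eval, LTree.lits] at this
    exact this

end Complexity

/-! ### A tree that represents a function has many restrictions -/

section Restrictions

variable {k₀ k : ℕ}

theorem countP_eq_sum_count {n : ℕ} (p : Fin n → Prop) [DecidablePred p] (xs : List (Fin n)) :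
    xs.countP (fun i => p i) = ∑ i, if p i then xs.count i else 0 := by
  induction xs with
  | nil => simp
  | cons a xs ih =>
    rw [List.countP_cons, ih, ← Finset.add_sum_erase _ _ (Finset.mem_univ a),
      ← Finset.add_sum_erase _ (fun i => if p i then (a :: xs).count i else 0)
        (Finset.mem_univ a)]
    have : ∑ i ∈ Finset.univ.erase a, (if p i then (a :: xs).count i else 0) =
        ∑ i ∈ Finset.univ.erase a, if p i then xs.count i else 0 := by
      refine Finset.sum_congr rfl fun i hi => ?_
      rw [List.count_cons_of_ne (Finset.ne_of_mem_erase hi).symm]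
    rw [this]
    by_cases ha : p a
    · simp [ha]
      omega
    · simp [ha]

/-- A leaf whose variable appears `c ≥ 2` times is one of `c` leaves that count for `c - 1 ≥ c / 2`
restrictions. -/
theorem countP_le_two_mul_restr (s : Finset (Fin k)) (xs : List (Fin k)) :
    xs.countP (fun i => ¬ (i ∉ s ∧ xs.count i = 1)) ≤ 2 * restr s xs := by
  rw [countP_eq_sum_count (fun i => ¬ (i ∉ s ∧ xs.count i = 1)), restr, Finset.mul_sum]
  refine Finset.sum_le_sum fun i _ => ?_
  by_cases h1 : i ∈ s
  · simp [h1]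
    omega
  · simp only [h1, not_false_eq_true, true_and, ite_not, if_false]
    split_ifs <;> omega

theorem countP_mem_le_restr (s : Finset (Fin k)) (xs : List (Fin k)) :
    xs.countP (· ∈ s) ≤ restr s xs := by
  rw [countP_eq_sum_count (· ∈ s), restr]
  refine Finset.sum_le_sum fun i _ => ?_
  by_cases h1 : i ∈ s <;> simp [h1]

theorem countP_mem_lt_restr {s : Finset (Fin k)} {xs : List (Fin k)} {j : Fin k} (hj : j ∉ s)
    (hj' : 2 ≤ xs.count j) : xs.countP (· ∈ s) < restr s xs := by
  rw [countP_eq_sum_count (· ∈ s), restr]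
  refine Finset.sum_lt_sum (fun i _ => ?_) ⟨j, Finset.mem_univ j, ?_⟩
  · by_cases h1 : i ∈ s <;> simp [h1]
  · simp only [hj, if_false]
    omega

theorem countP_lt_restr_of_mem {s : Finset (Fin k)} {xs ys zs : List (Fin k)} {j : Fin k}
    (hj : j ∈ ys) (hj' : ¬ (j ∉ s ∧ (xs ++ (ys ++ zs)).count j = 1)) :
    xs.countP (· ∈ s) < restr s (xs ++ (ys ++ zs)) := by
  have hle : xs.countP (· ∈ s) ≤ (xs ++ (ys ++ zs)).countP (· ∈ s) := by
    rw [List.countP_append]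
    exact Nat.le_add_right _ _
  by_cases hs : j ∈ s
  · refine lt_of_lt_of_le ?_ (countP_mem_le_restr s _)
    have : 0 < ys.countP (· ∈ s) := List.countP_pos_iff.2 ⟨j, hj, by simpa using hs⟩
    rw [List.countP_append, List.countP_append]
    omega
  · refine hle.trans_lt (countP_mem_lt_restr hs ?_)
    have h1 : 0 < (xs ++ (ys ++ zs)).count j := List.count_pos_iff.2 (by simp [hj])
    have h2 : (xs ++ (ys ++ zs)).count j ≠ 1 := fun h => hj' ⟨hs, h⟩
    omega

/-- If a spine node can be forced, then so can the spine nodes closer to the root, until one of them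
has a leaf whose variable appears twice or is one of those of `f`. Giving there the absorbing value
to the next spine node shows that the levels closer to the root represent `f`, so that at least
`complexity f` of their leaves have a variable of `f`; the leaf just met, or another one
with its variable, is one more restriction. -/
theorem restr_of_settable {f : BoolFun k₀} (hk : k₀ ≤ k) {G : BoolFun k} {l : List (LLevel k)}
    (hl : ∀ v ∈ l, v.Pos) (hrep : ∀ x, spineEval x (G x) l = f.lift hk x)
    (l₁ l₂ : List (LLevel k)) (h12 : l = l₁ ++ l₂)
    (hs : Settable (fun i => i ∉ firstVars k₀ k ∧ (levelsVars l).count i = 1) G l₂) :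
    complexity f < restr (firstVars k₀ k) (levelsVars l) := by
  have hlift : ∀ x x' : Fin k → Bool, (∀ i ∈ firstVars k₀ k, x' i = x i) →
      f.lift hk x' = f.lift hk x := by
    intro x x' h
    rw [BoolFun.lift, BoolFun.lift]
    congr 1
    funext i
    exact h _ (mem_firstVars.2 (by simp))
  induction l₁ using List.reverseRecOn generalizing l₂ with
  | nil =>
    -- the root itself cannot be forced without changing the variables of `f`
    exfalso
    rw [List.nil_append] at h12
    subst h12
    obtain ⟨x', h1, h2⟩ := hs (!f.lift hk fun _ => false) fun _ => false
    rw [hrep, hlift (fun _ => false) x' fun i hi => h1 i fun h => h.1.1 hi] at h2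
    cases h : f.lift hk fun _ => false <;> simp [h] at h2
  | append_singleton l₁ u ih =>
    have h12' : l = l₁ ++ (u :: l₂) := by rw [h12]; simp
    by_cases hu : ∀ i ∈ varsList u.forest,
        i ∉ firstVars k₀ k ∧ (levelsVars l).count i = 1
    · refine ih (u :: l₂) h12' (hs.cons (hl u (by rw [h12']; simp)) hu fun i hi => ?_)
      rw [← hi.2, h12', levelsVars_append, List.count_append]
      exact Nat.le_add_left _ _
    · push Not at hu
      obtain ⟨j, hj, hj'⟩ := hu
      -- forcing `u` to its absorbing value changes no variable of `f` and no leaf of `l₁`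
      have hf : ∀ x, f.lift hk x = spineEval x u.conn l₁ := by
        intro x
        obtain ⟨x', h1, h2⟩ := hs u.conn x
        rw [← hlift x x' fun i hi => h1 i fun h => h.1.1 hi, ← hrep, h12', spineEval_append]
        have h3 : spineEval x' (G x') (u :: l₂) = u.conn := by
          rw [spineEval, h2]
          exact Conn.apply_of_mem List.mem_cons_self
        rw [h3]
        refine spineEval_congr _ fun i hi => h1 i fun h => ?_
        have h4 := h.1.2
        rw [h12', levelsVars_append, levelsVars_cons, List.count_append, List.count_append] at h4
        have h5 := List.count_pos_iff.2 hi
        have h6 := List.count_pos_iff.2 h.2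
        omega
      have hf' : f = fun y => spineEval (extend k y) u.conn l₁ := by
        funext y
        rw [← hf, lift_extend]
      have hc : complexity f ≤ (levelsVars l₁).countP (· ∈ firstVars k₀ k) := by
        rw [hf']
        exact (spineEval_expressible u.conn l₁).complexity_le
      refine hc.trans_lt ?_
      have hxs : levelsVars l = levelsVars l₁ ++ (varsList u.forest ++ levelsVars l₂) := by
        rw [h12', levelsVars_append, levelsVars_cons]
      rw [hxs]
      refine countP_lt_restr_of_mem hj fun h => ?_
      rw [← hxs] at h
      exact hj' h.1 h.2

/-- If a tree represents `f` and some of its first levels `l` contain more than `2 * complexity f`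
pairs of distinct connectives, then there are more than `complexity f` restrictions among the labels
of these levels, whatever the function `G` represented by the rest of the tree. -/
theorem restr_of_represents {f : BoolFun k₀} (hk : k₀ ≤ k) {G : BoolFun k} {l : List (LLevel k)}
    (hl : ∀ v ∈ l, v.Pos) (hrep : ∀ x, spineEval x (G x) l = f.lift hk x)
    (hM : 2 * complexity f < altPairs (l.map LLevel.conn)) :
    complexity f < restr (firstVars k₀ k) (levelsVars l) := by
  classical
  rcases exists_pair_or_le
      (fun i => i ∉ firstVars k₀ k ∧ (levelsVars l).count i = 1) l with
    ⟨l₁, v, w, l₂, h12, hvw, hv, hw⟩ | h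
  · refine restr_of_settable hk hl hrep l₁ (v :: w :: l₂) h12
      (settable_pair (hl v (by rw [h12]; simp)) (hl w (by rw [h12]; simp)) hvw hv hw fun i hi => ?_)
    rw [← hi.2, h12, levelsVars_append, List.count_append]
    exact Nat.le_add_left _ _
  · have := h.trans (countP_le_two_mul_restr _ _)
    omega

end Restrictions

/-! ### Upper bound for the probability of a function -/

section Upper

section Pos

variable {k : ℕ} [NeZero k]

theorem pos_of_mem_support_label {t : RTree} {τ : LTree k} (hτ : τ ∈ (RTree.label k t).support) :
    τ.Pos := by
  induction hn : sizeOf t using Nat.strong_induction_on generalizing t τ with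
  | _ n ih =>
    subst hn
    obtain ⟨l⟩ := t
    by_cases hl : l = []
    · subst hl
      rw [label_node_nil, PMF.mem_support_map_iff] at hτ
      obtain ⟨ℓ, -, rfl⟩ := hτ
      exact .leaf ℓ
    · rw [label_node k hl, PMF.mem_support_bind_iff] at hτ
      obtain ⟨c, -, hτ⟩ := hτ
      rw [PMF.mem_support_map_iff] at hτ
      obtain ⟨l', hl', rfl⟩ := hτ
      refine .node (ne_nil_of_mem_support_labelList hl' hl) fun τ hτ => ?_
      rw [labelList_eq_seqList, mem_support_seqList, List.forall₂_map_right_iff] at hl'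
      obtain ⟨t, ht, h⟩ : ∃ t ∈ l, τ ∈ (RTree.label k t).support := by
        clear ih hl
        induction hl' with
        | nil => simp at hτ
        | cons h _ ih' =>
          rcases List.mem_cons.1 hτ with rfl | hτ
          · exact ⟨_, List.mem_cons_self, h⟩
          · obtain ⟨t, ht, h⟩ := ih' hτ
            exact ⟨t, List.mem_cons_of_mem _ ht, h⟩
      refine ih _ ?_ h rfl
      have := List.sizeOf_lt_of_mem ht
      simp
      omega

theorem mem_support_forest_label {F : Forest} {v : LLevel k} :
    v ∈ (Forest.label k F).support ↔ v.forest ∈ (RTree.labelList k F).support := by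
  rw [Forest.label, PMF.mem_support_bind_iff]
  constructor
  · rintro ⟨c, -, hv⟩
    rw [PMF.mem_support_map_iff] at hv
    obtain ⟨l, hl, rfl⟩ := hv
    exact hl
  · intro h
    exact ⟨v.conn, by simp, (PMF.mem_support_map_iff _ _ _).2 ⟨v.forest, h, rfl⟩⟩

theorem pos_of_mem_support_labelList {F : List RTree} {l : List (LTree k)}
    (hl : l ∈ (RTree.labelList k F).support) : ∀ τ ∈ l, τ.Pos := by
  rw [labelList_eq_seqList, mem_support_seqList, List.forall₂_map_right_iff] at hl
  induction hl with
  | nil => simp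
  | cons h _ ih =>
    intro τ hτ
    rcases List.mem_cons.1 hτ with rfl | hτ
    · exact pos_of_mem_support_label h
    · exact ih τ hτ

theorem ae_label {a : ℕ → Forest} {P : ℕ → LLevel k → Prop}
    (h : ∀ i, ∀ v ∈ (Forest.label k (a i)).support, P i v) :
    ∀ᵐ σ ∂(SpineTree.label k a), ∀ i, P i (σ i) := by
  rw [ae_all_iff]
  intro i
  have h1 : ∀ᵐ v ∂(Forest.label k (a i)).toMeasure, P i v := by
    rw [ae_iff, PMF.toMeasure_apply_eq_zero_iff _ MeasurableSet.of_discrete]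
    exact Set.disjoint_left.2 fun v hv hv' => hv' (h i v hv)
  exact (measurePreserving_eval_infinitePi
    (fun i => (Forest.label k (a i)).toMeasure) i).quasiMeasurePreserving.ae h1

theorem ae_pos {a : ℕ → Forest} (ha : ∀ i, a i ≠ ([] : List RTree)) :
    ∀ᵐ σ ∂(SpineTree.label k a), ∀ i, (σ i).Pos := by
  refine ae_label (P := fun _ => LLevel.Pos) fun i v hv => ?_
  rw [mem_support_forest_label] at hv
  exact ⟨ne_nil_of_mem_support_labelList hv (ha i), pos_of_mem_support_labelList hv⟩

end Pos

variable {k₀ k : ℕ}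

theorem cutEval_add (x : Fin k → Bool) (n h : ℕ) (σ : LSpineTree k) :
    LSpineTree.cutEval x (n + h) σ =
      spineEval x (LSpineTree.cutEval x h fun i => σ (n + i)) (pre n σ) := by
  induction n generalizing σ with
  | zero => simp [pre_zero, spineEval]
  | succ n ih =>
    rw [show n + 1 + h = n + h + 1 by ring, LSpineTree.cutEval, ih, pre_succ, spineEval]
    congr 4
    funext i
    rw [add_right_comm]

theorem exists_spineEval_eq {σ : LSpineTree k} {g : BoolFun k} (hσ : σ.Represents g) (n : ℕ) :
    ∃ G : BoolFun k, ∀ x, spineEval x (G x) (pre n σ) = g x := by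
  obtain ⟨N, hN⟩ := eventually_atTop.1 hσ
  refine ⟨fun x => LSpineTree.cutEval x N fun i => σ (n + i), fun x => ?_⟩
  rw [← cutEval_add, hN _ (Nat.le_add_left _ _)]

variable [NeZero k]

/-- The number of leaves in the forests that hang from the first `n` spine nodes. -/
def sizeUpTo (a : ℕ → Forest) (n : ℕ) : ℕ := ((pre n a).map Forest.size).sum

theorem take_pre {X : Type*} (σ : ℕ → X) {m n : ℕ} (h : m ≤ n) : (pre n σ).take m = pre m σ := by
  obtain ⟨d, rfl⟩ := Nat.exists_eq_add_of_le h
  rw [pre_add]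
  nth_rw 1 [← length_pre m σ]
  exact List.take_left

/-- The exploration of the spine stops at the first pair of levels by which
`2 * complexity f + 1` pairs of distinct connectives have been found, or after `n` pairs. The sum is
over the index `i` of the last pair explored; the condition that the first `i` pairs do not suffice
only involves connectives, hence is independent of the restrictions among the labels. -/
theorem spineProb_lift_le (f : BoolFun k₀) (hk : k₀ ≤ k) {a : ℕ → Forest}
    (ha : ∀ i, a i ≠ ([] : List RTree)) (n : ℕ) :
    spineProb k a (f.lift hk) ≤ 2 ^ (2 * complexity f + 1) * (3 / 4) ^ n +
      ∑ i ∈ Finset.range n, 2 ^ (2 * complexity f + 1) * (3 / 4) ^ i *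
        ((sizeUpTo a (2 * (i + 1)) : ℝ≥0∞) ^ (complexity f + 1) *
          (((k₀ + sizeUpTo a (2 * (i + 1)) : ℕ) : ℝ≥0∞) / k) ^ (complexity f + 1)) := by
  set L := complexity f with hL
  set E₀ : Set (List (LLevel k)) := {l | altPairs (l.map LLevel.conn) < 2 * L + 1} with hE₀
  set E : ℕ → Set (List (LLevel k)) := fun i =>
    {l | altPairs ((l.map LLevel.conn).take (2 * i)) < 2 * L + 1 ∧
      L + 1 ≤ restr (firstVars k₀ k) (levelsVars l)} with hE
  have hincl : ∀ᵐ σ ∂(SpineTree.label k a), σ ∈ {σ | LSpineTree.Represents σ (f.lift hk)} →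
      σ ∈ {σ | pre (2 * n) σ ∈ E₀} ∪
        ⋃ i ∈ Finset.range n, {σ | pre (2 * (i + 1)) σ ∈ E i} := by
    filter_upwards [ae_pos ha] with σ hσ hrep
    by_cases h0 : altPairs ((pre (2 * n) σ).map LLevel.conn) < 2 * L + 1
    · exact Or.inl h0
    · right
      have hex : ∃ j, ¬ altPairs ((pre (2 * j) σ).map LLevel.conn) < 2 * L + 1 := ⟨n, h0⟩
      classical
      have hj := Nat.find_spec hex
      have hjn : Nat.find hex ≤ n := Nat.find_min' hex h0
      obtain ⟨i, hi⟩ : ∃ i, Nat.find hex = i + 1 := by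
        refine Nat.exists_eq_succ_of_ne_zero fun h => ?_
        rw [h] at hj
        simp [pre_zero, altPairs] at hj
      have hi' := Nat.find_min hex (m := i) (by omega)
      rw [not_not] at hi'
      rw [hi] at hj
      refine Set.mem_biUnion (x := i) (by simp; omega) ⟨?_, ?_⟩
      · rw [← List.map_take, take_pre σ (by omega)]
        exact hi'
      · obtain ⟨G, hG⟩ := exists_spineEval_eq hrep (2 * (i + 1))
        refine restr_of_represents hk (fun v hv => ?_) hG (by omega)
        obtain ⟨j, -, rfl⟩ := mem_pre.1 hv
        exact hσ j
  calc spineProb k a (f.lift hk)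
      ≤ SpineTree.label k a ({σ | pre (2 * n) σ ∈ E₀} ∪
        ⋃ i ∈ Finset.range n, {σ | pre (2 * (i + 1)) σ ∈ E i}) := measure_mono_ae hincl
    _ ≤ SpineTree.label k a {σ | pre (2 * n) σ ∈ E₀} +
        ∑ i ∈ Finset.range n, SpineTree.label k a {σ | pre (2 * (i + 1)) σ ∈ E i} :=
        (measure_union_le _ _).trans (add_le_add_right (measure_biUnion_finset_le _ _) _)
    _ ≤ _ := by
        refine add_le_add ?_ (Finset.sum_le_sum fun i _ => ?_)
        · rw [label_pre, ← map_pre (Forest.label k)]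
          exact levels_altPairs_le _ n _ (length_pre _ _)
        · rw [label_pre, ← map_pre (Forest.label k)]
          refine (levels_restr_le _ i _ _ (length_pre _ _) _).trans ?_
          change _ * ((sizeUpTo a (2 * (i + 1)) : ℝ≥0∞) ^ _ * _) ≤ _
          gcongr
          · exact card_firstVars_le
          · exact le_rfl

theorem sum_pow_le_mul_sum_pow {n : ℕ} (hn : 0 < n) (m : ℕ) (s : ℕ → ℕ) :
    (∑ j ∈ Finset.range n, s j) ^ m ≤ n ^ m * ∑ j ∈ Finset.range n, s j ^ m := by
  obtain ⟨j, hj, hmax⟩ := Finset.exists_max_image (Finset.range n) s ⟨0, by simpa using hn⟩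
  calc (∑ j ∈ Finset.range n, s j) ^ m ≤ (n * s j) ^ m := by
        gcongr
        calc _ ≤ ∑ i ∈ Finset.range n, s j := Finset.sum_le_sum hmax
          _ = _ := by simp
    _ = n ^ m * s j ^ m := mul_pow _ _ _
    _ ≤ _ := by
        gcongr
        exact Finset.single_le_sum (f := fun j => s j ^ m) (fun _ _ => Nat.zero_le _) hj

theorem sizeUpTo_eq_sum (a : ℕ → Forest) (n : ℕ) :
    sizeUpTo a n = ∑ j ∈ Finset.range n, (a j).size := by
  rw [sizeUpTo, map_pre, pre, List.sum_ofFn, Finset.sum_range]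

variable {Ω : Type*} [MeasurableSpace Ω] {μ : Measure Ω} {A : ℕ → Ω → Forest}
  {α : Measure Forest}

theorem lintegral_sizeUpTo_pow_le (hA : ∀ i, Measurable (A i)) (hlaw : ∀ i, μ.map (A i) = α)
    (n m : ℕ) (hn : 0 < n) :
    ∫⁻ ω, (sizeUpTo (fun i => A i ω) n : ℝ≥0∞) ^ m ∂μ ≤
      n ^ (m + 1) * ∫⁻ F, (F.size : ℝ≥0∞) ^ m ∂α := by
  have hm : ∀ j, Measurable fun ω => ((A j ω).size : ℝ≥0∞) ^ m := fun j =>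
    (Measurable.of_discrete (f := fun F : Forest => (F.size : ℝ≥0∞) ^ m)).comp (hA j)
  calc _ ≤ ∫⁻ ω, n ^ m * ∑ j ∈ Finset.range n, ((A j ω).size : ℝ≥0∞) ^ m ∂μ := by
        refine lintegral_mono fun ω => ?_
        simp only [sizeUpTo_eq_sum]
        exact_mod_cast sum_pow_le_mul_sum_pow hn m fun j => (A j ω).size
    _ = n ^ m * ∑ j ∈ Finset.range n, ∫⁻ ω, ((A j ω).size : ℝ≥0∞) ^ m ∂μ := by
        rw [lintegral_const_mul _ (Finset.measurable_sum _ fun j _ => hm j),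
          lintegral_finsetSum _ fun j _ => hm j]
    _ = n ^ (m + 1) * ∫⁻ F, (F.size : ℝ≥0∞) ^ m ∂α := by
        have : ∀ j, ∫⁻ ω, ((A j ω).size : ℝ≥0∞) ^ m ∂μ = ∫⁻ F, (F.size : ℝ≥0∞) ^ m ∂α := by
          intro j
          rw [← hlaw j, lintegral_map Measurable.of_discrete (hA j)]
        simp only [this, Finset.sum_const, Finset.card_range, nsmul_eq_mul]
        ring

/-- The exponential tail of the number of explored levels beats the polynomial growth of the moments
of the number of leaves. -/
theorem tsum_geometric_mul_pow_ne_top (m : ℕ) :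
    ∑' i : ℕ, (3 / 4 : ℝ≥0∞) ^ i * ((2 * (i + 1) : ℕ) : ℝ≥0∞) ^ m ≠ ∞ := by
  have h1 : Summable fun i : ℕ => (3 / 4 : ℝ) ^ i * ((2 * (i + 1) : ℕ) : ℝ) ^ m := by
    have h2 := summable_pow_mul_geometric_of_norm_lt_one m (r := (3 / 4 : ℝ)) (by norm_num)
    have h3 := ((summable_nat_add_iff 1).2 h2).mul_left ((4 / 3) * 2 ^ m)
    refine h3.congr fun i => ?_
    push_cast
    rw [mul_pow, pow_succ]
    ring
  have h4 : ∀ i : ℕ, (3 / 4 : ℝ≥0∞) ^ i * ((2 * (i + 1) : ℕ) : ℝ≥0∞) ^ m =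
      ENNReal.ofReal ((3 / 4 : ℝ) ^ i * ((2 * (i + 1) : ℕ) : ℝ) ^ m) := by
    intro i
    rw [ENNReal.ofReal_mul (by positivity), ENNReal.ofReal_pow (by norm_num),
      ENNReal.ofReal_pow (by positivity), ENNReal.ofReal_natCast,
      ENNReal.ofReal_div_of_pos (by norm_num)]
    norm_num
  simp_rw [h4]
  exact h1.tsum_ofReal_ne_top

/-- The probability that the random labelling of the limit tree represents `f` is
`O(k ^ (-(L(f) + 1)))`. -/
theorem exists_lintegral_spineProb_le (f : BoolFun k₀)
    (hmom : ∀ m : ℕ, ∫⁻ F, (F.size : ℝ≥0∞) ^ m ∂α ≠ ∞) :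
    ∃ C : ℝ≥0∞, C ≠ ∞ ∧ ∀ (k : ℕ) [NeZero k] (hk : k₀ ≤ k) (A : ℕ → Ω → Forest)
      [IsProbabilityMeasure μ],
      (∀ i, Measurable (A i)) → (∀ i, μ.map (A i) = α) →
      (∀ᵐ ω ∂μ, ∀ i, A i ω ≠ ([] : List RTree)) →
      ∫⁻ ω, spineProb k (fun i => A i ω) (f.lift hk) ∂μ ≤ C / (k : ℝ≥0∞) ^ (complexity f + 1) := by
  set L := complexity f with hL
  set R := L + 1 with hR
  set D : ℝ≥0∞ := 2 ^ (2 * L + 1) * (k₀ + 1 : ℕ) ^ R * ∫⁻ F, (F.size : ℝ≥0∞) ^ (2 * R) ∂α with hD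
  set C : ℝ≥0∞ := D * ∑' i : ℕ, (3 / 4 : ℝ≥0∞) ^ i * ((2 * (i + 1) : ℕ) : ℝ≥0∞) ^ (2 * R + 1)
    with hC
  refine ⟨C, ?_, ?_⟩
  · have := hmom (2 * R)
    have := tsum_geometric_mul_pow_ne_top (2 * R + 1)
    finiteness
  · intro k _ hk A _ hA hlaw hne
    have hmeas : ∀ n : ℕ, ∀ φ : ℕ → ℝ≥0∞,
        Measurable fun ω => φ (sizeUpTo (fun i => A i ω) n) := fun n φ =>
      measurable_comp_pre hA n fun l => φ ((l.map Forest.size).sum)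
    have hterm : ∀ i : ℕ, ∫⁻ ω, 2 ^ (2 * L + 1) * (3 / 4 : ℝ≥0∞) ^ i *
        ((sizeUpTo (fun i => A i ω) (2 * (i + 1)) : ℝ≥0∞) ^ R *
          (((k₀ + sizeUpTo (fun i => A i ω) (2 * (i + 1)) : ℕ) : ℝ≥0∞) / k) ^ R) ∂μ ≤
        D * ((3 / 4 : ℝ≥0∞) ^ i * ((2 * (i + 1) : ℕ) : ℝ≥0∞) ^ (2 * R + 1)) / (k : ℝ≥0∞) ^ R := by
      intro i
      have hS : ∀ S : ℕ, (S : ℝ≥0∞) ^ R * (((k₀ + S : ℕ) : ℝ≥0∞) / k) ^ R ≤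
          ((k₀ + 1 : ℕ) : ℝ≥0∞) ^ R * (S : ℝ≥0∞) ^ (2 * R) / (k : ℝ≥0∞) ^ R := by
        intro S
        rw [div_eq_mul_inv, mul_pow, ← mul_assoc, ← ENNReal.inv_pow, ← div_eq_mul_inv]
        refine ENNReal.div_le_div_right ?_ _
        rw [← mul_pow, pow_mul, ← mul_pow]
        refine pow_le_pow_left' ?_ R
        have : S * (k₀ + S) ≤ (k₀ + 1) * S ^ 2 := by
          rcases Nat.eq_zero_or_pos S with rfl | hS
          · simp
          · nlinarith [Nat.mul_le_mul_left (k₀ * S) hS]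
        exact_mod_cast this
      calc _ ≤ ∫⁻ ω, 2 ^ (2 * L + 1) * (3 / 4 : ℝ≥0∞) ^ i *
            (((k₀ + 1 : ℕ) : ℝ≥0∞) ^ R / (k : ℝ≥0∞) ^ R) *
            (sizeUpTo (fun i => A i ω) (2 * (i + 1)) : ℝ≥0∞) ^ (2 * R) ∂μ := by
            refine lintegral_mono fun ω => ?_
            refine (mul_le_mul_right (hS _) _).trans (le_of_eq ?_)
            simp only [div_eq_mul_inv]
            ring
        _ = 2 ^ (2 * L + 1) * (3 / 4 : ℝ≥0∞) ^ i *
            (((k₀ + 1 : ℕ) : ℝ≥0∞) ^ R / (k : ℝ≥0∞) ^ R) *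
            ∫⁻ ω, (sizeUpTo (fun i => A i ω) (2 * (i + 1)) : ℝ≥0∞) ^ (2 * R) ∂μ :=
            lintegral_const_mul _ (hmeas _ fun S => (S : ℝ≥0∞) ^ (2 * R))
        _ ≤ 2 ^ (2 * L + 1) * (3 / 4 : ℝ≥0∞) ^ i *
            (((k₀ + 1 : ℕ) : ℝ≥0∞) ^ R / (k : ℝ≥0∞) ^ R) *
            (((2 * (i + 1) : ℕ) : ℝ≥0∞) ^ (2 * R + 1) *
              ∫⁻ F, (F.size : ℝ≥0∞) ^ (2 * R) ∂α) :=
            mul_le_mul_right (lintegral_sizeUpTo_pow_le hA hlaw _ _ (by omega)) _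
        _ = _ := by
            simp only [hD, div_eq_mul_inv]
            ring
    have hn : ∀ n : ℕ, ∫⁻ ω, spineProb k (fun i => A i ω) (f.lift hk) ∂μ ≤
        2 ^ (2 * L + 1) * (3 / 4) ^ n + C / (k : ℝ≥0∞) ^ R := by
      intro n
      calc _ ≤ ∫⁻ ω, (2 ^ (2 * L + 1) * (3 / 4) ^ n +
            ∑ i ∈ Finset.range n, 2 ^ (2 * L + 1) * (3 / 4 : ℝ≥0∞) ^ i *
            ((sizeUpTo (fun i => A i ω) (2 * (i + 1)) : ℝ≥0∞) ^ R *
            (((k₀ + sizeUpTo (fun i => A i ω) (2 * (i + 1)) : ℕ) : ℝ≥0∞) / k) ^ R)) ∂μ := by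
            refine lintegral_mono_ae ?_
            filter_upwards [hne] with ω hω
            exact spineProb_lift_le f hk hω n
        _ = 2 ^ (2 * L + 1) * (3 / 4) ^ n +
            ∑ i ∈ Finset.range n, ∫⁻ ω, 2 ^ (2 * L + 1) * (3 / 4 : ℝ≥0∞) ^ i *
            ((sizeUpTo (fun i => A i ω) (2 * (i + 1)) : ℝ≥0∞) ^ R *
            (((k₀ + sizeUpTo (fun i => A i ω) (2 * (i + 1)) : ℕ) : ℝ≥0∞) / k) ^ R) ∂μ := by
            rw [lintegral_add_left measurable_const, lintegral_const, measure_univ, mul_one,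
              lintegral_finsetSum]
            intro i _
            exact hmeas _ fun S => 2 ^ (2 * L + 1) * (3 / 4 : ℝ≥0∞) ^ i *
              ((S : ℝ≥0∞) ^ R * (((k₀ + S : ℕ) : ℝ≥0∞) / k) ^ R)
        _ ≤ 2 ^ (2 * L + 1) * (3 / 4) ^ n + ∑ i ∈ Finset.range n,
            D * ((3 / 4 : ℝ≥0∞) ^ i * ((2 * (i + 1) : ℕ) : ℝ≥0∞) ^ (2 * R + 1)) /
              (k : ℝ≥0∞) ^ R := by
            gcongr with i _
            exact hterm i
        _ ≤ _ := by
            refine add_le_add_right ?_ _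
            simp_rw [div_eq_mul_inv _ ((k : ℝ≥0∞) ^ R)]
            rw [← Finset.sum_mul, ← Finset.mul_sum]
            refine mul_le_mul_left (mul_le_mul_right ?_ _) _
            exact ENNReal.sum_le_tsum _
    have hlim : Tendsto (fun n : ℕ => 2 ^ (2 * L + 1) * (3 / 4 : ℝ≥0∞) ^ n +
        C / (k : ℝ≥0∞) ^ R) atTop (𝓝 (2 ^ (2 * L + 1) * 0 + C / (k : ℝ≥0∞) ^ R)) := by
      refine Tendsto.add (ENNReal.Tendsto.const_mul
        (ENNReal.tendsto_pow_atTop_nhds_zero_of_lt_one ?_) (Or.inr (by finiteness)))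
        tendsto_const_nhds
      rw [ENNReal.div_lt_iff (by norm_num) (by norm_num)]
      norm_num
    rw [mul_zero, zero_add] at hlim
    exact ge_of_tendsto' hlim hn

end Upper

/-! ### Moments of the size of the untrimmed forest -/

section Moments

variable {k : ℕ}

mutual
/-- The constraints imposed by the leaves of a tree whose root has a parent labelled `c`. -/
def LTree.constraintList (c : Conn) : LTree k → List (Literal k)
  | .leaf ℓ => [constraintOf c ℓ]
  | .node c' l => LTree.constraintLists c' l
/-- The constraints imposed by the leaves of a forest whose roots have a parent labelled `c`. -/
def LTree.constraintLists (c : Conn) : List (LTree k) → List (Literal k)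
  | [] => []
  | t :: ts => t.constraintList c ++ LTree.constraintLists c ts
end

theorem mem_constraintLists {ℓ : Literal k} {c : Conn} {l : List (LTree k)} :
    ℓ ∈ LTree.constraintLists c l ↔ ∃ t ∈ l, ℓ ∈ t.constraintList c := by
  induction l with
  | nil => simp [LTree.constraintLists]
  | cons t ts ih => simp [LTree.constraintLists, ih]

theorem constraintOf_fst (c : Conn) (ℓ : Literal k) : (constraintOf c ℓ).1 = ℓ.1 := by
  unfold constraintOf Literal.neg
  split_ifs <;> rfl

mutual
theorem LTree.map_fst_constraintList (c : Conn) : ∀ t : LTree k,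
    (t.constraintList c).map Prod.fst = t.lits.map Prod.fst
  | .leaf ℓ => by simp [LTree.constraintList, LTree.lits, constraintOf_fst]
  | .node c' l => by
    rw [LTree.constraintList, LTree.lits]
    exact LTree.map_fst_constraintLists c' l
theorem LTree.map_fst_constraintLists (c : Conn) : ∀ l : List (LTree k),
    (LTree.constraintLists c l).map Prod.fst = varsList l
  | [] => rfl
  | t :: ts => by
    rw [LTree.constraintLists, varsList_cons, List.map_append, LTree.map_fst_constraintList c t,
      LTree.map_fst_constraintLists c ts]
end

mutual
theorem LTree.length_lits : ∀ t : LTree k, t.lits.length = t.size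
  | .leaf ℓ => by simp [LTree.lits, LTree.size]
  | .node c l => by
    rw [LTree.lits, LTree.size]
    exact LTree.length_litsList l
theorem LTree.length_litsList : ∀ l : List (LTree k),
    (LTree.litsList l).length = LTree.sizeList l
  | [] => rfl
  | t :: ts => by
    rw [LTree.litsList, LTree.sizeList, List.length_append, LTree.length_lits t,
      LTree.length_litsList ts]
end

theorem leafConstraints_subset {c : Conn} {l : List (LTree k)} {ℓ : Literal k}
    (h : ℓ ∈ leafConstraints c l) : ℓ ∈ LTree.constraintLists c l := by
  obtain ⟨ℓ', h1, rfl⟩ := h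
  exact mem_constraintLists.2 ⟨_, h1, by simp [LTree.constraintList]⟩

mutual
theorem LTree.trimSize_eq (x : Fin k → Bool) (c : Conn) : ∀ (t : LTree k) (S : Set (Literal k)),
    (∀ ℓ ∈ t.constraintList c, Literal.eval x ℓ = true) →
    (∀ ℓ ∈ S, Literal.eval x ℓ = true) → t.trimSize S = t.size
  | .leaf ℓ, S, _, h2 => by
    rw [LTree.trimSize, LTree.size, keep, if_pos ⟨x, h2⟩]
  | .node c' l, S, h1, h2 => by
    rw [LTree.constraintList] at h1
    rw [LTree.trimSize, LTree.size]
    refine LTree.trimSizeList_eq x c' l _ h1 fun ℓ hℓ => ?_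
    exact hℓ.elim (h2 ℓ) fun h => h1 ℓ (leafConstraints_subset h)
theorem LTree.trimSizeList_eq (x : Fin k → Bool) (c : Conn) :
    ∀ (l : List (LTree k)) (S : Set (Literal k)),
    (∀ ℓ ∈ LTree.constraintLists c l, Literal.eval x ℓ = true) →
    (∀ ℓ ∈ S, Literal.eval x ℓ = true) → LTree.trimSizeList l S = LTree.sizeList l
  | [], S, _, _ => rfl
  | t :: ts, S, h1, h2 => by
    simp only [LTree.constraintLists, List.mem_append] at h1
    rw [LTree.trimSizeList, LTree.sizeList,
      LTree.trimSize_eq x c t S (fun ℓ hℓ => h1 ℓ (Or.inl hℓ)) h2,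
      LTree.trimSizeList_eq x c ts S (fun ℓ hℓ => h1 ℓ (Or.inr hℓ)) h2]
end

/-- Nothing is trimmed when some assignment satisfies all the constraints of the leaves. -/
theorem LLevel.trimSize_empty_eq {v : LLevel k} {x : Fin k → Bool}
    (hx : ∀ ℓ ∈ LTree.constraintLists v.conn v.forest, Literal.eval x ℓ = true) :
    v.trimSize ∅ = (varsList v.forest).length := by
  rw [LLevel.trimSize, LTree.trimSizeList_eq x v.conn v.forest _ hx, varsList, List.length_map,
    LTree.length_litsList]
  rintro ℓ (h | h)
  · exact h.elim
  · exact hx ℓ (leafConstraints_subset h)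

/-- Nothing is trimmed when the variables at the leaves are distinct. -/
theorem LLevel.trimSize_of_nodup {v : LLevel k} (hv : (varsList v.forest).Nodup) :
    v.trimSize ∅ = (varsList v.forest).length := by
  rw [← LTree.map_fst_constraintLists v.conn] at hv
  obtain ⟨x, -, hx⟩ := exists_assignment true (fun _ => false) hv
  exact LLevel.trimSize_empty_eq hx

theorem nodup_of_restr_eq_zero {xs : List (Fin k)} (h : restr ∅ xs = 0) : xs.Nodup := by
  rw [List.nodup_iff_count_le_one]
  intro i
  have := (Finset.sum_eq_zero_iff.1 h) i (Finset.mem_univ i)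
  simp only [Finset.notMem_empty, if_false] at this
  omega

variable [NeZero k]

theorem length_varsList_of_mem_support {F : Forest} {v : LLevel k}
    (hv : v ∈ (Forest.label k F).support) : (varsList v.forest).length = F.size := by
  rw [mem_support_forest_label] at hv
  have h1 : varsList v.forest ∈ ((RTree.labelList k F).map varsList).support :=
    (PMF.mem_support_map_iff _ _ _).2 ⟨_, hv, rfl⟩
  have h2 : varsList v.forest ∈ (unifs k F.size).support := map_varsList_labelList (k := k) F ▸ h1
  rw [length_of_mem_support_seqList h2, List.length_replicate]

theorem label_restr_le (F : Forest) :
    (Forest.label k F).toOuterMeasure {v | 1 ≤ restr ∅ (varsList v.forest)} ≤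
      (F.size : ℝ≥0∞) ^ 2 / k := by
  have h1 : {v : LLevel k | 1 ≤ restr ∅ (varsList v.forest)} =
      (fun v => (v.conn, varsList v.forest)) ⁻¹' (Set.univ ×ˢ {xs | 1 ≤ restr ∅ xs}) := by
    ext v
    simp
  rw [h1, ← PMF.toOuterMeasure_map_apply, map_conn_vars, toOuterMeasure_bind_prod,
    toOuterMeasure_univ, one_mul]
  refine (unifs_restr_le F.size 1 F.size ∅ (by simp)).trans (le_of_eq ?_)
  rw [Nat.choose_one_right, pow_one, sq, mul_div_assoc]

/-- With probability at least `1 - F.size ^ 2 / k` the labels of the leaves have distinct variables,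
and then nothing is trimmed. -/
theorem size_pow_mul_le (F : Forest) (m : ℕ) :
    (F.size : ℝ≥0∞) ^ m * (1 - (F.size : ℝ≥0∞) ^ 2 / k) ≤
      ∫⁻ v, (v.trimSize ∅ : ℝ≥0∞) ^ m ∂(Forest.label k F).toMeasure := by
  refine le_trans (mul_le_mul_right ?_ _) (mul_meas_ge_le_lintegral Measurable.of_discrete _)
  set U : Set (LLevel k) := {v | (F.size : ℝ≥0∞) ^ m ≤ (v.trimSize ∅ : ℝ≥0∞) ^ m} with hU
  have h1 : (Forest.label k F).toMeasure Uᶜ ≤ (F.size : ℝ≥0∞) ^ 2 / k := by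
    rw [PMF.toMeasure_apply_eq_toOuterMeasure]
    refine ((Forest.label k F).toOuterMeasure_mono ?_).trans (label_restr_le F)
    rintro v ⟨hv, hv'⟩
    by_contra hcon
    have h2 : restr ∅ (varsList v.forest) = 0 := by
      have : ¬ 1 ≤ restr ∅ (varsList v.forest) := hcon
      omega
    refine hv ?_
    change (F.size : ℝ≥0∞) ^ m ≤ (v.trimSize ∅ : ℝ≥0∞) ^ m
    rw [LLevel.trimSize_of_nodup (nodup_of_restr_eq_zero h2), length_varsList_of_mem_support hv']
  have h3 := prob_compl_eq_one_sub (μ := (Forest.label k F).toMeasure)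
    (s := U) MeasurableSet.of_discrete
  have h4 := prob_add_prob_compl (μ := (Forest.label k F).toMeasure)
    (s := U) MeasurableSet.of_discrete
  rw [tsub_le_iff_right, ← h4]
  exact add_le_add_right h1 _

/-- As the number of variables tends to infinity, the labels of a fixed forest are distinct with
probability tending to one, so that uniform bounds for the trimmed forests hold
for the whole forest. -/
theorem lintegral_size_pow_ne_top {α : Measure Forest} {m : ℕ}
    (hL : ∃ (B : ℝ≥0) (K : ℕ), ∀ (k : ℕ) [NeZero k], K ≤ k → momentL k α m ≤ B) :
    ∫⁻ F, (F.size : ℝ≥0∞) ^ m ∂α ≠ ∞ := by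
  obtain ⟨B, K, hB⟩ := hL
  set φ : ℕ → Forest → ℝ≥0∞ := fun n F =>
    ∫⁻ v, (v.trimSize ∅ : ℝ≥0∞) ^ m ∂(Forest.label (n + 1) F).toMeasure with hφ
  have h1 : ∀ F : Forest, (F.size : ℝ≥0∞) ^ m ≤ liminf (fun n => φ n F) atTop := by
    intro F
    have h2 : Tendsto (fun n : ℕ => (F.size : ℝ≥0∞) ^ m *
        (1 - (F.size : ℝ≥0∞) ^ 2 / ((n + 1 : ℕ) : ℝ≥0∞))) atTop
        (𝓝 ((F.size : ℝ≥0∞) ^ m * (1 - 0))) := by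
      refine ENNReal.Tendsto.const_mul (ENNReal.Tendsto.sub tendsto_const_nhds ?_
        (Or.inl ENNReal.one_ne_top)) (Or.inr (by finiteness))
      have h3 : Tendsto (fun n : ℕ => ((n + 1 : ℕ) : ℝ≥0∞)) atTop (𝓝 ∞) :=
        ENNReal.tendsto_nat_nhds_top.comp (tendsto_add_atTop_nat 1)
      have h5 := ENNReal.Tendsto.const_div (a := (F.size : ℝ≥0∞) ^ 2) h3 (Or.inr (by finiteness))
      rwa [ENNReal.div_top] at h5
    rw [tsub_zero, mul_one] at h2
    rw [← h2.liminf_eq]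
    exact liminf_le_liminf (Eventually.of_forall fun n => size_pow_mul_le F m)
  have h4 : ∫⁻ F, (F.size : ℝ≥0∞) ^ m ∂α ≤ B :=
    calc _ ≤ ∫⁻ F, liminf (fun n => φ n F) atTop ∂α := lintegral_mono h1
      _ ≤ liminf (fun n => ∫⁻ F, φ n F ∂α) atTop :=
        lintegral_liminf_le fun n => Measurable.of_discrete
      _ ≤ liminf (fun _ : ℕ => (B : ℝ≥0∞)) atTop := by
        refine liminf_le_liminf ?_
        filter_upwards [eventually_ge_atTop K] with n hn
        exact hB (n + 1) (by omega)
      _ = B := liminf_const _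
  exact (h4.trans_lt ENNReal.coe_lt_top).ne

end Moments

/-! ### Leaves attached to the spine -/

section LeafProb

theorem RTree.size_pos (t : RTree) : 0 < t.size := by
  induction hn : sizeOf t using Nat.strong_induction_on generalizing t with
  | _ n ih =>
    subst hn
    obtain ⟨l⟩ := t
    rcases l with _ | ⟨t, ts⟩
    · simp [RTree.size]
    · have := ih (sizeOf t) (by simp; omega) t rfl
      simp only [RTree.size, RTree.sizeList, List.isEmpty_cons, Bool.false_eq_true, if_false]
      omega

theorem RTree.sizeList_pos {F : List RTree} (hF : F ≠ []) : 0 < RTree.sizeList F := by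
  obtain ⟨t, ts, rfl⟩ := List.exists_cons_of_ne_nil hF
  rw [RTree.sizeList]
  have := t.size_pos
  omega

/-- Some tree of the forest is a single leaf. The membership is that of lists, as `Forest` is a
definition without instances of its own. -/
def Forest.HasLeaf (F : Forest) : Prop := @Membership.mem RTree (List RTree) _ F (RTree.node [])

theorem exists_atom (α : Measure Forest) [IsProbabilityMeasure α] : ∃ F, α {F} ≠ 0 := by
  obtain ⟨F, hF⟩ := α.toPMF.support_nonempty
  exact ⟨F, hF⟩

theorem admissible_of_atom {α : Measure Forest} (hα : ∀ᵐ F ∂α, F.Admissible) {F : Forest}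
    (hF : α {F} ≠ 0) : F.Admissible := by
  by_contra h
  exact hF (measure_mono_null (Set.singleton_subset_iff.2 h) hα)

variable {k : ℕ} [NeZero k]

theorem node_nil_mem {F : List RTree} {l : List (LTree k)}
    (hl : l ∈ (RTree.labelList k F).support) {ℓ : Literal k} (hℓ : LTree.leaf ℓ ∈ l) :
    RTree.node [] ∈ F := by
  rw [labelList_eq_seqList, mem_support_seqList, List.forall₂_map_right_iff] at hl
  induction hl with
  | nil => simp at hℓ
  | @cons τ t _ _ h _ ih =>
    rcases List.mem_cons.1 hℓ with rfl | hℓ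
    · obtain ⟨l⟩ := t
      by_cases hl : l = []
      · subst hl
        exact List.mem_cons_self
      · rw [label_node k hl, PMF.mem_support_bind_iff] at h
        obtain ⟨c, -, h⟩ := h
        rw [PMF.mem_support_map_iff] at h
        obtain ⟨l', -, h⟩ := h
        cases h
    · exact List.mem_cons_of_mem _ (ih hℓ)

theorem leafConstraints_eq_empty {F : Forest} (hF : ¬ F.HasLeaf) {v : LLevel k}
    (hv : v ∈ (Forest.label k F).support) : leafConstraints v.conn v.forest = ∅ := by
  have h1 : ∀ ℓ, LTree.leaf ℓ ∉ v.forest := fun ℓ hℓ =>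
    hF (node_nil_mem (mem_support_forest_label.1 hv) hℓ)
  ext ℓ'
  simp [leafConstraints, h1]

/-- Without leaves attached to the spine, the trimmed size is the sum over the levels of the trimmed
sizes of the forests. -/
theorem lintegral_trimSize {a : ℕ → Forest} (ha : ∀ i, ¬ (a i).HasLeaf) :
    ∫⁻ σ, LSpineTree.trimSize σ ∂(SpineTree.label k a) =
      ∑' i, ∫⁻ v, (v.trimSize ∅ : ℝ≥0∞) ∂(Forest.label k (a i)).toMeasure := by
  have h1 : ∀ᵐ σ ∂(SpineTree.label k a), ∀ i, leafConstraints (σ i).conn (σ i).forest = ∅ :=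
    ae_label (P := fun _ v => leafConstraints v.conn v.forest = ∅)
      fun i v hv => leafConstraints_eq_empty (ha i) hv
  have h2 : ∫⁻ σ, LSpineTree.trimSize σ ∂(SpineTree.label k a) =
      ∫⁻ σ : LSpineTree k, ∑' i, ((σ i).trimSize ∅ : ℝ≥0∞) ∂(SpineTree.label k a) := by
    refine lintegral_congr_ae ?_
    filter_upwards [h1] with σ hσ
    have h3 : ∀ i, LSpineTree.constraints σ i = ∅ := by
      intro i
      induction i with
      | zero => rfl
      | succ i ih => rw [LSpineTree.constraints, ih, hσ, Set.union_empty]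
    simp only [LSpineTree.trimSize, h3]
  have hm : Measurable fun v : LLevel k => (v.trimSize ∅ : ℝ≥0∞) := Measurable.of_discrete
  refine h2.trans ((lintegral_tsum (f := fun i (σ : ℕ → LLevel k) => ((σ i).trimSize ∅ : ℝ≥0∞))
    fun i => (hm.comp (measurable_pi_apply i)).aemeasurable).trans (tsum_congr fun i => ?_))
  exact (measurePreserving_eval_infinitePi
    (fun i => (Forest.label k (a i)).toMeasure) i).lintegral_comp hm

variable {Ω : Type*} [MeasurableSpace Ω] {μ : Measure Ω}

/-- If no leaf were attached to the spine, then no constraint would reach the spine, and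
infinitely many trimmed forests would be non-empty. -/
theorem measure_hasLeaf_ne_zero {α : Measure Forest} [IsProbabilityMeasure α]
    (hα : ∀ᵐ F ∂α, F.Admissible) {A : ℕ → ℕ → Ω → Forest} (hA : ∀ k i, Measurable (A k i))
    (hlaw : ∀ (k : ℕ) [NeZero k] (i : ℕ), μ.map (A k i) = α)
    (htrim : ∀ (k : ℕ) [NeZero k],
      ∫⁻ ω, ∫⁻ σ, LSpineTree.trimSize σ ∂(SpineTree.label k fun i => A k i ω) ∂μ < ∞) :
    α {F | F.HasLeaf} ≠ 0 := by
  intro h0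
  obtain ⟨F, hF⟩ := exists_atom α
  have hFpos := RTree.sizeList_pos (admissible_of_atom hα hF).1
  change 0 < F.size at hFpos
  set k := F.size ^ 2 + 1 with hk
  have hkz : NeZero k := ⟨by omega⟩
  set e : Forest → ℝ≥0∞ := fun F => ∫⁻ v, (v.trimSize ∅ : ℝ≥0∞) ∂(Forest.label k F).toMeasure
    with he
  have heF : e F ≠ 0 := by
    have h1 := size_pow_mul_le (k := k) F 1
    simp only [pow_one] at h1
    refine (lt_of_lt_of_le ?_ h1).ne'
    refine ENNReal.mul_pos (by exact_mod_cast hFpos.ne') (tsub_pos_of_lt ?_).ne'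
    rw [ENNReal.div_lt_iff (Or.inl (by simp [hk])) (Or.inl (ENNReal.natCast_ne_top k)), one_mul]
    exact_mod_cast Nat.lt_succ_self (F.size ^ 2)
  have hint : ∫⁻ F, e F ∂α ≠ 0 := by
    rw [lintegral_countable']
    intro h
    exact mul_ne_zero heF hF (ENNReal.tsum_eq_zero.1 h F)
  have hae : ∀ᵐ ω ∂μ, ∀ i, ¬ (A k i ω).HasLeaf := by
    rw [ae_all_iff]
    intro i
    refine ae_of_ae_map (p := fun F => ¬ F.HasLeaf) (hA k i).aemeasurable ?_
    rw [hlaw k i, ae_iff]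
    simpa using h0
  have h2 := htrim k
  rw [lintegral_congr_ae (g := fun ω => ∑' i, e (A k i ω))
    (hae.mono fun ω hω => lintegral_trimSize hω),
    lintegral_tsum (f := fun i ω => e (A k i ω)) fun i =>
      ((Measurable.of_discrete (f := e)).comp (hA k i)).aemeasurable] at h2
  have h3 : ∀ i, ∫⁻ ω, e (A k i ω) ∂μ = ∫⁻ F, e F ∂α := by
    intro i
    rw [← hlaw k i, lintegral_map Measurable.of_discrete (hA k i)]
  simp_rw [h3] at h2
  rw [ENNReal.tsum_const_eq_top_of_ne_zero hint] at h2
  exact lt_irrefl _ h2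

end LeafProb

/-! ### Lower bound for the probability of a function -/

section Lower

section Lift

variable {k₀ k : ℕ}

mutual
/-- A labelled tree in `k₀` variables, seen as a labelled tree in `k ≥ k₀` variables. -/
def LTree.lift (hk : k₀ ≤ k) : LTree k₀ → LTree k
  | .leaf ℓ => .leaf (Fin.castLE hk ℓ.1, ℓ.2)
  | .node c l => .node c (LTree.liftList hk l)
/-- The same for a forest. -/
def LTree.liftList (hk : k₀ ≤ k) : List (LTree k₀) → List (LTree k)
  | [] => []
  | t :: ts => t.lift hk :: LTree.liftList hk ts
end

mutual
theorem LTree.eval_lift (hk : k₀ ≤ k) (x : Fin k → Bool) : ∀ t : LTree k₀,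
    (t.lift hk).eval x = t.eval fun i => x (Fin.castLE hk i)
  | .leaf ℓ => by simp [LTree.lift, LTree.eval, Literal.eval]
  | .node c l => by rw [LTree.lift, LTree.eval, LTree.eval, LTree.evalList_lift hk x l]
theorem LTree.evalList_lift (hk : k₀ ≤ k) (x : Fin k → Bool) : ∀ l : List (LTree k₀),
    LTree.evalList x (LTree.liftList hk l) = LTree.evalList (fun i => x (Fin.castLE hk i)) l
  | [] => rfl
  | t :: ts => by
    rw [LTree.liftList, LTree.evalList, LTree.evalList, LTree.eval_lift hk x t,
      LTree.evalList_lift hk x ts]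
end

variable [NeZero k₀]

theorem le_map_apply {X Y : Type*} (p : PMF X) (f : X → Y) (x : X) : p x ≤ p.map f (f x) := by
  classical
  rw [PMF.map_apply]
  refine le_trans ?_ (ENNReal.le_tsum x)
  rw [if_pos rfl]

theorem le_bind_apply {X Y : Type*} (p : PMF X) (f : X → PMF Y) (x : X) (y : Y) :
    p x * f x y ≤ p.bind f y := by
  rw [PMF.bind_apply]
  exact ENNReal.le_tsum x

theorem exists_labelList_lift_ge {F : List RTree}
    (h : ∀ t ∈ F, ∀ τ : LTree k₀, τ ∈ (RTree.label k₀ t).support →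
      ∃ c : ℝ≥0∞, c ≠ 0 ∧ ∀ (k : ℕ) [NeZero k] (hk : k₀ ≤ k),
        c * (k : ℝ≥0∞)⁻¹ ^ t.size ≤ RTree.label k t (τ.lift hk))
    {l : List (LTree k₀)} (hl : l ∈ (RTree.labelList k₀ F).support) :
    ∃ c : ℝ≥0∞, c ≠ 0 ∧ ∀ (k : ℕ) [NeZero k] (hk : k₀ ≤ k),
      c * (k : ℝ≥0∞)⁻¹ ^ RTree.sizeList F ≤ RTree.labelList k F (LTree.liftList hk l) := by
  rw [labelList_eq_seqList, mem_support_seqList, List.forall₂_map_right_iff] at hl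
  induction hl with
  | nil =>
    refine ⟨1, one_ne_zero, fun k _ hk => ?_⟩
    simp [RTree.labelList, RTree.sizeList, LTree.liftList]
  | @cons τ t l F h1 _ ih =>
    obtain ⟨c, hc, h2⟩ := h t List.mem_cons_self τ h1
    obtain ⟨c', hc', h3⟩ := ih fun t ht => h t (List.mem_cons_of_mem _ ht)
    refine ⟨c * c', mul_ne_zero hc hc', fun k _ hk => ?_⟩
    rw [labelList_eq_seqList, List.map_cons, LTree.liftList, seqList_cons_apply,
      ← labelList_eq_seqList, RTree.sizeList, pow_add, mul_mul_mul_comm]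
    exact mul_le_mul' (h2 k hk) (h3 k hk)

theorem uniform_literal [NeZero k] (ℓ : Literal k) :
    PMF.uniformOfFintype (Literal k) ℓ = 2⁻¹ * (k : ℝ≥0∞)⁻¹ := by
  rw [PMF.uniformOfFintype_apply, Fintype.card_prod, Fintype.card_fin, Fintype.card_bool]
  push_cast
  rw [ENNReal.mul_inv (Or.inr (by simp)) (Or.inr (by simp)), mul_comm]

/-- Each leaf costs a factor of order `1 / k`, and each connective a constant factor. -/
theorem exists_label_lift_ge {t : RTree} {τ : LTree k₀} (hτ : τ ∈ (RTree.label k₀ t).support) :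
    ∃ c : ℝ≥0∞, c ≠ 0 ∧ ∀ (k : ℕ) [NeZero k] (hk : k₀ ≤ k),
      c * (k : ℝ≥0∞)⁻¹ ^ t.size ≤ RTree.label k t (τ.lift hk) := by
  induction hn : sizeOf t using Nat.strong_induction_on generalizing t τ with
  | _ n ih =>
    subst hn
    obtain ⟨l⟩ := t
    by_cases hl : l = []
    · subst hl
      rw [label_node_nil, PMF.mem_support_map_iff] at hτ
      obtain ⟨ℓ, -, rfl⟩ := hτ
      refine ⟨2⁻¹, by simp, fun k _ hk => ?_⟩
      rw [label_node_nil, LTree.lift]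
      refine le_trans (le_of_eq ?_) (le_map_apply _ _ _)
      rw [uniform_literal]
      simp [RTree.size]
    · rw [label_node k₀ hl, PMF.mem_support_bind_iff] at hτ
      obtain ⟨c, -, hτ⟩ := hτ
      rw [PMF.mem_support_map_iff] at hτ
      obtain ⟨l', hl', rfl⟩ := hτ
      obtain ⟨b, hb, h⟩ := exists_labelList_lift_ge (F := l) (fun t ht τ hτ => by
        refine ih _ ?_ hτ rfl
        have := List.sizeOf_lt_of_mem ht
        simp
        omega) hl'
      refine ⟨2⁻¹ * b, mul_ne_zero (by simp) hb, fun k _ hk => ?_⟩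
      rw [label_node k hl, LTree.lift]
      refine le_trans ?_ (le_bind_apply _ _ c _)
      rw [uniform_conn, mul_assoc]
      refine mul_le_mul_right (le_trans ?_ (le_map_apply _ _ _)) _
      have h3 : (RTree.node l).size = RTree.sizeList l := by simp [RTree.size, hl]
      rw [h3]
      exact h k hk

theorem exists_forest_label_lift_ge {F : Forest} {l : List (LTree k₀)}
    (hl : l ∈ (RTree.labelList k₀ F).support) (c₀ : Conn) :
    ∃ c : ℝ≥0∞, c ≠ 0 ∧ ∀ (k : ℕ) [NeZero k] (hk : k₀ ≤ k),
      c * (k : ℝ≥0∞)⁻¹ ^ F.size ≤ Forest.label k F ⟨c₀, LTree.liftList hk l⟩ := by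
  obtain ⟨c, hc, h⟩ := exists_labelList_lift_ge (fun t _ τ hτ => exists_label_lift_ge hτ) hl
  refine ⟨2⁻¹ * c, mul_ne_zero (by simp) hc, fun k _ hk => ?_⟩
  rw [Forest.label]
  refine le_trans ?_ (le_bind_apply _ _ c₀ _)
  rw [uniform_conn, mul_assoc]
  exact mul_le_mul_right ((h k hk).trans (le_map_apply _ (fun l => (⟨c₀, l⟩ : LLevel k)) _)) _

end Lift

variable {k₀ k : ℕ} [NeZero k]

/-- The label of the first tree of the forest that is a single leaf. -/
def firstLeaf : List (LTree k) → Option (Literal k)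
  | [] => none
  | .leaf ℓ :: _ => some ℓ
  | .node _ _ :: ts => firstLeaf ts

omit [NeZero k] in
theorem mem_of_firstLeaf {ℓ : Literal k} : ∀ {l : List (LTree k)}, firstLeaf l = some ℓ →
    LTree.leaf ℓ ∈ l
  | [], h => by simp [firstLeaf] at h
  | .leaf ℓ' :: ts, h => by
    rw [firstLeaf, Option.some_inj] at h
    rw [h]
    exact List.mem_cons_self
  | .node _ _ :: ts, h => List.mem_cons_of_mem _ (mem_of_firstLeaf (l := ts) h)

theorem map_firstLeaf {F : List RTree} (hF : RTree.node [] ∈ F) :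
    (RTree.labelList k F).map firstLeaf = (PMF.uniformOfFintype (Literal k)).map some := by
  induction F with
  | nil => simp at hF
  | cons t ts ih =>
    obtain ⟨l⟩ := t
    rw [RTree.labelList, PMF.map_bind]
    by_cases hl : l = []
    · subst hl
      rw [label_node_nil, PMF.bind_map]
      simp only [Function.comp_def, PMF.map_comp, firstLeaf]
      simp only [PMF.map, Function.comp_def, PMF.bind_const]
    · have hts : RTree.node [] ∈ ts := by
        rcases List.mem_cons.1 hF with h | h
        · exact absurd (RTree.node.inj h).symm hl
        · exact h
      rw [label_node k hl, PMF.bind_bind]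
      simp only [PMF.bind_map, Function.comp_def, PMF.map_comp, firstLeaf, PMF.bind_const]
      exact ih hts

/-- The labelled spine nodes that are conjunctions and have a leaf labelled `ℓ` as a child, before
any other leaf. -/
def andLeaf (ℓ : Literal k) : Set (LLevel k) :=
  {v | v.conn = false ∧ firstLeaf v.forest = some ℓ}

/-- The factors are `1 / 2` for the connective and `1 / (2 k)` for the literal. -/
theorem label_andLeaf {F : Forest} (hF : F.HasLeaf) (ℓ : Literal k) :
    (Forest.label k F).toMeasure (andLeaf ℓ) = 4⁻¹ * (k : ℝ≥0∞)⁻¹ := by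
  classical
  rw [PMF.toMeasure_apply_eq_toOuterMeasure]
  have h1 : andLeaf ℓ =
      (fun v : LLevel k => (v.conn, firstLeaf v.forest)) ⁻¹' ({false} ×ˢ {some ℓ}) := by
    ext v
    simp [andLeaf]
  have h2 : (Forest.label k F).map (fun v : LLevel k => (v.conn, firstLeaf v.forest)) =
      (PMF.uniformOfFintype Conn).bind fun c =>
        ((PMF.uniformOfFintype (Literal k)).map some).map fun y => (c, y) := by
    rw [Forest.label, PMF.map_bind]
    congr 1
    funext c
    refine Eq.trans ?_ (congrArg (PMF.map fun y => (c, y)) (map_firstLeaf (k := k) hF))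
    rw [PMF.map_comp, PMF.map_comp]
    rfl
  rw [h1, ← PMF.toOuterMeasure_map_apply, h2, toOuterMeasure_bind_prod,
    PMF.toOuterMeasure_apply_singleton, PMF.toOuterMeasure_map_apply, uniform_conn]
  have h3 : (some ⁻¹' {some ℓ} : Set (Literal k)) = {ℓ} := by
    ext
    simp
  rw [h3, PMF.toOuterMeasure_apply_singleton, uniform_literal, ← mul_assoc,
    ← ENNReal.mul_inv (by simp) (by simp)]
  norm_num

omit [NeZero k] in
/-- Two consecutive conjunctions with contradictory leaves make the first of them `False`, so
that a disjunction at the root computes the disjunction of the trees of its forest. -/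
theorem represents_of_contradiction {σ : LSpineTree k} {g : BoolFun k} {ℓ : Literal k}
    (h0 : (σ 0).conn = true) (hg : ∀ x, Conn.apply true (LTree.evalList x (σ 0).forest) = g x)
    (h1 : σ 1 ∈ andLeaf ℓ) (h2 : σ 2 ∈ andLeaf ℓ.neg) : σ.Represents g := by
  filter_upwards [eventually_ge_atTop 3] with h hh x
  obtain ⟨h, rfl⟩ := Nat.exists_eq_add_of_le hh
  have hev : ∀ (v : LLevel k) (ℓ : Literal k) (b : Bool), v ∈ andLeaf ℓ →
      Literal.eval x ℓ = false → v.conn.apply (b :: LTree.evalList x v.forest) = false := by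
    intro v ℓ b hv hℓ
    rw [hv.1]
    refine Conn.apply_of_mem (List.mem_cons_of_mem _ ?_)
    rw [evalList_eq_map]
    exact List.mem_map.2 ⟨_, mem_of_firstLeaf hv.2, by rw [LTree.eval, hℓ]⟩
  rw [cutEval_add, pre_succ, pre_succ, pre_succ, pre_zero, spineEval, spineEval, spineEval,
    spineEval]
  generalize LSpineTree.cutEval x h _ = G
  simp only [zero_add]
  have h3 : (σ 1).conn.apply ((σ 2).conn.apply (G :: LTree.evalList x (σ 2).forest) ::
      LTree.evalList x (σ 1).forest) = false := by
    by_cases hℓ : Literal.eval x ℓ = false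
    · exact hev _ ℓ _ h1 hℓ
    · have hℓ' : Literal.eval x ℓ.neg = false := by
        obtain ⟨i, s⟩ := ℓ
        simp only [Literal.eval, Literal.neg] at hℓ ⊢
        revert hℓ
        cases x i <;> cases s <;> simp
      rw [hev _ ℓ.neg G h2 hℓ', h1.1]
      exact Conn.apply_of_mem List.mem_cons_self
  have h4 : ((1 : ℕ) + 1) = 2 := rfl
  rw [h4, h3, h0, Conn.apply_cons, if_pos rfl, Bool.false_or]
  exact hg x

/-- The sum over the `2 k` literals `ℓ` of the probability `(1 / (4 k)) ^ 2` that the second spine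
node is in `andLeaf ℓ` and the third in `andLeaf ℓ.neg` is `1 / (8 k)`. -/
theorem spineProb_ge {a : ℕ → Forest} (h1 : (a 1).HasLeaf) (h2 : (a 2).HasLeaf) {g : BoolFun k}
    {l : List (LTree k)} (hg : ∀ x, Conn.apply true (LTree.evalList x l) = g x) :
    Forest.label k (a 0) ⟨true, l⟩ * (8⁻¹ * (k : ℝ≥0∞)⁻¹) ≤ spineProb k a g := by
  set t : Literal k → ℕ → Set (LLevel k) := fun ℓ i =>
    if i = 0 then {⟨true, l⟩} else if i = 1 then andLeaf ℓ else andLeaf ℓ.neg with ht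
  set W : Literal k → Set (LSpineTree k) := fun ℓ =>
    ((Finset.range 3 : Finset ℕ) : Set ℕ).pi (t ℓ) with hW
  have hWmem : ∀ ℓ σ, σ ∈ W ℓ → σ 0 = ⟨true, l⟩ ∧ σ 1 ∈ andLeaf ℓ ∧ σ 2 ∈ andLeaf ℓ.neg := by
    intro ℓ σ hσ
    have e0 := hσ 0 (by simp)
    have e1 := hσ 1 (by simp)
    have e2 := hσ 2 (by simp)
    simp only [ht] at e0 e1 e2
    exact ⟨by simpa using e0, by simpa using e1, by simpa using e2⟩
  have hWprob : ∀ ℓ, SpineTree.label k a (W ℓ) =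
      Forest.label k (a 0) ⟨true, l⟩ * (4⁻¹ * (k : ℝ≥0∞)⁻¹) ^ 2 := by
    intro ℓ
    have e : SpineTree.label k a (W ℓ) =
        ∏ i ∈ Finset.range 3, (Forest.label k (a i)).toMeasure (t ℓ i) :=
      Measure.infinitePi_pi _ fun i _ => MeasurableSet.of_discrete
    rw [e, Finset.prod_range_succ, Finset.prod_range_succ, Finset.prod_range_one]
    simp only [ht, if_true, one_ne_zero, if_false, OfNat.ofNat_ne_zero, OfNat.ofNat_ne_one]
    rw [label_andLeaf h1, label_andLeaf h2,
      PMF.toMeasure_apply_singleton _ _ (MeasurableSet.singleton _), sq, mul_assoc]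
  have hk : (k : ℝ≥0∞) ≠ 0 := by exact_mod_cast NeZero.ne k
  have hk' : (k : ℝ≥0∞) ≠ ∞ := ENNReal.natCast_ne_top k
  calc _ = ∑ ℓ : Literal k, SpineTree.label k a (W ℓ) := by
        simp only [hWprob, Finset.sum_const, Finset.card_univ, Fintype.card_prod, Fintype.card_fin,
          Fintype.card_bool, nsmul_eq_mul]
        push_cast
        have e8 : (8⁻¹ : ℝ≥0∞) = 2 * (4⁻¹ * 4⁻¹) := by
          rw [← ENNReal.toReal_eq_toReal_iff' (by finiteness) (by finiteness)]
          simp [ENNReal.toReal_mul, ENNReal.toReal_inv]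
          norm_num
        rw [e8]
        calc _ = Forest.label k (a 0) ⟨true, l⟩ * (2 * (4⁻¹ * 4⁻¹) * (k : ℝ≥0∞)⁻¹) *
              ((k : ℝ≥0∞) * (k : ℝ≥0∞)⁻¹) := by
              rw [ENNReal.mul_inv_cancel hk hk', mul_one]
          _ = _ := by ring
    _ = SpineTree.label k a (⋃ ℓ, W ℓ) := by
        rw [measure_iUnion, tsum_fintype]
        · intro ℓ ℓ' hℓ
          refine Set.disjoint_left.2 fun σ hσ hσ' => hℓ ?_
          have e1 := (hWmem ℓ σ hσ).2.1.2
          have e2 := (hWmem ℓ' σ hσ').2.1.2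
          rw [e1] at e2
          exact Option.some_inj.1 e2
        · intro ℓ
          exact MeasurableSet.pi (Set.to_countable _) fun i _ => MeasurableSet.of_discrete
    _ ≤ _ := by
        refine measure_mono (Set.iUnion_subset fun ℓ σ hσ => ?_)
        obtain ⟨e0, e1, e2⟩ := hWmem ℓ σ hσ
        exact represents_of_contradiction (by rw [e0]) (by rw [e0]; exact hg) e1 e2

variable {Ω : Type*} [MeasurableSpace Ω] {μ : Measure Ω} {α : Measure Forest}

/-- The probability that the random labelling of the limit tree represents `f` is at least of order
`k ^ (-(ℓ + 1))`, where `ℓ` is the effective complexity of `f`. -/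
theorem exists_le_lintegral_spineProb (f : BoolFun k₀) {ℓ : ℕ} (hf : effComplexity α f = ℓ)
    (hp : α {F | F.HasLeaf} ≠ 0) :
    ∃ c : ℝ≥0∞, c ≠ 0 ∧ ∀ (k : ℕ) [NeZero k] (hk : k₀ ≤ k) (A : ℕ → Ω → Forest),
      (∀ i, Measurable (A i)) → (∀ i, μ.map (A i) = α) → iIndepFun A μ →
      c * (k : ℝ≥0∞)⁻¹ ^ (ℓ + 1) ≤ ∫⁻ ω, spineProb k (fun i => A i ω) (f.lift hk) ∂μ := by
  set s : Set ℕ∞ := {n | ∃ F : Forest, α {F} ≠ 0 ∧ (F.size : ℕ∞) = n ∧ ∃ _ : NeZero k₀,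
    ∃ l ∈ (RTree.labelList k₀ F).support, ∀ x, Conn.apply true (LTree.evalList x l) = f x} with hs
  have hne : s.Nonempty := by
    rw [Set.nonempty_iff_ne_empty]
    intro h
    have : effComplexity α f = sInf s := rfl
    rw [this, h, sInf_empty] at hf
    exact ENat.natCast_ne_top ℓ hf.symm
  obtain ⟨F, hF, hFℓ, hk₀, l, hl, hlf⟩ : (ℓ : ℕ∞) ∈ s := by
    rw [← hf]
    exact csInf_mem hne
  have hFℓ' : F.size = ℓ := by exact_mod_cast hFℓ
  obtain ⟨c, hc, h⟩ := exists_forest_label_lift_ge hl true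
  refine ⟨c * 8⁻¹ * (α {F} * (α {F | F.HasLeaf} * α {F | F.HasLeaf})), ?_, ?_⟩
  · exact mul_ne_zero (mul_ne_zero hc (by simp)) (mul_ne_zero hF (mul_ne_zero hp hp))
  · intro k _ hk A hA hlaw hind
    set t : ℕ → Set Forest := fun i => if i = 0 then {F} else {F | F.HasLeaf} with ht
    set U : Set Ω := ⋂ i ∈ Finset.range 3, A i ⁻¹' t i with hU
    have hUm : MeasurableSet U :=
      Finset.measurableSet_biInter _ fun i _ => hA i MeasurableSet.of_discrete
    have hUp : μ U = α {F} * (α {F | F.HasLeaf} * α {F | F.HasLeaf}) := by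
      rw [hU, hind.measure_inter_preimage_eq_mul _ fun i _ => MeasurableSet.of_discrete]
      have hlaw' : ∀ i, μ (A i ⁻¹' t i) = α (t i) := fun i => by
        rw [← hlaw i, Measure.map_apply (hA i) MeasurableSet.of_discrete]
      simp only [hlaw']
      rw [Finset.prod_range_succ, Finset.prod_range_succ, Finset.prod_range_one]
      simp only [ht, if_true, one_ne_zero, if_false, OfNat.ofNat_ne_zero]
      rw [mul_assoc]
    have hUmem : ∀ ω ∈ U, A 0 ω = F ∧ (A 1 ω).HasLeaf ∧ (A 2 ω).HasLeaf := by
      intro ω hω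
      simp only [hU, Set.mem_iInter, Finset.mem_range] at hω
      have e0 := hω 0 (by norm_num)
      have e1 := hω 1 (by norm_num)
      have e2 := hω 2 (by norm_num)
      simp only [ht] at e0 e1 e2
      exact ⟨by simpa using e0, by simpa using e1, by simpa using e2⟩
    calc _ = ∫⁻ ω, U.indicator (fun _ => c * (k : ℝ≥0∞)⁻¹ ^ ℓ * (8⁻¹ * (k : ℝ≥0∞)⁻¹)) ω ∂μ := by
          rw [lintegral_indicator_const hUm, hUp]
          ring
      _ ≤ _ := by
          refine lintegral_mono fun ω => ?_
          by_cases hω : ω ∈ U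
          · rw [Set.indicator_of_mem hω]
            obtain ⟨e0, e1, e2⟩ := hUmem ω hω
            refine le_trans ?_ (spineProb_ge (a := fun i => A i ω) (g := f.lift hk)
              (l := LTree.liftList hk l) e1 e2 fun x => ?_)
            · refine mul_le_mul_left ?_ _
              rw [← hFℓ']
              simp only [e0]
              exact h k hk
            · rw [LTree.evalList_lift]
              exact hlf _
          · rw [Set.indicator_of_notMem hω]
            exact zero_le

end Lower

/-! ### Bounds for the limit probabilities -/

section Bounds

variable {Ω : Type*} [MeasurableSpace Ω] {μ : Measure Ω} {α : Measure Forest}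

theorem ae_ne_nil (hα : ∀ᵐ F ∂α, F.Admissible) {A : ℕ → Ω → Forest} (hA : ∀ i, Measurable (A i))
    (hlaw : ∀ i, μ.map (A i) = α) : ∀ᵐ ω ∂μ, ∀ i, A i ω ≠ ([] : List RTree) := by
  rw [ae_all_iff]
  intro i
  refine ae_of_ae_map (p := fun F : Forest => F ≠ ([] : List RTree)) (hA i).aemeasurable ?_
  rw [hlaw i]
  exact hα.mono fun F hF => hF.1

theorem complexity_trueFn (k : ℕ) : complexity (trueFn k) = 0 :=
  if_pos ⟨true, fun _ => rfl⟩

theorem lintegral_spineProb_ne_top [IsProbabilityMeasure μ] {k : ℕ} [NeZero k]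
    (A : ℕ → Ω → Forest) (g : BoolFun k) : ∫⁻ ω, spineProb k (fun i => A i ω) g ∂μ ≠ ∞ := by
  refine ne_top_of_le_ne_top ENNReal.one_ne_top
    ((lintegral_mono (g := fun _ => 1) fun ω => ?_).trans (by simp))
  exact prob_le_one

theorem exists_limitProb_le [IsProbabilityMeasure μ]
    (hmom : ∀ m : ℕ, ∫⁻ F, (F.size : ℝ≥0∞) ^ m ∂α ≠ ∞) {A : ℕ → ℕ → Ω → Forest}
    (hA : ∀ k i, Measurable (A k i))
    (hlaw : ∀ (k : ℕ) [NeZero k] (i : ℕ), μ.map (A k i) = α) (hα : ∀ᵐ F ∂α, F.Admissible)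
    {k₀ : ℕ} (f : BoolFun k₀) :
    ∃ C : ℝ, 0 < C ∧ ∀ (k : ℕ) [NeZero k] (hk : k₀ ≤ k),
      limitProb k μ (A k) (f.lift hk) ≤ C / (k : ℝ) ^ (complexity f + 1) := by
  obtain ⟨C, hC, h⟩ := exists_lintegral_spineProb_le (μ := μ) f hmom
  refine ⟨C.toReal + 1, by positivity, fun k _ hk => ?_⟩
  have hk0 : (k : ℝ≥0∞) ≠ 0 := by exact_mod_cast NeZero.ne k
  have h1 := ENNReal.toReal_mono (ENNReal.div_ne_top hC (pow_ne_zero _ hk0))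
    (h k hk (A k) (hA k) (hlaw k) (ae_ne_nil hα (hA k) (hlaw k)))
  rw [ENNReal.toReal_div, ENNReal.toReal_pow, ENNReal.toReal_natCast] at h1
  refine h1.trans ?_
  gcongr
  linarith

theorem exists_le_limitProb [IsProbabilityMeasure μ] {A : ℕ → ℕ → Ω → Forest}
    (hA : ∀ k i, Measurable (A k i))
    (hlaw : ∀ (k : ℕ) [NeZero k] (i : ℕ), μ.map (A k i) = α)
    (hind : ∀ (k : ℕ) [NeZero k], iIndepFun (A k) μ) (hp : α {F | F.HasLeaf} ≠ 0)
    {k₀ : ℕ} (f : BoolFun k₀) {ℓ : ℕ} (hf : effComplexity α f = ℓ) :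
    ∃ c : ℝ, 0 < c ∧ ∀ (k : ℕ) [NeZero k] (hk : k₀ ≤ k),
      c / (k : ℝ) ^ (ℓ + 1) ≤ limitProb k μ (A k) (f.lift hk) := by
  obtain ⟨c, hc, h⟩ := exists_le_lintegral_spineProb (μ := μ) f hf hp
  have hc1 : min c 1 ≠ ∞ := ne_top_of_le_ne_top ENNReal.one_ne_top (min_le_right _ _)
  refine ⟨(min c 1).toReal, ENNReal.toReal_pos (by simp [hc]) hc1, fun k _ hk => ?_⟩
  have h1 := ENNReal.toReal_mono (lintegral_spineProb_ne_top (A k) (f.lift hk))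
    ((mul_le_mul_left (min_le_left c 1) _).trans (h k hk (A k) (hA k) (hlaw k) (hind k)))
  rw [ENNReal.toReal_mul, ENNReal.toReal_pow, ENNReal.toReal_inv, ENNReal.toReal_natCast,
    inv_pow, ← div_eq_mul_inv] at h1
  exact h1

end Bounds

end AndOr

theorem mainTheorem1 {Ω : Type*} [MeasurableSpace Ω] (μ : Measure Ω) [IsProbabilityMeasure μ]
    -- the random finite trees `T k n`, and the forests `A k i` on the spine of their local limit
    (T : ℕ → ℕ → Ω → AndOr.RTree) (A : ℕ → ℕ → Ω → AndOr.Forest)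
    (hTm : ∀ k n, Measurable (T k n)) (hAm : ∀ k i, Measurable (A k i))
    (hTu : ∀ (k : ℕ) [NeZero k] (n : ℕ), ∀ᵐ ω ∂μ, (T k n ω).NoUnary)
    (hTA : ∀ (k : ℕ) [NeZero k], AndOr.LocallyConverges μ (T k) (A k))
    -- the common law of the forests, which does not depend on `k`
    (α : Measure AndOr.Forest) [IsProbabilityMeasure α]
    (hα : ∀ᵐ F ∂α, F.Admissible)
    (hind : ∀ (k : ℕ) [NeZero k], iIndepFun (A k) μ)
    (hlaw : ∀ (k : ℕ) [NeZero k] (i : ℕ), μ.map (A k i) = α)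
    -- the moments of `L` are bounded uniformly in `k`
    (hL : ∀ m : ℕ, ∃ (B : ℝ≥0) (K : ℕ), ∀ (k : ℕ) [NeZero k], K ≤ k →
      AndOr.momentL k α m ≤ B)
    (hN : ∀ (k : ℕ) [NeZero k] (m : ℕ), 1 ≤ m →
      ∫⁻ ω, (AndOr.SpineTree.numNodesUpTo m (fun i => A k i ω) : ℝ≥0∞) ^ (m + 2) ∂μ < ∞)
    (htrim : ∀ (k : ℕ) [NeZero k] (m : ℕ), 1 ≤ m →
      ∫⁻ ω, ∫⁻ σ, (AndOr.LSpineTree.trimSize σ) ^ m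
        ∂(AndOr.SpineTree.label k fun i => A k i ω) ∂μ < ∞)
    {k₀ : ℕ} (f : AndOr.BoolFun k₀) :
    (∀ (k : ℕ) [NeZero k] (g : AndOr.BoolFun k),
      Tendsto (fun n => AndOr.randomTreeProb k μ (T k n) g) atTop
        (𝓝 (AndOr.limitProb k μ (A k) g))) ∧
    (∃ c C : ℝ, 0 < c ∧ 0 < C ∧ ∃ K : ℕ, ∀ (k : ℕ) [NeZero k] (hk : k₀ ≤ k), K ≤ k →
      (∀ ℓ : ℕ, AndOr.effComplexity α f = ℓ →
        c * (AndOr.limitProb k μ (A k) (AndOr.trueFn k) / (k : ℝ) ^ ℓ) ≤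
          AndOr.limitProb k μ (A k) (f.lift hk)) ∧
      AndOr.limitProb k μ (A k) (f.lift hk) ≤
        C * ((AndOr.limitProb k μ (A k) (AndOr.trueFn k) + 1 / (k : ℝ)) /
          (k : ℝ) ^ AndOr.complexity f)) ∧
    (AndOr.effComplexity α f = AndOr.complexity f →
      ∃ c C : ℝ, 0 < c ∧ 0 < C ∧ ∃ K : ℕ, ∀ (k : ℕ) [NeZero k] (hk : k₀ ≤ k), K ≤ k →
        c / (k : ℝ) ^ (AndOr.complexity f + 1) ≤ AndOr.limitProb k μ (A k) (f.lift hk) ∧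
        AndOr.limitProb k μ (A k) (f.lift hk) ≤
          C / (k : ℝ) ^ (AndOr.complexity f + 1)) := by
  have hmom : ∀ m : ℕ, ∫⁻ F, (F.size : ℝ≥0∞) ^ m ∂α ≠ ∞ := fun m =>
    AndOr.lintegral_size_pow_ne_top (hL m)
  have hp : α {F | F.HasLeaf} ≠ 0 :=
    AndOr.measure_hasLeaf_ne_zero hα hAm hlaw fun k _ => by simpa using htrim k 1 le_rfl
  obtain ⟨C, hC, hupper⟩ := AndOr.exists_limitProb_le hmom hAm hlaw hα f
  have hlower := fun ℓ (hℓ : AndOr.effComplexity α f = (ℓ : ℕ)) =>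
    AndOr.exists_le_limitProb hAm hlaw hind hp f hℓ
  have hpos : ∀ (k : ℕ) [NeZero k], (0 : ℝ) < k := fun k _ => by exact_mod_cast NeZero.pos k
  refine ⟨fun k _ g => AndOr.tendsto_randomTreeProb (hTA k) (hTm k) (hAm k)
    (AndOr.ae_ne_nil hα (hAm k) (hlaw k)) g, ?_, fun hf => ?_⟩
  · -- the bound `ℙ_k(True) ≤ C' / k` turns the bounds of order `k ^ (-(ℓ + 1))` into ratios
    obtain ⟨C', hC', htrue⟩ := AndOr.exists_limitProb_le hmom hAm hlaw hα (AndOr.trueFn k₀)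
    simp only [AndOr.complexity_trueFn, zero_add, pow_one] at htrue
    obtain ⟨c, hc, h⟩ : ∃ c : ℝ, 0 < c ∧ ∀ (k : ℕ) [NeZero k] (hk : k₀ ≤ k) (ℓ : ℕ),
        AndOr.effComplexity α f = ℓ →
          c / (k : ℝ) ^ (ℓ + 1) ≤ AndOr.limitProb k μ (A k) (f.lift hk) := by
      rcases eq_or_ne (AndOr.effComplexity α f) ⊤ with htop | htop
      · exact ⟨1, one_pos, fun k _ hk ℓ hℓ => absurd (htop ▸ hℓ).symm (ENat.natCast_ne_top ℓ)⟩
      · obtain ⟨ℓ, hℓ⟩ := ENat.ne_top_iff_exists.1 htop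
        obtain ⟨c, hc, h⟩ := hlower ℓ hℓ.symm
        refine ⟨c, hc, fun k _ hk ℓ' hℓ' => ?_⟩
        obtain rfl : ℓ = ℓ' := by exact_mod_cast hℓ.trans hℓ'
        exact h k hk
    refine ⟨c / C', C, div_pos hc hC', hC, 0, fun k _ hk _ => ⟨fun ℓ hℓ => ?_, ?_⟩⟩
    · have hk0 := hpos k
      have h1 : AndOr.limitProb k μ (A k) (AndOr.trueFn k) ≤ C' / k := htrue k hk
      refine le_trans ?_ (h k hk ℓ hℓ)
      calc _ ≤ c / C' * (C' / k / (k : ℝ) ^ ℓ) := by gcongr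
        _ = _ := by
          rw [pow_succ]
          field_simp
    · have hk0 := hpos k
      refine (hupper k hk).trans ?_
      have h1 : 0 ≤ AndOr.limitProb k μ (A k) (AndOr.trueFn k) := ENNReal.toReal_nonneg
      calc _ = C * ((0 + 1 / (k : ℝ)) / (k : ℝ) ^ AndOr.complexity f) := by
            rw [pow_succ]
            field_simp
            ring
        _ ≤ _ := by gcongr
  · obtain ⟨c, hc, h⟩ := hlower _ hf
    exact ⟨c, C, hc, hC, 0, fun k _ hk _ => ⟨h k hk, hupper k hk⟩⟩
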